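/- **Setting.** Let $0<U<a$, $M=U/a$, $c=\dfrac{M}{a(1-M^2)}$ and, for $\operatorname{Re}s>0$, $\lambda(s)=-\dfrac{s(1+cU)}{U}$. Let $H_0^{(1)}=J_0+iY_0$ be the Hankel function of the first kind of order $0$ (principal branch), and for real $x,\xi,y$ put $$z=z_s(x,\xi,y)=\frac{is}{a\sqrt{1-M^2}}\sqrt{\frac{(x-\xi)^2}{1-M^2}+y^2}.$$ The kernel of the generalized Possio equation is $$G(x,\xi,s)=\lim_{y\to0^+}\Big[\tfrac{1-M^2}{U}\,\partial_xH_0^{(1)}(z_s(x,\xi,y))+\tfrac{\lambda(s)(1-M^2)}{U}H_0^{(1)}(z_s(x,\xi,y))+\tfrac{e^{\lambda(s)x}}{U}\Big(\lambda(s)^2(1-M^2)-\tfrac{s^2}{a^2(1-M^2)}\Big)\int_{-\infty}^xe^{-\lambda(s)u}H_0^{(1)}(z_s(u,\xi,y))\,du\Big].$$ Let $$K(x,\xi,s)=G(x,\xi,s)-\frac{2i(1-M^2)}{\pi U}\,\frac1{x-\xi}$$ (this has only a logarithmic singularity at $x=\xi$), and let $\mathcal K_s$ be the integral operator on $[-1,1]$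 with kernel $K(x,\xi,s)$. Let $\mathcal T^{-1}[g](x)=-\frac1\pi\,\mathrm{p.v.}\!\int_{-1}^1\sqrt{\frac{1-y^2}{1-x^2}}\,\frac{g(y)}{y-x}\,dy$ be the right inverse of the finite Hilbert transform $\mathcal T[f](x)=\frac1\pi\,\mathrm{p.v.}\!\int_{-1}^1\frac{f(\xi)}{\xi-x}\,d\xi$. Let $\mathcal N_s=\frac{iU}{2(1-M^2)}\,\mathcal K_s\circ\mathcal T^{-1}$, i.e. the integral operator with kernel $$N_s(x,y)=-\frac{iU}{2\pi(1-M^2)}\ \mathrm{p.v.}\!\int_{-1}^1K(x,u,s)\sqrt{\frac{1-y^2}{1-u^2}}\,\frac{du}{y-u}\qquad(x,y\in[-1,1]),$$ extended by $0$ to $\mathbb R^2$. Finally, let $$D_N(s)=1+\sum_{m=1}^\infty\frac1{m!}\int_{\mathbb R}\!\cdots\!\int_{\mathbb R}\det\big[(1-\delta_{ij})N_s(t_i,t_j)\big]_{i,j=1}^m\,dt_1\cdots dt_m$$ be Hilbert's modified Fredholm determinant of $\mathcal N_s$. **Lemma.** Let $0\le\sigma_1<\sigma_2$ and suppose that $D_N(s)\neq0$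 for all $s$ with $\sigma_1<\operatorname{Re}s<\sigma_2$. Then for every $\gamma>0$ there is a constant $C>0$ (depending only on $a,U,\sigma_1,\sigma_2,\gamma$) such that $$\left|\frac1{D_N(s)}\right|<\exp\left\{C\,e^{|\nu|}(1+|\nu|)^4\right\}$$ for all $s=\sigma+i\nu$ with $\sigma_1+\gamma<\sigma<\sigma_2-\gamma$. -/

import Mathlib

open Filter Topology MeasureTheory Set

noncomputable section

namespace Possio

/-- The Bessel function of the first kind of order zero,
`J₀(z) = ∑ₖ (-1)ᵏ (z²/4)ᵏ / (k!)²`. -/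
def besselJ0 (z : ℂ) : ℂ :=
  ∑' k : ℕ, (-1 : ℂ) ^ k * (z ^ 2 / 4) ^ k / ((k.factorial : ℂ) ^ 2)

/-- The Bessel function of the second kind of order zero (principal branch),
`Y₀(z) = (2/π) (log (z/2) + γ) J₀(z) - (2/π) ∑ₖ (-1)ᵏ hₖ (z²/4)ᵏ / (k!)²`, with `γ` the
Euler-Mascheroni constant and `hₖ = 1 + 1/2 + ⋯ + 1/k`. -/
def besselY0 (z : ℂ) : ℂ :=
  (2 / (Real.pi : ℂ)) *
      (Complex.log (z / 2) + (Real.eulerMascheroniConstant : ℂ)) * besselJ0 z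
    - (2 / (Real.pi : ℂ)) *
      ∑' k : ℕ, (-1 : ℂ) ^ k * ((harmonic k : ℚ) : ℂ) * (z ^ 2 / 4) ^ k / ((k.factorial : ℂ) ^ 2)

/-- The Hankel function of the first kind of order zero, `H₀⁽¹⁾ = J₀ + i Y₀`. -/
def hankelH0 (z : ℂ) : ℂ := besselJ0 z + Complex.I * besselY0 z

/-- The Mach number `M = U / a`. -/
def mach (a U : ℝ) : ℝ := U / a

/-- The constant `c = M / (a (1 - M²))`. -/
def cConst (a U : ℝ) : ℝ := mach a U / (a * (1 - mach a U ^ 2))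

/-- `λ(s) = - s (1 + c U) / U`. -/
def lam (a U : ℝ) (s : ℂ) : ℂ := -(s * (1 + (cConst a U : ℂ) * (U : ℂ))) / (U : ℂ)

/-- The argument of the Hankel function,
`z = (i s / (a √(1 - M²))) √((x - ξ)² / (1 - M²) + (y - η)²)`, at `η = 0`. -/
def zArg (a U : ℝ) (s : ℂ) (x ξ y : ℝ) : ℂ :=
  Complex.I * s / ((a * Real.sqrt (1 - mach a U ^ 2) : ℝ) : ℂ) *
    ((Real.sqrt ((x - ξ) ^ 2 / (1 - mach a U ^ 2) + y ^ 2) : ℝ) : ℂ)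

/-- The kernel of the generalized Possio equation before the passage to the limit `y → 0⁺`. -/
def possioPreKernel (a U : ℝ) (s : ℂ) (x ξ y : ℝ) : ℂ :=
  (((1 - mach a U ^ 2) / U : ℝ) : ℂ) * deriv (fun x' : ℝ => hankelH0 (zArg a U s x' ξ y)) x
    + lam a U s * ((1 - mach a U ^ 2 : ℝ) : ℂ) / (U : ℂ) * hankelH0 (zArg a U s x ξ y)
    + Complex.exp (lam a U s * (x : ℂ)) / (U : ℂ) *
        (lam a U s ^ 2 * ((1 - mach a U ^ 2 : ℝ) : ℂ)
          - s ^ 2 / ((a ^ 2 * (1 - mach a U ^ 2) : ℝ) : ℂ)) *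
        ∫ u in Iic x, Complex.exp (-(lam a U s * (u : ℂ))) * hankelH0 (zArg a U s u ξ y)

/-- The kernel of the generalized Possio integral equation. -/
def possioKernel (a U : ℝ) (s : ℂ) (x ξ : ℝ) : ℂ :=
  limUnder (𝓝[>] (0 : ℝ)) (fun y : ℝ => possioPreKernel a U s x ξ y)

/-- The remainder `K(x, ξ, s)` of the Possio kernel after its Cauchy singularity
`(2 i (1 - M²) / (π U)) · 1 / (x - ξ)` is removed; since `H₀⁽¹⁾(z) ∼ (2i/π) log z` at `0`, this is
the coefficient for which the remainder has only a logarithmic singularity at `x = ξ`. -/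
def kernelK (a U : ℝ) (s : ℂ) (x ξ : ℝ) : ℂ :=
  possioKernel a U s x ξ
    - 2 * Complex.I * ((1 - mach a U ^ 2 : ℝ) : ℂ) / ((Real.pi * U : ℝ) : ℂ)
      * (1 / ((x - ξ : ℝ) : ℂ))

/-- The principal value at `u = y` of the integral of `f` over `[-1, 1]`. -/
def pvIntegral (f : ℝ → ℂ) (y : ℝ) : ℂ :=
  limUnder (𝓝[>] (0 : ℝ)) (fun ε : ℝ => ∫ u in {u : ℝ | u ∈ Icc (-1) 1 ∧ ε < |u - y|}, f u)

/-- The kernel on `ℝ²`, supported in `[-1, 1]²`, of the operator `𝒩ₛ = (i U / (2 (1 - M²))) 𝒦ₛ ∘ 𝒯⁻¹`,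
where `𝒦ₛ` is the integral operator with kernel `K(x, ξ, s)` and
`𝒯⁻¹[g](u) = -(1/π) p.v.∫ √((1 - y²) / (1 - u²)) g(y) / (y - u) dy` is the right inverse of the finite
Hilbert transform `𝒯[f](x) = (1/π) p.v.∫ f(ξ) / (ξ - x) dξ`.
Dividing the Possio equation by `-2 i (1 - M²) / U` turns its operator into
`ℛₛ = 𝒯 + (i U / (2 (1 - M²))) 𝒦ₛ`, and `ℛₛ ∘ 𝒯⁻¹ = ℐ + 𝒩ₛ`. -/
def kernelN (a U : ℝ) (s : ℂ) (x y : ℝ) : ℂ :=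
  if x ∈ Icc (-1 : ℝ) 1 ∧ y ∈ Icc (-1 : ℝ) 1 then
    Complex.I * (U : ℂ) / ((2 * (1 - mach a U ^ 2) : ℝ) : ℂ) *
      (-(1 / (Real.pi : ℂ)) *
        pvIntegral (fun u : ℝ => kernelK a U s x u *
          ((Real.sqrt ((1 - y ^ 2) / (1 - u ^ 2)) / (y - u) : ℝ) : ℂ)) y)
  else 0

/-- Hilbert's modified Fredholm determinant `D_{P,m}(t₁, …, tₘ)`: the determinant of the matrix
with entries `P(tᵢ, tⱼ)` off the diagonal and `0` on it. -/
def modDet (P : ℝ → ℝ → ℂ) (m : ℕ) (t : Fin m → ℝ) : ℂ :=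
  Matrix.det (Matrix.of fun i j : Fin m => if i = j then (0 : ℂ) else P (t i) (t j))

/-- The modified Fredholm determinant
`D_P = 1 + ∑_{m ≥ 1} (1/m!) ∫ ⋯ ∫ D_{P,m}(t₁, …, tₘ) dt₁ ⋯ dtₘ`. -/
def fredholmDet (P : ℝ → ℝ → ℂ) : ℂ :=
  1 + ∑' n : ℕ, (1 / ((n + 1).factorial : ℂ)) * ∫ t : Fin (n + 1) → ℝ, modDet P (n + 1) t

/-- The function `D_N(s) = D_{N_s}`. -/
def DN (a U : ℝ) (s : ℂ) : ℂ := fredholmDet (kernelN a U s)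

end Possio

end

noncomputable section

namespace Possio

/-! The argument has two halves: an upper bound for the holomorphic function $D_N$, and a general
principle turning an upper bound into a lower bound on a zero-free strip.

Upper bound. Put $\kappa=s/(a(1-M^2))$. Then $K(x,\xi,s)$ depends only on $t=x-\xi$: it is a
combination of $H_0^{(1)}(i\kappa|t|)$, its regularised derivative, and a wake integral that
converges because $a/U>1$. An energy argument for Bessel's equation bounds $H_0^{(1)}(i\kappa r)$
and its derivative in the whole half-plane $\operatorname{Re}\kappa>0$. Hence $K$ has a modulus of
continuity "logarithm plus square root" with constant $O((1+|s|)^4)$ on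
$\delta\le\operatorname{Re}s\le L$ (`exists_norm_diffKernel_sub_le`). With $y=\tanh b$,
$u=\tanh(b-v)$ the weighted Cauchy kernel becomes $dv/\sinh v$, and symmetrising in $v$ gives an
absolutely convergent integral. The majorant of its logarithmic part is $\omega^{-1}W(v/\omega)$
with $\omega=|\operatorname{artanh}x-\operatorname{artanh}y|$, whose integral does not depend on
$\omega$; so $N_s$ is bounded off the diagonal and the boundary of the square
(`exists_norm_regKernelN_le`). Hadamard's inequality then gives $|D_N|\le\exp(1+24B^2)$ for a kernel
bounded by $B$, that is, $\exp(C(1+|\nu|)^8)$, and dominated convergence makes $D_N$ holomorphic.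

Lower bound. For $|f|\le e^A$ consider the deficit $A-\log|f|$. The maximum principle for a product
of sixteen rotated copies of $f$ shows that the deficit at the centre of a disc grows at most
16-fold at some point near any prescribed point of the circle; no absence of zeros is needed. Discs
inside the strip are too small to travel a height $|\nu|$ cheaply, so the chain first moves right by
14, climbs in steps of length 6, and returns in boundedly many small steps. Climbing costs about
$16^{|\nu|/6}\le e^{|\nu|/2}$, and the polynomial $A$ is absorbed by another $e^{|\nu|/2}$. The
chain ends near $s$, not at $s$; Borel–Carathéodory in a zero-free disc closes the gap
(`exists_norm_inv_lt_of_zero_free_strip`). -/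

/-! ### Propagation of lower bounds for holomorphic functions -/

/-- Consecutive rotations differ by the angle $2\pi/16<2/5$, so rounding the angle from $\zeta$ to
$\tau$ down to a multiple of it moves the point by less than $2r/5$. -/
theorem exists_rotation_near {ζ τ : ℂ} {r : ℝ} (hr : 0 < r) (hζ : ‖ζ‖ = r) (hτ : ‖τ‖ = r) :
    ∃ k ∈ Finset.range 16,
      ‖Complex.exp (Complex.I * ((2 * Real.pi * k / 16 : ℝ) : ℂ)) * ζ - τ‖ ≤ 2 / 5 * r := by
  have hζ0 : ζ ≠ 0 := by rintro rfl; simp at hζ; linarith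
  have hτ0 : τ ≠ 0 := by rintro rfl; simp at hτ; linarith
  obtain ⟨θ, hθ0, hθ1, hθ⟩ : ∃ θ : ℝ, 0 ≤ θ ∧ θ < 2 * Real.pi ∧
      τ = Complex.exp (Complex.I * (θ : ℂ)) * ζ := by
    have key : τ = Complex.exp (Complex.I * ((τ / ζ).arg : ℂ)) * ζ := by
      have h := Complex.norm_mul_exp_arg_mul_I (τ / ζ)
      rw [norm_div, hζ, hτ, div_self hr.ne'] at h
      rw [mul_comm Complex.I]
      simp only [Complex.ofReal_one, one_mul] at h
      rw [h]; field_simp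
    rcases le_or_gt 0 (τ / ζ).arg with h | h
    · exact ⟨_, h, by linarith [Complex.arg_le_pi (τ / ζ), Real.pi_pos], key⟩
    · refine ⟨(τ / ζ).arg + 2 * Real.pi, by linarith [Complex.neg_pi_lt_arg (τ / ζ)],
        by linarith, ?_⟩
      conv_lhs => rw [key]
      congr 1
      push_cast
      rw [mul_add, Complex.exp_add, show Complex.I * (2 * (Real.pi : ℂ)) = 2 * Real.pi * Complex.I
        by ring, Complex.exp_two_pi_mul_I, mul_one]
  have hpi := Real.pi_pos
  set k : ℕ := ⌊θ * 16 / (2 * Real.pi)⌋₊ with hk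
  have hnn : 0 ≤ θ * 16 / (2 * Real.pi) := by positivity
  have hk1 : (k : ℝ) ≤ θ * 16 / (2 * Real.pi) := Nat.floor_le hnn
  have hk2 : θ * 16 / (2 * Real.pi) < k + 1 := Nat.lt_floor_add_one _
  rw [le_div_iff₀ (by positivity)] at hk1
  rw [div_lt_iff₀ (by positivity)] at hk2
  refine ⟨k, ?_, ?_⟩
  · rw [Finset.mem_range]
    have : (k : ℝ) < 16 := by nlinarith
    exact_mod_cast this
  · set α : ℝ := 2 * Real.pi * k / 16
    have e : Complex.exp (Complex.I * (α : ℂ)) * ζ - τ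
        = Complex.exp (Complex.I * (θ : ℂ)) * (Complex.exp (Complex.I * ((α - θ : ℝ) : ℂ)) - 1) * ζ := by
      rw [hθ, mul_sub, ← Complex.exp_add]
      push_cast
      ring_nf
    rw [e, norm_mul, norm_mul, hζ, mul_comm Complex.I (θ : ℂ), Complex.norm_exp_ofReal_mul_I, one_mul]
    gcongr
    refine (Real.norm_exp_I_mul_ofReal_sub_one_le).trans ?_
    rw [Real.norm_eq_abs, abs_le]
    have h4 := Real.pi_lt_d2
    constructor <;> simp only [α] <;> nlinarith

/-- A lower bound for `|f|` at the centre of a disc propagates to some point of the boundary circle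
close to a prescribed one. -/
theorem exists_norm_pow_le_on_circle {f : ℂ → ℂ} {c T : ℂ} {A : ℝ} {V : Set ℂ}
    (hf : DifferentiableOn ℂ f V) (hb : Metric.closedBall c ‖T - c‖ ⊆ V) (hr : 0 < ‖T - c‖)
    (hA : ∀ z ∈ Metric.closedBall c ‖T - c‖, ‖f z‖ ≤ Real.exp A) :
    ∃ T' ∈ Metric.closedBall c ‖T - c‖, ‖T' - T‖ ≤ 2 / 5 * ‖T - c‖ ∧
      ‖f c‖ ^ 16 ≤ ‖f T'‖ * Real.exp (15 * A) := by
  set r := ‖T - c‖ with hr_def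
  set S : Set ℂ := Metric.closedBall c r ∩ Metric.closedBall T (2 / 5 * r)
  have hSc : IsCompact S := (isCompact_closedBall _ _).inter_right Metric.isClosed_closedBall
  have hSn : S.Nonempty := ⟨T, by simp [S, hr_def, dist_eq_norm]⟩
  obtain ⟨T', hT'S, hmax⟩ := hSc.exists_isMaxOn hSn
    (f := fun z => ‖f z‖) ((hf.continuousOn.mono (inter_subset_left.trans hb)).norm)
  refine ⟨T', hT'S.1, by simpa [dist_eq_norm] using hT'S.2, ?_⟩
  -- The product $g$ of the sixteen rotated copies has $g(0)=f(c)^{16}$. At each point of the circle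
  -- one factor is evaluated in `S`, hence is at most $|f(T')|$, and the other fifteen are at most
  -- $e^A$.
  set ω : ℕ → ℂ := fun k => Complex.exp (Complex.I * ((2 * Real.pi * k / 16 : ℝ) : ℂ))
  have hω : ∀ k, ‖ω k‖ = 1 := fun k => by
    simp only [ω]; rw [mul_comm, Complex.norm_exp_ofReal_mul_I]
  set g : ℂ → ℂ := fun ζ => ∏ k ∈ Finset.range 16, f (c + ω k * ζ)
  have hmem : ∀ k, ∀ ζ ∈ Metric.closedBall (0 : ℂ) r, c + ω k * ζ ∈ Metric.closedBall c r := by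
    intro k ζ hζ
    simpa [dist_eq_norm, hω] using hζ
  have hgd : DifferentiableOn ℂ g (Metric.closedBall 0 r) := by
    refine DifferentiableOn.fun_finsetProd fun k _ => ?_
    exact hf.comp (by fun_prop) fun ζ hζ => hb (hmem k ζ hζ)
  have hcl : closure (Metric.ball (0 : ℂ) r) = Metric.closedBall 0 r := closure_ball _ hr.ne'
  have hd : DiffContOnCl ℂ g (Metric.ball 0 r) :=
    DifferentiableOn.diffContOnCl (by rw [hcl]; exact hgd)
  have hfr : ∀ ζ ∈ frontier (Metric.ball (0 : ℂ) r), ‖g ζ‖ ≤ ‖f T'‖ * Real.exp (15 * A) := by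
    intro ζ hζ
    rw [frontier_ball _ hr.ne', mem_sphere_zero_iff_norm] at hζ
    obtain ⟨k, hk, hkn⟩ := exists_rotation_near hr hζ (τ := T - c) rfl
    have hζ' : ζ ∈ Metric.closedBall (0 : ℂ) r := by simp [hζ]
    rw [norm_prod, ← Finset.mul_prod_erase _ _ hk]
    have h1 : ‖f (c + ω k * ζ)‖ ≤ ‖f T'‖ := by
      refine hmax ⟨hmem k ζ hζ', ?_⟩
      rw [Metric.mem_closedBall, dist_eq_norm]
      rwa [show c + ω k * ζ - T = ω k * ζ - (T - c) by ring]
    have h2 : ∏ j ∈ (Finset.range 16).erase k, ‖f (c + ω j * ζ)‖ ≤ Real.exp (15 * A) := by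
      calc _ ≤ ∏ j ∈ (Finset.range 16).erase k, Real.exp A :=
            Finset.prod_le_prod (fun _ _ => norm_nonneg _) fun j _ => hA _ (hmem j ζ hζ')
        _ = Real.exp (15 * A) := by
            rw [Finset.prod_const, Finset.card_erase_of_mem hk, Finset.card_range,
              ← Real.exp_nat_mul]
            norm_num
    exact mul_le_mul h1 h2 (Finset.prod_nonneg fun _ _ => norm_nonneg _) (norm_nonneg _)
  have := Complex.norm_le_of_forall_mem_frontier_norm_le Metric.isBounded_ball hd hfr
    (z := 0) (subset_closure (Metric.mem_ball_self hr))
  simpa [g, norm_prod] using this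

/-- The deficit `A - log |f|` grows at most by the factor `16` from one circle to a point near
a prescribed point of the next. -/
theorem exists_deficit_step {f : ℂ → ℂ} {c T : ℂ} {A R : ℝ} {V : Set ℂ} 
    (hf : DifferentiableOn ℂ f V) (hb : Metric.closedBall c R ⊆ V) (hTR : ‖T - c‖ ≤ R)
    (hA : ∀ z ∈ Metric.closedBall c R, ‖f z‖ ≤ Real.exp A) (hfc : f c ≠ 0) :
    ∃ T', ‖T' - T‖ ≤ 2 / 5 * R ∧ f T' ≠ 0 ∧
      A - Real.log ‖f T'‖ ≤ 16 * (A - Real.log ‖f c‖) := by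
  have hu : Real.log ‖f c‖ ≤ A := by
    rw [Real.log_le_iff_le_exp (norm_pos_iff.2 hfc)]
    exact hA c (Metric.mem_closedBall_self ((norm_nonneg _).trans hTR))
  rcases (norm_nonneg (T - c)).eq_or_lt with h0 | h0
  · refine ⟨c, ?_, hfc, by linarith⟩
    rw [norm_sub_rev, ← h0]; linarith
  · have hsub := Metric.closedBall_subset_closedBall (x := c) hTR
    obtain ⟨T', -, h2, h3⟩ := exists_norm_pow_le_on_circle hf (hsub.trans hb) h0
      fun z hz => hA z (hsub hz)
    have hfT' : f T' ≠ 0 := by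
      intro h
      rw [h, norm_zero, zero_mul] at h3
      exact absurd h3 (not_le.2 (pow_pos (norm_pos_iff.2 hfc) _))
    refine ⟨T', by linarith, hfT', ?_⟩
    have := Real.log_le_log (pow_pos (norm_pos_iff.2 hfc) 16) h3
    rw [Real.log_pow, Real.log_mul (norm_ne_zero_iff.2 hfT') (Real.exp_ne_zero _), Real.log_exp]
      at this
    push_cast at this
    linarith

/-- Propagation of the deficit along a segment, in `n` steps of length at most `h`. -/
theorem exists_deficit_chain {f : ℂ → ℂ} {A h : ℝ} {V W : Set ℂ} 
    (hf : DifferentiableOn ℂ f V) (hWV : W ⊆ V) (hA : ∀ z ∈ W, ‖f z‖ ≤ Real.exp A)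
    (n : ℕ) : ∀ P Q c : ℂ, ‖Q - P‖ ≤ n * h → ‖c - P‖ ≤ 2 / 3 * h →
      (∀ z ∈ segment ℝ P Q, Metric.closedBall z (7 / 3 * h) ⊆ W) → f c ≠ 0 →
      ∃ c', ‖c' - Q‖ ≤ 2 / 3 * h ∧ f c' ≠ 0 ∧
        A - Real.log ‖f c'‖ ≤ 16 ^ n * (A - Real.log ‖f c‖) := by
  induction n with
  | zero =>
    intro P Q c hPQ hc _ hfc
    have : Q = P := by
      have : ‖Q - P‖ ≤ 0 := by simpa using hPQ
      exact sub_eq_zero.1 (norm_le_zero_iff.1 this)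
    exact ⟨c, by rwa [this], hfc, by simp⟩
  | succ n ih =>
    intro P Q c hPQ hc hW hfc
    -- The error $2h/3$ reproduces itself: $P'$ is within $5h/3$ of $c$, and the new error is
    -- $\frac25\cdot\frac53h=\frac23h$. The disc used lies within $\frac23h+\frac53h=\frac73h$ of
    -- $P$.
    set P' : ℂ := P + (1 / (n + 1 : ℝ)) • (Q - P) with hP'
    have hn : (0 : ℝ) < n + 1 := by positivity
    have hn0 : (n + 1 : ℝ) ≠ 0 := hn.ne'
    have h01 : (1 / (n + 1 : ℝ)) ∈ Icc (0 : ℝ) 1 :=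
      ⟨by positivity, by rw [div_le_one hn]; linarith [n.cast_nonneg (α := ℝ)]⟩
    have hP's : P' ∈ segment ℝ P Q := by
      rw [segment_eq_image']
      exact ⟨_, h01, rfl⟩
    push_cast at hPQ
    have h1 : ‖P' - P‖ ≤ h := by
      rw [hP', add_sub_cancel_left, norm_smul, Real.norm_of_nonneg h01.1]
      rw [div_mul_eq_mul_div, one_mul, div_le_iff₀ hn]; linarith
    have h2 : ‖Q - P'‖ ≤ n * h := by
      have : Q - P' = ((n : ℝ) / (n + 1)) • (Q - P) := by
        have e : (n : ℝ) / (n + 1) = 1 - 1 / (n + 1) := by field_simp; ring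
        rw [hP', e, sub_smul, one_smul]; ring
      rw [this, norm_smul, Real.norm_of_nonneg (by positivity)]
      rw [div_mul_eq_mul_div, div_le_iff₀ hn]
      nlinarith [n.cast_nonneg (α := ℝ)]
    have hcb : Metric.closedBall c (5 / 3 * h) ⊆ W := by
      refine Subset.trans ?_ (hW P (left_mem_segment ℝ P Q))
      intro z hz
      rw [Metric.mem_closedBall, dist_eq_norm] at hz ⊢
      calc ‖z - P‖ = ‖(z - c) + (c - P)‖ := by ring_nf
        _ ≤ _ := norm_add_le _ _
        _ ≤ _ := by linarith
    have hT : ‖P' - c‖ ≤ 5 / 3 * h := by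
      calc ‖P' - c‖ = ‖(P' - P) - (c - P)‖ := by ring_nf
        _ ≤ _ := norm_sub_le _ _
        _ ≤ _ := by linarith
    obtain ⟨c', hc', hfc', hu'⟩ := exists_deficit_step hf (hcb.trans hWV) hT
      (fun z hz => hA z (hcb hz)) hfc
    obtain ⟨c'', hc'', hfc'', hu''⟩ := ih P' Q c' h2 (by linarith)
      (fun z hz => hW z ((convex_segment P Q).segment_subset hP's (right_mem_segment ℝ P Q) hz)) hfc'
    refine ⟨c'', hc'', hfc'', hu''.trans ?_⟩
    rw [pow_succ, mul_assoc]
    gcongr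

/-- In a zero-free disc the deficit at a point is controlled by the one at the centre. -/
theorem deficit_le_of_zero_free {f : ℂ → ℂ} {c z : ℂ} {A R : ℝ} (hR : 0 < R)
    (hf : DifferentiableOn ℂ f (Metric.ball c R))
    (hA : ∀ w ∈ Metric.ball c R, ‖f w‖ ≤ Real.exp A) (h0 : ∀ w ∈ Metric.ball c R, f w ≠ 0)
    (hz : ‖z - c‖ ≤ R / 3) :
    A - Real.log ‖f z‖ ≤ 2 * (A - Real.log ‖f c‖) := by
  have hball := Metric.isOpen_ball (x := c) (ε := R)
  have hcm : c ∈ Metric.ball c R := Metric.mem_ball_self hR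
  have hdl : DifferentiableOn ℂ (fun w => deriv f w / f w) (Metric.ball c R) :=
    (hf.deriv hball).div hf h0
  -- A primitive of $f'/f$, normalised to vanish at $c$, serves as $\log(f/f(c))$.
  obtain ⟨g₀, hg₀⟩ := hdl.isExactOn_ball
  set g : ℂ → ℂ := fun w => g₀ w - g₀ c
  have hg : ∀ w ∈ Metric.ball c R, HasDerivAt g (deriv f w / f w) w := fun w hw =>
    (hg₀ w hw).sub_const _
  have hfd : ∀ w ∈ Metric.ball c R, HasDerivAt f (deriv f w) w := fun w hw =>
    ((hf w hw).differentiableAt (hball.mem_nhds hw)).hasDerivAt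
  have hconst : ∀ w ∈ Metric.ball c R, f w * Complex.exp (-g w) = f c := by
    intro w hw
    have hder : ∀ w ∈ Metric.ball c R, HasDerivAt (fun w => f w * Complex.exp (-g w)) 0 w := by
      intro w hw
      have := (hfd w hw).mul ((hg w hw).neg.cexp)
      refine this.congr_deriv ?_
      have h0w := h0 w hw
      field_simp
      ring
    have := (convex_ball c R).is_const_of_fderivWithin_eq_zero (𝕜 := ℂ)
      (f := fun w => f w * Complex.exp (-g w))
      (fun w hw => (hder w hw).differentiableAt.differentiableWithinAt)
      (fun w hw => by
        rw [fderivWithin_of_isOpen hball hw]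
        ext
        simp [(hder w hw).deriv]) hw hcm
    simpa [g] using this
  have hlog : ∀ w ∈ Metric.ball c R, Real.log ‖f w‖ = Real.log ‖f c‖ + (g w).re := by
    intro w hw
    have h1 : f w = f c * Complex.exp (g w) := by
      rw [← hconst w hw, mul_assoc, ← Complex.exp_add]; simp
    rw [h1, norm_mul, Complex.norm_exp, Real.log_mul (norm_ne_zero_iff.2 (h0 c hcm))
      (Real.exp_ne_zero _), Real.log_exp]
  have hle : ∀ w ∈ Metric.ball c R, Real.log ‖f w‖ ≤ A := fun w hw => by
    rw [Real.log_le_iff_le_exp (norm_pos_iff.2 (h0 w hw))]; exact hA w hw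
  have hzm : z ∈ Metric.ball c R := by
    rw [Metric.mem_ball, dist_eq_norm]; linarith
  -- Borel–Carathéodory needs a strictly positive bound for the real part, whereas the deficit at
  -- $c$ may be zero.
  refine le_of_forall_pos_le_add fun ε hε => ?_
  have hM : 0 < A - Real.log ‖f c‖ + ε := by linarith [hle c hcm]
  have hadd : ∀ w ∈ Metric.ball (0 : ℂ) R, c + w ∈ Metric.ball c R := fun w hw => by
    simpa [dist_eq_norm] using hw
  have hBC := Complex.borelCaratheodory_zero (f := fun w => g (c + w)) (R := R) (z := z - c) hM
    (fun w hw => ((hg _ (hadd w hw)).differentiableAt.comp w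
      (by fun_prop : DifferentiableAt ℂ (fun w => c + w) w)).differentiableWithinAt)
    (fun w hw => by
      have := hlog _ (hadd w hw)
      have := hle _ (hadd w hw)
      simp only [Set.mem_ofPred_eq]; linarith) hR (by simpa [dist_eq_norm] using hzm) (by simp [g])
  simp only [add_sub_cancel] at hBC
  -- For $|z-c|\le R/3$ the factor $2|z-c|/(R-|z-c|)$ is at most 1.
  have h3 : 2 * (A - Real.log ‖f c‖ + ε) * ‖z - c‖ / (R - ‖z - c‖) ≤ A - Real.log ‖f c‖ + ε := by
    rw [div_le_iff₀ (by linarith)]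
    nlinarith
  have h4 := hlog z hzm
  have h5 := (abs_le.1 ((Complex.abs_re_le_norm (g z)).trans (hBC.trans h3))).1
  linarith

theorem closedBall_subset_rect {P Q : ℂ} {ρ δ L Y : ℝ}
    (hP : δ + ρ ≤ P.re ∧ P.re ≤ L - ρ ∧ |P.im| ≤ Y - ρ)
    (hQ : δ + ρ ≤ Q.re ∧ Q.re ≤ L - ρ ∧ |Q.im| ≤ Y - ρ) :
    ∀ z ∈ segment ℝ P Q, Metric.closedBall z ρ ⊆ {w : ℂ | δ ≤ w.re ∧ w.re ≤ L ∧ |w.im| ≤ Y} := by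
  rintro z ⟨a, b, ha, hb, hab, rfl⟩ w hw
  rw [Metric.mem_closedBall, dist_eq_norm] at hw
  have h1 := abs_le.1 ((Complex.abs_re_le_norm _).trans hw)
  have h2 := abs_le.1 ((Complex.abs_im_le_norm _).trans hw)
  have h3 := abs_le.1 hP.2.2
  have h4 := abs_le.1 hQ.2.2
  obtain rfl : b = 1 - a := by linarith
  simp only [Complex.sub_re, Complex.add_re, Complex.sub_im, Complex.add_im, Complex.real_smul,
    Complex.mul_re, Complex.mul_im, Complex.ofReal_re, Complex.ofReal_im, zero_mul, sub_zero,
    add_zero] at h1 h2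
  refine ⟨by nlinarith, by nlinarith, abs_le.2 ⟨by nlinarith, by nlinarith⟩⟩

set_option maxHeartbeats 1000000 in
/-- A holomorphic function on the right half-plane, of finite exponential order in vertical strips,
and without zeros in a strip, is bounded below there. -/
theorem exists_norm_inv_lt_of_zero_free_strip {f : ℂ → ℂ} {σ₁ σ₂ γ : ℝ} (hσ₁ : 0 ≤ σ₁) (hγ : 0 < γ)
    (hf : DifferentiableOn ℂ f {s | 0 < s.re})
    (hbd : ∀ δ L : ℝ, 0 < δ → ∃ C : ℝ, 0 ≤ C ∧ ∃ p : ℕ, ∀ s : ℂ, δ ≤ s.re → s.re ≤ L →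
      ‖f s‖ ≤ Real.exp (C * (1 + |s.im|) ^ p))
    (h0 : ∀ s : ℂ, σ₁ < s.re → s.re < σ₂ → f s ≠ 0) :
    ∃ C : ℝ, 0 < C ∧ ∀ s : ℂ, σ₁ + γ < s.re → s.re < σ₂ - γ →
      ‖1 / f s‖ < Real.exp (C * Real.exp |s.im| * (1 + |s.im|) ^ 4) := by
  rcases le_or_gt (σ₂ - γ) (σ₁ + γ) with hemp | hne
  · exact ⟨1, one_pos, fun s h1 h2 => by linarith⟩
  -- The slack 40 leaves room for the shift by 14 together with discs of radius 14 around the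
  -- shifted path.
  set L := σ₂ + 40 + γ with hL
  obtain ⟨C, hC, p, hCp⟩ := hbd (γ / 4) L (by linarith)
  set s₀ : ℂ := (((σ₁ + σ₂) / 2 : ℝ) : ℂ) with hs₀
  have hs₀re : s₀.re = (σ₁ + σ₂) / 2 := Complex.ofReal_re _
  have hs₀im : s₀.im = 0 := Complex.ofReal_im _
  have hfs₀ : f s₀ ≠ 0 := h0 _ (by rw [hs₀re]; linarith) (by rw [hs₀re]; linarith)
  -- The small step: discs of radius $\frac73h\le\frac7{12}\gamma$ about points with real part at
  -- least $\gamma$ stay in $\operatorname{Re}\ge\gamma/4$.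
  set h : ℝ := min (γ / 4) 1 with hh
  have hh0 : 0 < h := by positivity
  have hhγ : h ≤ γ / 4 := min_le_left _ _
  have hh1 : h ≤ 1 := min_le_right _ _
  -- Enough small steps for length 18: the shift 14 plus the error $\frac23\cdot6=4$ left by the
  -- climb.
  set n₀ : ℕ := ⌈18 / h⌉₊ with hn₀
  have hn₀h : 18 ≤ n₀ * h := by
    have := Nat.le_ceil (18 / h)
    rwa [div_le_iff₀ hh0] at this
  set D := σ₂ - σ₁ with hD
  set B : ℝ := |Real.log ‖f s₀‖| with hB
  set K : ℝ := 2 * 16 ^ n₀ * 16 ^ n₀ * (16 * Real.exp (D / 2)) *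
    (C * (2 ^ p * p.factorial * Real.exp ((41 + γ) / 2)) + B) with hK
  have hK0 : 0 ≤ K := by positivity
  refine ⟨K + 1, by linarith, fun s hs1 hs2 => ?_⟩
  set ν := |s.im| with hν
  have hν0 : 0 ≤ ν := abs_nonneg _
  have hfs : f s ≠ 0 := h0 s (by linarith) (by linarith)
  set Y := ν + 40 + γ with hY
  set A := C * (1 + Y) ^ p with hA
  have hA0 : 0 ≤ A := by positivity
  set W : Set ℂ := {w : ℂ | γ / 4 ≤ w.re ∧ w.re ≤ L ∧ |w.im| ≤ Y} with hW
  have hWV : W ⊆ {s : ℂ | 0 < s.re} := fun w hw => by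
    have := hw.1
    simp only [Set.mem_ofPred_eq]; linarith
  have hfA : ∀ w ∈ W, ‖f w‖ ≤ Real.exp A := fun w hw => by
    refine (hCp w hw.1 hw.2.1).trans (Real.exp_le_exp.2 ?_)
    have := hw.2.2
    rw [hA]
    gcongr
  have e14 : ∀ z : ℂ, (z + 14).re = z.re + 14 ∧ (z + 14).im = z.im := fun z => by simp
  obtain ⟨c₁, hc₁, hfc₁, hu₁⟩ := exists_deficit_chain (h := h) hf hWV hfA n₀ s₀ (s₀ + 14) s₀
    (by simp; linarith) (by simp; positivity)
    (closedBall_subset_rect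
      ⟨by linarith, by linarith, by rw [hs₀im, abs_zero]; linarith⟩
      ⟨by rw [(e14 _).1]; linarith, by rw [(e14 _).1]; linarith,
        by rw [(e14 _).2, hs₀im, abs_zero]; linarith⟩) hfs₀
  set n₁ : ℕ := ⌈(ν + D) / 6⌉₊ with hn₁
  have hn₁6 : ν + D ≤ n₁ * 6 := by
    have := Nat.le_ceil ((ν + D) / 6)
    rwa [div_le_iff₀ (by norm_num)] at this
  -- The climb uses steps of length 6, whose discs have radius $\frac73\cdot6=14$; this is the
  -- reason for the shift by 14.
  obtain ⟨c₂, hc₂, hfc₂, hu₂⟩ := exists_deficit_chain (h := 6) hf hWV hfA n₁ (s₀ + 14) (s + 14) c₁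
    (by
      refine le_trans ?_ hn₁6
      have : s + 14 - (s₀ + 14) = s - s₀ := by ring
      rw [this]
      refine (Complex.norm_le_abs_re_add_abs_im _).trans ?_
      rw [Complex.sub_re, Complex.sub_im, hs₀re, hs₀im, sub_zero, add_comm]
      gcongr
      rw [abs_le]; constructor <;> linarith)
    (by linarith)
    (closedBall_subset_rect
      ⟨by rw [(e14 _).1]; linarith, by rw [(e14 _).1]; linarith,
        by rw [(e14 _).2, hs₀im, abs_zero]; linarith⟩
      ⟨by rw [(e14 _).1]; linarith, by rw [(e14 _).1]; linarith,
        by rw [(e14 _).2]; linarith⟩) hfc₁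
  have hc₂n : ‖c₂ - (s + 14)‖ ≤ 4 := by linarith
  have hc₂re := abs_le.1 ((Complex.abs_re_le_norm _).trans hc₂n)
  have hc₂im := abs_le.1 ((Complex.abs_im_le_norm _).trans hc₂n)
  rw [Complex.sub_re, (e14 _).1] at hc₂re
  rw [Complex.sub_im, (e14 _).2] at hc₂im
  -- The return starts at $c_2$ itself, so its initial error is zero, and it ends within
  -- $\frac23h\le\gamma/6$ of $s$. The disc of radius $\gamma/2$ about $c_3$ then stays within
  -- $\frac23\gamma$ of $s$, inside the zero-free strip.
  obtain ⟨c₃, hc₃, hfc₃, hu₃⟩ := exists_deficit_chain (h := h) hf hWV hfA n₀ c₂ s c₂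
    (by
      refine le_trans ?_ hn₀h
      calc ‖s - c₂‖ = ‖-(c₂ - (s + 14)) - 14‖ := by ring_nf
        _ ≤ _ := norm_sub_le _ _
        _ ≤ _ := by rw [norm_neg]; norm_num; linarith)
    (by simp; positivity)
    (closedBall_subset_rect
      ⟨by linarith, by linarith,
        by
          have := abs_le.1 (le_refl |s.im|)
          rw [abs_le]; constructor <;> linarith⟩
      ⟨by linarith, by linarith, by linarith⟩) hfc₂
  have hc₃γ : ‖c₃ - s‖ ≤ γ / 6 := by linarith
  have hball : ∀ w ∈ Metric.ball c₃ (γ / 2), ‖w - s‖ ≤ 2 / 3 * γ := fun w hw => by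
    rw [Metric.mem_ball, dist_eq_norm] at hw
    calc ‖w - s‖ = ‖(w - c₃) + (c₃ - s)‖ := by ring_nf
      _ ≤ _ := norm_add_le _ _
      _ ≤ _ := by linarith
  have hballre : ∀ w ∈ Metric.ball c₃ (γ / 2), s.re - 2 / 3 * γ ≤ w.re ∧ w.re ≤ s.re + 2 / 3 * γ :=
    fun w hw => by
      have := abs_le.1 ((Complex.abs_re_le_norm _).trans (hball w hw))
      rw [Complex.sub_re] at this
      constructor <;> linarith
  have hballW : ∀ w ∈ Metric.ball c₃ (γ / 2), w ∈ W := fun w hw => by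
    have h2 := hballre w hw
    have h1 := abs_le.1 ((Complex.abs_im_le_norm _).trans (hball w hw))
    have h3 := abs_le.1 (le_refl |s.im|)
    rw [Complex.sub_im] at h1
    exact ⟨by linarith, by linarith, abs_le.2 ⟨by linarith, by linarith⟩⟩
  have hu₄ := deficit_le_of_zero_free (z := s) (half_pos hγ)
    (hf.mono fun w hw => hWV (hballW w hw)) (fun w hw => hfA w (hballW w hw))
    (fun w hw => h0 w (by linarith [(hballre w hw).1]) (by linarith [(hballre w hw).2]))
    (by rw [norm_sub_rev]; linarith)
  -- Since $\log16\le3$, a climb with step 6 costs at most $e^{|\nu|/2}$ up to a constant, which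
  -- leaves a second factor $e^{|\nu|/2}$ for $A$.
  have h16 : (16 : ℝ) ^ n₁ ≤ 16 * Real.exp (D / 2) * Real.exp (ν / 2) := by
    have hl : Real.log 16 ≤ 3 := by
      rw [show (16 : ℝ) = 2 ^ 4 by norm_num, Real.log_pow]
      have := Real.log_two_lt_d9
      push_cast; linarith
    have hlp : 0 ≤ Real.log 16 := Real.log_nonneg (by norm_num)
    have hνD : 0 ≤ (ν + D) / 6 := by linarith
    have hc : (n₁ : ℝ) ≤ (ν + D) / 6 + 1 := (Nat.ceil_lt_add_one hνD).le
    calc (16 : ℝ) ^ n₁ = Real.exp (n₁ * Real.log 16) := by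
          rw [Real.exp_nat_mul, Real.exp_log (by norm_num)]
      _ ≤ Real.exp (Real.log 16 + D / 2 + ν / 2) := by
          rw [Real.exp_le_exp]
          nlinarith
      _ = _ := by rw [Real.exp_add, Real.exp_add, Real.exp_log (by norm_num)]
  have hApow : A ≤ C * (2 ^ p * p.factorial * Real.exp ((41 + γ) / 2)) * Real.exp (ν / 2) := by
    have h1 := Real.pow_div_factorial_le_exp ((1 + Y) / 2) (by positivity) p
    rw [div_le_iff₀ (by positivity), div_pow, div_le_iff₀ (by positivity)] at h1
    have h2 : Real.exp ((1 + Y) / 2) = Real.exp ((41 + γ) / 2) * Real.exp (ν / 2) := by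
      rw [← Real.exp_add]; congr 1; rw [hY]; ring
    rw [h2] at h1
    calc A ≤ C * (Real.exp ((41 + γ) / 2) * Real.exp (ν / 2) * ↑p.factorial * 2 ^ p) := by
          rw [hA]; gcongr
      _ = _ := by ring
  have he1 : 1 ≤ Real.exp (ν / 2) := Real.one_le_exp (by positivity)
  have hu₀ : A - Real.log ‖f s₀‖ ≤
      (C * (2 ^ p * p.factorial * Real.exp ((41 + γ) / 2)) + B) * Real.exp (ν / 2) := by
    have h1 : -Real.log ‖f s₀‖ ≤ B := neg_le_abs _
    have h2 : B ≤ B * Real.exp (ν / 2) := le_mul_of_one_le_right (abs_nonneg _) he1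
    linarith
  have hs₀W : s₀ ∈ W := ⟨by linarith, by linarith, by rw [hs₀im, abs_zero]; linarith⟩
  have hnn : 0 ≤ A - Real.log ‖f s₀‖ := by
    have := (Real.log_le_iff_le_exp (norm_pos_iff.2 hfs₀)).2 (hfA _ hs₀W)
    linarith
  have hfin : -Real.log ‖f s‖ ≤ K * Real.exp ν := by
    calc -Real.log ‖f s‖ ≤ A - Real.log ‖f s‖ := by linarith
      _ ≤ 2 * (16 ^ n₀ * (16 ^ n₁ * (16 ^ n₀ * (A - Real.log ‖f s₀‖)))) := by
          refine hu₄.trans ?_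
          gcongr
          refine hu₃.trans ?_
          gcongr
          refine hu₂.trans ?_
          gcongr
      _ ≤ 2 * (16 ^ n₀ * ((16 * Real.exp (D / 2) * Real.exp (ν / 2)) * (16 ^ n₀ *
          ((C * (2 ^ p * p.factorial * Real.exp ((41 + γ) / 2)) + B) * Real.exp (ν / 2))))) := by
          have : 0 ≤ (C * (2 ^ p * p.factorial * Real.exp ((41 + γ) / 2)) + B) * Real.exp (ν / 2) := by
            positivity
          gcongr
      _ = K * (Real.exp (ν / 2) * Real.exp (ν / 2)) := by rw [hK]; ring
      _ = K * Real.exp ν := by rw [← Real.exp_add, add_halves]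
  -- The bound obtained is $\exp(Ke^{|\nu|})$; the factor $(1+|\nu|)^4$ is only a weakening, and
  -- $K+1$ makes the inequality strict.
  have h1p : 1 ≤ (1 + ν) ^ 4 := one_le_pow₀ (by linarith)
  have hE : 0 < Real.exp ν := Real.exp_pos _
  calc ‖1 / f s‖ = Real.exp (-Real.log ‖f s‖) := by
        rw [Real.exp_neg, Real.exp_log (norm_pos_iff.2 hfs), norm_div, norm_one, one_div]
    _ < Real.exp ((K + 1) * Real.exp ν * (1 + ν) ^ 4) := by
        rw [Real.exp_lt_exp]
        generalize Real.exp ν = E at hfin hE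
        generalize (1 + ν) ^ 4 = P at h1p
        have h1 : K * E < (K + 1) * E := by linarith
        exact hfin.trans_lt (h1.trans_le (le_mul_of_one_le_right (by positivity) h1p))

/-! ### Holomorphic parameter integrals -/

/-- A dominated integral of functions holomorphic in a parameter is holomorphic. -/
theorem differentiableOn_integral_of_dominated {α : Type*} [MeasurableSpace α] {μ : Measure α}
    {F : ℂ → α → ℂ} {V : Set ℂ} (hV : IsOpen V)
    (hmeas : ∀ s ∈ V, AEStronglyMeasurable (F s) μ)
    (hdiff : ∀ᵐ a ∂μ, DifferentiableOn ℂ (fun s => F s a) V)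
    (hbd : ∀ s₀ ∈ V, ∃ ε > 0, ∃ g : α → ℝ, Integrable g μ ∧
      ∀ᵐ a ∂μ, ∀ s ∈ Metric.ball s₀ ε ∩ V, ‖F s a‖ ≤ g a) :
    DifferentiableOn ℂ (fun s => ∫ a, F s a ∂μ) V := by
  intro s₀ hs₀
  obtain ⟨ε₀, hε₀, g, hg, hFg⟩ := hbd s₀ hs₀
  obtain ⟨ε₁, hε₁, hε₁V⟩ := Metric.isOpen_iff.1 hV s₀ hs₀
  set ε := min ε₀ ε₁ with hε
  have hε0 : 0 < ε := lt_min hε₀ hε₁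
  have hεV : Metric.ball s₀ ε ⊆ V := (Metric.ball_subset_ball (min_le_right _ _)).trans hε₁V
  have hεε₀ : Metric.ball s₀ ε ⊆ Metric.ball s₀ ε₀ := Metric.ball_subset_ball (min_le_left _ _)
  have hder : ∀ᵐ a ∂μ, ∀ s ∈ Metric.ball s₀ (ε / 2),
      HasDerivAt (fun s => F s a) (deriv (fun s => F s a) s) s := by
    filter_upwards [hdiff] with a ha s hs
    have hsV : s ∈ V := hεV (Metric.ball_subset_ball (by linarith) hs)
    exact ((ha s hsV).differentiableAt (hV.mem_nhds hsV)).hasDerivAt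
  -- Cauchy's estimate on circles of radius $\varepsilon/3$, which stay in the ball of radius
  -- $\varepsilon$ because $\frac12+\frac13<1$.
  have hderb : ∀ᵐ a ∂μ, ∀ s ∈ Metric.ball s₀ (ε / 2),
      ‖deriv (fun s => F s a) s‖ ≤ g a / (ε / 3) := by
    filter_upwards [hdiff, hFg] with a ha hb s hs
    have hsub : Metric.closedBall s (ε / 3) ⊆ Metric.ball s₀ ε := by
      intro z hz
      rw [Metric.mem_closedBall] at hz
      rw [Metric.mem_ball] at hs ⊢
      linarith [dist_triangle z s s₀]
    refine Complex.norm_deriv_le_of_forall_mem_sphere_norm_le (by positivity) ?_ ?_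
    · refine DifferentiableOn.diffContOnCl ?_
      rw [closure_ball _ (by positivity)]
      exact ha.mono (hsub.trans hεV)
    · intro z hz
      have := hsub (Metric.sphere_subset_closedBall hz)
      exact hb z ⟨hεε₀ this, hεV this⟩
  -- The derivative is measurable as a limit of difference quotients along a sequence of increments.
  have hmeas' : AEStronglyMeasurable (fun a => deriv (fun s => F s a) s₀) μ := by
    refine aestronglyMeasurable_of_tendsto_ae (u := atTop)
      (f := fun (n : ℕ) a => ((ε / 2 / (n + 2) : ℝ) : ℂ)⁻¹ *
        (F (s₀ + ((ε / 2 / (n + 2) : ℝ) : ℂ)) a - F s₀ a)) ?_ ?_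
    · intro n
      refine ((hmeas _ (hεV ?_)).sub (hmeas _ hs₀)).const_mul _
      have h2 : (0 : ℝ) < ε / 2 / (n + 2) := by positivity
      have : ε / 2 / (n + 2) ≤ ε / 2 := div_le_self (by positivity) (by linarith [n.cast_nonneg (α := ℝ)])
      rw [Metric.mem_ball, dist_eq_norm, add_sub_cancel_left, Complex.norm_real,
        Real.norm_of_nonneg h2.le]
      linarith
    · filter_upwards [hder] with a ha
      have h1 := (hasDerivAt_iff_tendsto_slope_zero.1
        (ha s₀ (Metric.mem_ball_self (by positivity))))
      have h2 : Tendsto (fun n : ℕ => ((ε / 2 / (n + 2) : ℝ) : ℂ)) atTop (𝓝[≠] 0) := by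
        refine tendsto_nhdsWithin_iff.2 ⟨?_, Eventually.of_forall fun n => ?_⟩
        · have h3 : Tendsto (fun n : ℕ => ε / 2 / ((n : ℝ) + 2)) atTop (𝓝 0) :=
            tendsto_const_nhds.div_atTop
              (tendsto_atTop_add_const_right _ _ tendsto_natCast_atTop_atTop)
          have := (Complex.continuous_ofReal.tendsto 0).comp h3
          simpa [Function.comp_def] using this
        · have h2 : (0 : ℝ) < ε / 2 / (n + 2) := by positivity
          exact Complex.ofReal_ne_zero.2 h2.ne'
      exact h1.comp h2
  have := (hasDerivAt_integral_of_dominated_loc_of_deriv_le (μ := μ) (F := F) (x₀ := s₀)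
    (s := Metric.ball s₀ (ε / 2)) (bound := fun a => g a / (ε / 3))
    (F' := fun s a => deriv (fun s => F s a) s)
    (Metric.ball_mem_nhds _ (by positivity))
    (Filter.mem_of_superset (hV.mem_nhds hs₀) hmeas)
    (hg.mono' (hmeas _ hs₀) (by
      filter_upwards [hFg] with a ha
      exact ha s₀ ⟨Metric.mem_ball_self hε₀, hs₀⟩)) hmeas' hderb (hg.div_const _) hder).2
  exact this.differentiableAt.differentiableWithinAt

/-! ### Hadamard's inequality and the modified Fredholm determinant -/

open scoped ComplexOrder in
/-- Hadamard's inequality for matrices with bounded entries. -/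
theorem norm_det_sq_le {n : ℕ} (hn : 0 < n) (A : Matrix (Fin n) (Fin n) ℂ) {B : ℝ}
    (hA : ∀ i j, ‖A i j‖ ≤ B) : ‖A.det‖ ^ 2 ≤ (n * B ^ 2) ^ n := by
  have hps : (A * A.conjTranspose).PosSemidef := Matrix.posSemidef_self_mul_conjTranspose A
  have hH := hps.isHermitian
  have hdet : (A * A.conjTranspose).det = ((‖A.det‖ ^ 2 : ℝ) : ℂ) := by
    rw [Matrix.det_mul, Matrix.det_conjTranspose, Complex.star_def, Complex.mul_conj,
      Complex.normSq_eq_norm_sq]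
  have hdet2 : ‖A.det‖ ^ 2 = ∏ i, hH.eigenvalues i := by
    have := hH.det_eq_prod_eigenvalues
    rw [hdet] at this
    exact Complex.ofReal_injective (by rw [this]; push_cast; rfl)
  have htr : ((∑ i, hH.eigenvalues i : ℝ) : ℂ) = (((∑ i, ∑ j, ‖A i j‖ ^ 2 : ℝ)) : ℂ) := by
    have := hH.trace_eq_sum_eigenvalues
    push_cast
    refine Eq.trans (by simpa using this.symm) ?_
    simp only [Matrix.trace, Matrix.diag, Matrix.mul_apply, Matrix.conjTranspose_apply,
      Complex.star_def, Complex.mul_conj, Complex.normSq_eq_norm_sq]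
    push_cast
    rfl
  have htr2 : ∑ i, hH.eigenvalues i = ∑ i, ∑ j, ‖A i j‖ ^ 2 := by exact_mod_cast htr
  have hB : ∑ i, hH.eigenvalues i ≤ n * (n * B ^ 2) := by
    rw [htr2]
    calc _ ≤ ∑ i : Fin n, ∑ j : Fin n, B ^ 2 := by
          gcongr with i _ j _
          exact hA i j
      _ = _ := by simp
  have hn' : (0 : ℝ) < n := by exact_mod_cast hn
  -- The determinant of $AA^*$ is the product of its eigenvalues and its trace is their sum, the
  -- squared Frobenius norm of $A$; the inequality of the means compares the two.
  have hgm := Real.geom_mean_le_arith_mean Finset.univ (fun _ : Fin n => (1 : ℝ)) hH.eigenvalues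
    (fun _ _ => zero_le_one) (by simpa using hn) (fun i _ => hps.eigenvalues_nonneg i)
  simp only [Real.rpow_one, Finset.sum_const, Finset.card_univ, Fintype.card_fin, nsmul_eq_mul,
    mul_one, one_mul] at hgm
  have h0 : 0 ≤ ∏ i, hH.eigenvalues i := Finset.prod_nonneg fun i _ => hps.eigenvalues_nonneg i
  calc ‖A.det‖ ^ 2 = ((∏ i, hH.eigenvalues i) ^ ((n : ℝ)⁻¹)) ^ n := by
        rw [hdet2, Real.rpow_inv_natCast_pow h0 hn.ne']
    _ ≤ (n * B ^ 2) ^ n := by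
        refine pow_le_pow_left₀ (Real.rpow_nonneg h0 _) (hgm.trans ?_) n
        rw [div_le_iff₀ hn']; linarith

theorem modDet_eq_zero {P : ℝ → ℝ → ℂ} (hP : ∀ x y, x ∉ Icc (-1 : ℝ) 1 → P x y = 0) {n : ℕ}
    {t : Fin n → ℝ} (ht : t ∉ Set.pi univ fun _ => Icc (-1 : ℝ) 1) : modDet P n t = 0 := by
  simp only [Set.mem_pi, mem_univ, true_implies, not_forall] at ht
  obtain ⟨i, hi⟩ := ht
  refine Matrix.det_eq_zero_of_row_eq_zero i fun j => ?_
  simp [hP _ _ hi]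

theorem norm_modDet_sq_le {P : ℝ → ℝ → ℂ} {B : ℝ} (hB : 0 ≤ B) (hP : ∀ x y, ‖P x y‖ ≤ B) {n : ℕ}
    (hn : 0 < n) (t : Fin n → ℝ) : ‖modDet P n t‖ ^ 2 ≤ (n * B ^ 2) ^ n := by
  refine norm_det_sq_le hn _ fun i j => ?_
  by_cases h : i = j <;> simp [h, hB, hP]

theorem norm_modDet_le_indicator {P : ℝ → ℝ → ℂ} {B : ℝ} (hB : 0 ≤ B) (hP : ∀ x y, ‖P x y‖ ≤ B)
    (hP0 : ∀ x y, x ∉ Icc (-1 : ℝ) 1 → P x y = 0) {n : ℕ} (hn : 0 < n) (t : Fin n → ℝ) :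
    ‖modDet P n t‖ ≤
      (Set.pi univ fun _ : Fin n => Icc (-1 : ℝ) 1).indicator (fun _ => √((n * B ^ 2) ^ n)) t := by
  by_cases ht : t ∈ Set.pi univ fun _ : Fin n => Icc (-1 : ℝ) 1
  · rw [indicator_of_mem ht]
    exact Real.le_sqrt_of_sq_le (norm_modDet_sq_le hB hP hn t)
  · rw [indicator_of_notMem ht, modDet_eq_zero hP0 ht, norm_zero]

theorem volume_cube (n : ℕ) : volume (Set.pi univ fun _ : Fin n => Icc (-1 : ℝ) 1) = 2 ^ n := by
  rw [volume_pi_pi]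
  simp
  norm_num

theorem integrable_cube_indicator (n : ℕ) (c : ℝ) :
    Integrable ((Set.pi univ fun _ : Fin n => Icc (-1 : ℝ) 1).indicator fun _ => c) := by
  refine (integrable_indicator_iff (MeasurableSet.univ_pi fun _ => measurableSet_Icc)).2 ?_
  refine integrableOn_const ?_
  rw [volume_cube]
  simp

theorem norm_integral_modDet_le {P : ℝ → ℝ → ℂ} {B : ℝ} (hB : 0 ≤ B) (hP : ∀ x y, ‖P x y‖ ≤ B)
    (hP0 : ∀ x y, x ∉ Icc (-1 : ℝ) 1 → P x y = 0) {n : ℕ} (hn : 0 < n) :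
    ‖∫ t : Fin n → ℝ, modDet P n t‖ ≤ 2 ^ n * √((n * B ^ 2) ^ n) := by
  refine (norm_integral_le_of_norm_le (integrable_cube_indicator n _)
    (Eventually.of_forall (norm_modDet_le_indicator hB hP hP0 hn))).trans_eq ?_
  rw [integral_indicator (MeasurableSet.univ_pi fun _ => measurableSet_Icc), setIntegral_const,
    Measure.real, volume_cube]
  simp

/-- Hadamard bounds the term of index $m$ by $2^m(mB^2)^{m/2}/m!$. As $m^m\le3^mm!$, its square is
at most $(12B^2)^m/m!$, the product of $(24B^2)^m/m!$ and $2^{-m}$. Replacing the geometric mean by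
the arithmetic one gives series with known sums. -/
theorem norm_fredholmDet_term_le {P : ℝ → ℝ → ℂ} {B : ℝ} (hB : 0 ≤ B) (hP : ∀ x y, ‖P x y‖ ≤ B)
    (hP0 : ∀ x y, x ∉ Icc (-1 : ℝ) 1 → P x y = 0) (n : ℕ) :
    ‖(1 / ((n + 1).factorial : ℂ)) * ∫ t : Fin (n + 1) → ℝ, modDet P (n + 1) t‖ ≤
      ((24 * B ^ 2) ^ (n + 1) / (n + 1).factorial + (1 / 2) ^ (n + 1)) / 2 := by
  have h1 := norm_integral_modDet_le hB hP hP0 n.succ_pos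
  set m := n + 1 with hm
  have hf : (0 : ℝ) < m.factorial := by positivity
  have h2 : ‖(1 / (m.factorial : ℂ)) * ∫ t : Fin m → ℝ, modDet P m t‖ ≤
      2 ^ m * √((m * B ^ 2) ^ m) / m.factorial := by
    rw [norm_mul, norm_div, norm_one, Complex.norm_natCast, div_mul_eq_mul_div, one_mul]
    gcongr
  refine h2.trans (abs_le_of_sq_le_sq' ?_ (by positivity)).2
  rw [div_pow, mul_pow, Real.sq_sqrt (by positivity), mul_pow]
  have h3 : (m : ℝ) ^ m ≤ 3 ^ m * m.factorial := by
    have := Real.pow_div_factorial_le_exp (m : ℝ) (by positivity) m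
    rw [div_le_iff₀ hf] at this
    refine this.trans ?_
    gcongr
    rw [← mul_one (m : ℝ), Real.exp_nat_mul]
    gcongr
    linarith [Real.exp_one_lt_d9]
  set a := (24 * B ^ 2) ^ m / (m.factorial : ℝ)
  set b := (1 / 2 : ℝ) ^ m
  have h4 : (2 ^ m) ^ 2 * ((m : ℝ) ^ m * (B ^ 2) ^ m) / (m.factorial : ℝ) ^ 2 ≤ a * b := by
    have e : a * b = (2 ^ m) ^ 2 * ((3 ^ m * m.factorial) * (B ^ 2) ^ m) / (m.factorial : ℝ) ^ 2 := by
      simp only [a, b]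
      rw [show (24 : ℝ) * B ^ 2 = 2 * 2 * 2 * 3 * B ^ 2 by norm_num]
      simp only [mul_pow, div_pow, one_pow]
      field_simp
    rw [e]
    gcongr
  refine h4.trans ?_
  nlinarith [sq_nonneg (a - b)]

theorem summable_fredholmDet_bound (B : ℝ) : Summable fun n : ℕ =>
    ((24 * B ^ 2) ^ (n + 1) / ((n + 1).factorial : ℝ) + (1 / 2) ^ (n + 1)) / 2 := by
  have h1 := (summable_nat_add_iff 1).2 (Real.summable_pow_div_factorial (24 * B ^ 2))
  have h2 := (summable_nat_add_iff 1).2 summable_geometric_two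
  exact (h1.add h2).div_const 2

theorem norm_fredholmDet_le {P : ℝ → ℝ → ℂ} {B : ℝ} (hB : 0 ≤ B) (hP : ∀ x y, ‖P x y‖ ≤ B)
    (hP0 : ∀ x y, x ∉ Icc (-1 : ℝ) 1 → P x y = 0) :
    ‖fredholmDet P‖ ≤ Real.exp (1 + 24 * B ^ 2) := by
  have h1 := (summable_nat_add_iff 1).2 (Real.summable_pow_div_factorial (24 * B ^ 2))
  have h2 := (summable_nat_add_iff 1).2 summable_geometric_two
  have hs := tsum_of_norm_bounded (summable_fredholmDet_bound B).hasSum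
    (norm_fredholmDet_term_le hB hP hP0)
  have e1 : ∑' n : ℕ, (24 * B ^ 2) ^ (n + 1) / ((n + 1).factorial : ℝ) = Real.exp (24 * B ^ 2) - 1 := by
    rw [Real.exp_eq_exp_ℝ, NormedSpace.exp_eq_tsum_div]
    beta_reduce
    rw [(Real.summable_pow_div_factorial (24 * B ^ 2)).tsum_eq_zero_add]
    simp
  have e2 : ∑' n : ℕ, (1 / 2 : ℝ) ^ (n + 1) = 1 := by
    have := summable_geometric_two.tsum_eq_zero_add
    rw [tsum_geometric_two] at this
    norm_num at this ⊢
    linarith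
  rw [tsum_div_const, (h1.hasSum.add h2.hasSum).tsum_eq, e1, e2] at hs
  have h3 : ‖fredholmDet P‖ ≤ 1 + (Real.exp (24 * B ^ 2) - 1 + 1) / 2 := by
    refine (norm_add_le _ _).trans ?_
    rw [norm_one]
    gcongr
  refine h3.trans ?_
  rw [Real.exp_add]
  have := Real.add_one_le_exp 1
  have := Real.one_le_exp (x := 24 * B ^ 2) (by positivity)
  nlinarith

/-- The Fredholm determinant of a holomorphic family of bounded kernels is holomorphic. -/
theorem differentiableOn_fredholmDet {P : ℂ → ℝ → ℝ → ℂ} {V : Set ℂ} (hV : IsOpen V)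
    (hmeas : ∀ s ∈ V, Measurable (Function.uncurry (P s)))
    (hP0 : ∀ s x y, x ∉ Icc (-1 : ℝ) 1 → P s x y = 0)
    (hdiff : ∀ x y, DifferentiableOn ℂ (fun s => P s x y) V)
    (hbd : ∀ s₀ ∈ V, ∃ ε > 0, ∃ B, 0 ≤ B ∧ ∀ s ∈ Metric.ball s₀ ε ∩ V, ∀ x y, ‖P s x y‖ ≤ B) :
    DifferentiableOn ℂ (fun s => fredholmDet (P s)) V := by
  intro s₀ hs₀
  obtain ⟨ε, hε, B, hB, hPB⟩ := hbd s₀ hs₀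
  have hW : IsOpen (Metric.ball s₀ ε ∩ V) := Metric.isOpen_ball.inter hV
  have hterm : ∀ n : ℕ, DifferentiableOn ℂ
      (fun s => (1 / ((n + 1).factorial : ℂ)) * ∫ t : Fin (n + 1) → ℝ, modDet (P s) (n + 1) t)
      (Metric.ball s₀ ε ∩ V) := by
    intro n
    refine DifferentiableOn.const_mul ?_ _
    refine differentiableOn_integral_of_dominated hW (fun s hs => ?_)
      (Eventually.of_forall fun t => ?_) (fun s hs => ⟨1, one_pos, _,
        integrable_cube_indicator (n + 1) _, Eventually.of_forall fun t z hz =>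
          norm_modDet_le_indicator hB (hPB z hz.2) (hP0 z) n.succ_pos t⟩)
    · refine Measurable.aestronglyMeasurable (f := fun t => modDet (P s) (n + 1) t) ?_
      simp only [modDet, Matrix.det_apply, Matrix.of_apply]
      refine Finset.measurable_sum _ fun σ _ => Measurable.const_smul (Finset.measurable_prod _ fun i _ => ?_) _
      by_cases h : σ i = i
      · simp [h]
      · simp only [h, if_false]
        have hm : Measurable fun t : Fin (n + 1) → ℝ => (t (σ i), t i) :=
          (measurable_pi_apply _).prodMk (measurable_pi_apply _)
        exact (hmeas s hs.2).comp hm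
    · simp only [modDet, Matrix.det_apply, Matrix.of_apply]
      refine DifferentiableOn.fun_sum fun σ _ => DifferentiableOn.fun_const_smul
        (DifferentiableOn.fun_finsetProd fun i _ => ?_) _
      by_cases h : σ i = i
      · simp [h]
      · simp only [h, if_false]
        exact (hdiff _ _).mono inter_subset_right
  have hsum := Complex.differentiableOn_tsum_of_summable_norm (summable_fredholmDet_bound B) hterm hW
    fun n s hs => norm_fredholmDet_term_le hB (hPB s hs) (hP0 s) n
  have := (hsum.const_add 1) s₀ ⟨Metric.mem_ball_self hε, hs₀⟩
  exact (this.differentiableAt (hW.mem_nhds ⟨Metric.mem_ball_self hε, hs₀⟩)).differentiableWithinAt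

theorem volume_setOf_coord_eq {n : ℕ} {i j : Fin n} (hij : i ≠ j) :
    volume {t : Fin n → ℝ | t i = t j} = 0 := by
  have := Measure.addHaar_affineSubspace (volume : Measure (Fin n → ℝ))
    (LinearMap.ker (LinearMap.proj (R := ℝ) (φ := fun _ : Fin n => ℝ) i
      - LinearMap.proj j)).toAffineSubspace ?_
  · convert this using 2
    ext t
    simp [sub_eq_zero]
  · intro h
    have h1 : (Pi.single i (1 : ℝ) : Fin n → ℝ) ∈
        (LinearMap.ker (LinearMap.proj (R := ℝ) (φ := fun _ : Fin n => ℝ) i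
      - LinearMap.proj j)).toAffineSubspace := by rw [h]; trivial
    simp [hij.symm] at h1

/-- The Fredholm determinant depends only on the values of the kernel off the diagonal and off
countably many lines parallel to the axes. -/
theorem fredholmDet_congr {P Q : ℝ → ℝ → ℂ} {S : Set ℝ} (hS : S.Finite)
    (h : ∀ x y, x ∉ S → y ∉ S → x ≠ y → P x y = Q x y) : fredholmDet P = fredholmDet Q := by
  unfold fredholmDet
  congr 1
  refine tsum_congr fun n => ?_
  congr 1
  refine integral_congr_ae ?_
  have h1 : ∀ᵐ t : Fin (n + 1) → ℝ, ∀ i j, i ≠ j → t i ≠ t j := by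
    refine ae_all_iff.2 fun i => ae_all_iff.2 fun j => ?_
    by_cases hij : i = j
    · simp [hij]
    · simp only [ne_eq, hij, not_false_eq_true, true_implies]
      rw [ae_iff]
      simpa using volume_setOf_coord_eq hij
  have h2 : ∀ᵐ t : Fin (n + 1) → ℝ, ∀ i, t i ∉ S := by
    refine ae_all_iff.2 fun i => ?_
    have : ∀ᵐ t : Fin (n + 1) → ℝ, ∀ x ∈ S, t i ≠ x := by
      rw [ae_ball_iff hS.countable]
      intro x _
      rw [ae_iff]
      simpa [volume_pi] using Measure.pi_hyperplane (fun _ : Fin (n + 1) => (volume : Measure ℝ)) i x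
    filter_upwards [this] with t ht hm
    exact ht _ hm rfl
  filter_upwards [h1, h2] with t ht1 ht2
  unfold modDet
  congr 1
  ext i j
  by_cases hij : i = j
  · simp [hij]
  · simp [hij, h _ _ (ht2 i) (ht2 j) (ht1 i j hij)]

/-! ### Power series and Bessel's equation -/

/-- The sum of a power series with coefficients `c`. -/
def powSum (c : ℕ → ℂ) (x : ℂ) : ℂ := ∑' k, c k * x ^ k

/-- The coefficients of the derivative of a power series. -/
def derivCoeff (c : ℕ → ℂ) (k : ℕ) : ℂ := (k + 1) * c (k + 1)

/-- The bound $1/k!$ is stable under differentiation since $(k+1)/(k+1)!=1/k!$, so one convergence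
argument serves all derivatives. -/
theorem norm_derivCoeff_le {c : ℕ → ℂ} (hc : ∀ k, ‖c k‖ ≤ 1 / k.factorial) (k : ℕ) :
    ‖derivCoeff c k‖ ≤ 1 / k.factorial := by
  have h : ‖((k : ℂ) + 1)‖ = k + 1 := by
    rw [← Nat.cast_add_one, Complex.norm_natCast]; push_cast; rfl
  rw [derivCoeff, norm_mul, h]
  calc ((k : ℝ) + 1) * ‖c (k + 1)‖ ≤ (k + 1) * (1 / (k + 1).factorial) := by
        gcongr; exact hc _
    _ = 1 / k.factorial := by
        rw [Nat.factorial_succ]; push_cast; field_simp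

theorem summable_powSum {c : ℕ → ℂ} (hc : ∀ k, ‖c k‖ ≤ 1 / k.factorial) (x : ℂ) :
    Summable fun k => c k * x ^ k := by
  refine Summable.of_norm_bounded (Real.summable_pow_div_factorial ‖x‖) fun k => ?_
  rw [norm_mul, norm_pow]
  calc ‖c k‖ * ‖x‖ ^ k ≤ 1 / k.factorial * ‖x‖ ^ k := by gcongr; exact hc k
    _ = _ := by ring

theorem powSum_zero (c : ℕ → ℂ) : powSum c 0 = c 0 := by
  rw [powSum, tsum_eq_single 0 (fun k hk => by simp [hk])]; simp

theorem hasDerivAt_powSum {c : ℕ → ℂ} (hc : ∀ k, ‖c k‖ ≤ 1 / k.factorial) (x : ℂ) :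
    HasDerivAt (powSum c) (powSum (derivCoeff c) x) x := by
  set R := ‖x‖ + 1
  have hR : 0 < R := by positivity
  have hu : Summable fun k : ℕ => R ^ (k - 1) / ((k - 1).factorial : ℝ) := by
    rw [← summable_nat_add_iff 1]
    simpa using Real.summable_pow_div_factorial R
  have h := hasDerivAt_tsum_of_isPreconnected (g := fun k y => c k * y ^ k)
    (g' := fun k y => c k * (k * y ^ (k - 1))) hu Metric.isOpen_ball
    (convex_ball (0 : ℂ) R).isPreconnected
    (fun k y _ => (hasDerivAt_pow k y).const_mul _) (fun k y hy => ?_)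
    (Metric.mem_ball_self hR) (summable_powSum hc 0) (y := x) (by simp [R])
  · refine h.congr_deriv ?_
    symm
    change ∑' k, derivCoeff c k * x ^ k = _
    have hsum : Summable fun k : ℕ => c k * (k * x ^ (k - 1)) := by
      rw [← summable_nat_add_iff 1]
      refine (summable_powSum (norm_derivCoeff_le hc) x).congr fun k => ?_
      simp only [derivCoeff, Nat.add_sub_cancel]; push_cast; ring
    rw [hsum.tsum_eq_zero_add]
    simp only [Nat.cast_zero, zero_mul, mul_zero, zero_add]
    refine tsum_congr fun k => ?_
    simp only [derivCoeff, Nat.add_sub_cancel]; push_cast; ring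
  · rcases k with _ | k
    · simp
    · have hy' : ‖y‖ ≤ R := by simpa using (Metric.mem_ball.1 hy).le
      have h2 := norm_derivCoeff_le hc k
      calc ‖c (k + 1) * (((k + 1 : ℕ) : ℂ) * y ^ (k + 1 - 1))‖ = ‖derivCoeff c k‖ * ‖y‖ ^ k := by
            rw [← norm_pow, ← norm_mul, derivCoeff, Nat.add_sub_cancel]; push_cast; ring_nf
        _ ≤ 1 / k.factorial * R ^ k := by gcongr
        _ = _ := by simp; ring

theorem mul_powSum_derivCoeff {c : ℕ → ℂ} (hc : ∀ k, ‖c k‖ ≤ 1 / k.factorial) (x : ℂ) :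
    HasSum (fun k : ℕ => k * c k * x ^ k) (x * powSum (derivCoeff c) x) := by
  have h := ((summable_powSum (norm_derivCoeff_le hc) x).hasSum).mul_left x
  rw [← hasSum_nat_add_iff' 1]
  simp only [Finset.range_one, Finset.sum_singleton, Nat.cast_zero, zero_mul, sub_zero]
  refine h.congr_fun fun k => ?_
  simp only [derivCoeff]; push_cast; ring

/-- The coefficients of `I₀` as a power series in `z² / 4`. -/
def besselCoeff (k : ℕ) : ℂ := 1 / (k.factorial : ℂ) ^ 2

/-- The coefficients of the regular part of `K₀` as a power series in `z² / 4`. -/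
def harmonicCoeff (k : ℕ) : ℂ := ((harmonic k : ℚ) : ℂ) / (k.factorial : ℂ) ^ 2

theorem norm_besselCoeff_le (k : ℕ) : ‖besselCoeff k‖ ≤ 1 / k.factorial := by
  have h : (1 : ℝ) ≤ k.factorial := by exact_mod_cast k.factorial_pos
  rw [besselCoeff, norm_div, norm_pow, Complex.norm_natCast, norm_one]
  gcongr
  nlinarith

theorem harmonic_le_factorial (k : ℕ) : (harmonic k : ℚ) ≤ k.factorial := by
  have h1 : (harmonic k : ℚ) ≤ k := by
    induction k with
    | zero => simp
    | succ k ih =>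
      rw [harmonic_succ]
      have : ((k + 1 : ℕ) : ℚ)⁻¹ ≤ 1 := inv_le_one_of_one_le₀ (by simp)
      push_cast at *
      linarith
  exact h1.trans (by exact_mod_cast Nat.self_le_factorial k)

theorem norm_harmonicCoeff_le (k : ℕ) : ‖harmonicCoeff k‖ ≤ 1 / k.factorial := by
  have h : (0 : ℝ) < k.factorial := by exact_mod_cast k.factorial_pos
  have h0 : (0 : ℚ) ≤ harmonic k := by unfold harmonic; positivity
  have h1 : ‖((harmonic k : ℚ) : ℂ)‖ ≤ k.factorial := by
    have e : ((harmonic k : ℚ) : ℂ) = (((harmonic k : ℚ) : ℝ) : ℂ) := by push_cast; rfl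
    rw [e, Complex.norm_real, Real.norm_of_nonneg (by exact_mod_cast h0)]
    exact_mod_cast harmonic_le_factorial k
  rw [harmonicCoeff, norm_div, norm_pow, Complex.norm_natCast, div_le_div_iff₀ (by positivity) h]
  nlinarith

theorem succ_mul_derivCoeff_bessel (k : ℕ) :
    ((k : ℂ) + 1) * derivCoeff besselCoeff k = besselCoeff k := by
  have h : ((k : ℂ) + 1) ≠ 0 := Nat.cast_add_one_ne_zero k
  have h2 : (k.factorial : ℂ) ≠ 0 := by exact_mod_cast k.factorial_ne_zero
  simp only [derivCoeff, besselCoeff, Nat.factorial_succ]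
  push_cast
  field_simp

theorem succ_mul_derivCoeff_harmonic (k : ℕ) :
    ((k : ℂ) + 1) * derivCoeff harmonicCoeff k = harmonicCoeff k + derivCoeff besselCoeff k := by
  have h : ((k : ℂ) + 1) ≠ 0 := Nat.cast_add_one_ne_zero k
  have h2 : (k.factorial : ℂ) ≠ 0 := by exact_mod_cast k.factorial_ne_zero
  simp only [derivCoeff, besselCoeff, harmonicCoeff, Nat.factorial_succ, harmonic_succ]
  push_cast
  field_simp

/-- The recursion $(k+1)^2c_{k+1}=c_k$ in generating-function form: the modified Bessel equation of
order zero in the variable $x=w^2/4$. -/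
theorem bessel_ode (x : ℂ) : x * powSum (derivCoeff (derivCoeff besselCoeff)) x
    + powSum (derivCoeff besselCoeff) x = powSum besselCoeff x := by
  have hb := norm_derivCoeff_le norm_besselCoeff_le
  have h := (mul_powSum_derivCoeff hb x).add (summable_powSum hb x).hasSum
  rw [← powSum] at h
  rw [← h.tsum_eq, powSum]
  refine tsum_congr fun k => ?_
  rw [← succ_mul_derivCoeff_bessel]; ring

/-- The increment $1/(k+1)$ of the harmonic numbers adds an inhomogeneity, which cancels the terms
created by differentiating the logarithm in `modHankel`. -/
theorem harmonic_ode (x : ℂ) : x * powSum (derivCoeff (derivCoeff harmonicCoeff)) x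
    + powSum (derivCoeff harmonicCoeff) x
    = powSum harmonicCoeff x + powSum (derivCoeff besselCoeff) x := by
  have hb := norm_derivCoeff_le norm_harmonicCoeff_le
  have h := (mul_powSum_derivCoeff hb x).add (summable_powSum hb x).hasSum
  have h' := (summable_powSum norm_harmonicCoeff_le x).hasSum.add
    (summable_powSum (norm_derivCoeff_le norm_besselCoeff_le) x).hasSum
  refine h.unique (h'.congr_fun fun k => ?_)
  have := succ_mul_derivCoeff_harmonic k
  linear_combination x ^ k * this

/-- The modified Hankel function `w ↦ H₀⁽¹⁾(i w)`. -/
def modHankel (w : ℂ) : ℂ := 2 * Complex.I / Real.pi *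
  ((Complex.log (w / 2) + Real.eulerMascheroniConstant) * powSum besselCoeff (w ^ 2 / 4)
    - powSum harmonicCoeff (w ^ 2 / 4))

/-- The derivative of the modified Hankel function. -/
def modHankel' (w : ℂ) : ℂ := 2 * Complex.I / Real.pi *
  (powSum besselCoeff (w ^ 2 / 4) / w
    + (Complex.log (w / 2) + Real.eulerMascheroniConstant) *
      (powSum (derivCoeff besselCoeff) (w ^ 2 / 4) * (w / 2))
    - powSum (derivCoeff harmonicCoeff) (w ^ 2 / 4) * (w / 2))

/-- In the right half-plane $\log(iw/2)=\log(w/2)+i\pi/2$ on the principal branch, and the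
contribution of $i\pi/2$ to $iY_0$ is exactly $-J_0$. -/
theorem hankelH0_I_mul {w : ℂ} (hw : 0 < w.re) : hankelH0 (Complex.I * w) = modHankel w := by
  have e : ∀ k : ℕ, (-1 : ℂ) ^ k * ((Complex.I * w) ^ 2 / 4) ^ k = (w ^ 2 / 4) ^ k := fun k => by
    rw [← mul_pow, mul_pow Complex.I, Complex.I_sq]; ring_nf
  have eJ : besselJ0 (Complex.I * w) = powSum besselCoeff (w ^ 2 / 4) := by
    rw [besselJ0, powSum]
    refine tsum_congr fun k => ?_
    rw [e, besselCoeff]; ring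
  have eS : ∑' k : ℕ, (-1 : ℂ) ^ k * ((harmonic k : ℚ) : ℂ) * ((Complex.I * w) ^ 2 / 4) ^ k /
      ((k.factorial : ℂ) ^ 2) = powSum harmonicCoeff (w ^ 2 / 4) := by
    rw [powSum]
    refine tsum_congr fun k => ?_
    rw [mul_right_comm, e, harmonicCoeff]; ring
  have hw2 : 0 < (w / 2).re := by simp; linarith
  have hw0 : w / 2 ≠ 0 := by intro h; rw [h] at hw2; simp at hw2
  have hlog : Complex.log (Complex.I * w / 2) = Complex.log (w / 2) + Real.pi / 2 * Complex.I := by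
    have h1 := abs_lt.1 (Complex.abs_arg_lt_pi_div_two_iff.2 (Or.inl hw2))
    rw [mul_div_assoc, Complex.log_mul Complex.I_ne_zero hw0
      (by rw [Complex.arg_I]; constructor <;> linarith [Real.pi_pos]), Complex.log_I]
    ring
  have hpi : (Real.pi : ℂ) ≠ 0 := by exact_mod_cast Real.pi_ne_zero
  rw [hankelH0, besselY0, eJ, eS, hlog, modHankel]
  field_simp
  ring_nf
  rw [Complex.I_sq]
  ring

theorem hasDerivAt_comp_sq {F F' : ℂ → ℂ} (hF : ∀ x, HasDerivAt F (F' x) x) (w : ℂ) :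
    HasDerivAt (fun w => F (w ^ 2 / 4)) (F' (w ^ 2 / 4) * (w / 2)) w := by
  have h1 : HasDerivAt (fun w : ℂ => w ^ 2 / 4) (w / 2) w := by
    refine ((hasDerivAt_pow 2 w).div_const 4).congr_deriv ?_
    push_cast; ring
  exact (hF _).comp w h1

theorem hasDerivAt_log_half {w : ℂ} (hw : 0 < w.re) :
    HasDerivAt (fun w : ℂ => Complex.log (w / 2) + Real.eulerMascheroniConstant) (1 / w) w := by
  have hw2 : 0 < (w / 2).re := by simp; linarith
  have hw0 : w ≠ 0 := by rintro rfl; simp at hw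
  have := (((hasDerivAt_id w).div_const 2).clog (Or.inl hw2)).add_const
    (Real.eulerMascheroniConstant : ℂ)
  refine this.congr_deriv ?_
  simp only [id]
  field_simp

theorem hasDerivAt_modHankel {w : ℂ} (hw : 0 < w.re) :
    HasDerivAt modHankel (modHankel' w) w := by
  have hI := hasDerivAt_comp_sq (hasDerivAt_powSum norm_besselCoeff_le) w
  have hS := hasDerivAt_comp_sq (hasDerivAt_powSum norm_harmonicCoeff_le) w
  refine ((((hasDerivAt_log_half hw).mul hI).sub hS).const_mul
    (2 * Complex.I / Real.pi)).congr_deriv ?_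
  rw [modHankel']; ring

/-- This is Bessel's equation $H''=H-H'/w$, the source of all later estimates. -/
theorem hasDerivAt_modHankel' {w : ℂ} (hw : 0 < w.re) :
    HasDerivAt modHankel' (modHankel w - modHankel' w / w) w := by
  have hw0 : w ≠ 0 := by rintro rfl; simp at hw
  have hI := hasDerivAt_comp_sq (hasDerivAt_powSum norm_besselCoeff_le) w
  have hI1 := hasDerivAt_comp_sq (hasDerivAt_powSum (norm_derivCoeff_le norm_besselCoeff_le)) w
  have hS1 := hasDerivAt_comp_sq (hasDerivAt_powSum (norm_derivCoeff_le norm_harmonicCoeff_le)) w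
  have hid := (hasDerivAt_id w).div_const 2
  have hpi : (Real.pi : ℂ) ≠ 0 := by exact_mod_cast Real.pi_ne_zero
  refine ((((hI.div (hasDerivAt_id w) hw0).add ((hasDerivAt_log_half hw).mul (hI1.mul hid))).sub
    (hS1.mul hid)).const_mul (2 * Complex.I / Real.pi)).congr_deriv ?_
  have o1 := bessel_ode (w ^ 2 / 4)
  have o2 := harmonic_ode (w ^ 2 / 4)
  simp only [modHankel, modHankel', id, Pi.mul_apply]
  generalize Complex.log (w / 2) + (Real.eulerMascheroniConstant : ℂ) = l
  rw [← o1]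
  have o2' : powSum harmonicCoeff (w ^ 2 / 4) = w ^ 2 / 4 * powSum (derivCoeff (derivCoeff harmonicCoeff)) (w ^ 2 / 4)
    + powSum (derivCoeff harmonicCoeff) (w ^ 2 / 4) - powSum (derivCoeff besselCoeff) (w ^ 2 / 4) := by
    rw [o2]; ring
  rw [o2']
  field_simp
  ring

/-! ### Energy estimate in the right half-plane -/

/-- The energy of the modified Hankel function. -/
def hankelEnergy (w : ℂ) : ℝ := ‖modHankel w‖ ^ 2 + ‖modHankel' w‖ ^ 2

theorem hankelEnergy_nonneg (w : ℂ) : 0 ≤ hankelEnergy w := by unfold hankelEnergy; positivity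

/-- Along a vertical line the two cross terms combine to the real part of $i$ times a real number
and drop out; only the damping term $-H'/w$ of the equation contributes. -/
theorem hasDerivAt_hankelEnergy_vertical {σ : ℝ} (hσ : 0 < σ) (ν : ℝ) :
    HasDerivAt (fun ν : ℝ => hankelEnergy (σ + ν * Complex.I))
      (-2 * ν * ‖modHankel' (σ + ν * Complex.I)‖ ^ 2 / Complex.normSq (σ + ν * Complex.I)) ν := by
  set w : ℂ := σ + ν * Complex.I with hw
  have hre : w.re = σ := by simp [hw]
  have him : w.im = ν := by simp [hw]
  have hw0 : 0 < w.re := by rw [hre]; exact hσ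
  have hline : HasDerivAt (fun ν : ℝ => (σ : ℂ) + ν * Complex.I) Complex.I ν := by
    simpa using ((Complex.ofRealCLM.hasDerivAt (x := ν)).mul_const Complex.I).const_add (σ : ℂ)
  have h1 := ((hasDerivAt_modHankel hw0).scomp ν hline).norm_sq
  have h2 := ((hasDerivAt_modHankel' hw0).scomp ν hline).norm_sq
  refine (h1.add h2).congr_deriv ?_
  simp only [Function.comp_def, ← hw, smul_eq_mul]
  generalize modHankel w = p
  generalize modHankel' w = q
  have hn : Complex.normSq w ≠ 0 := by
    intro h; rw [Complex.normSq_eq_zero] at h; rw [h] at hw0; simp at hw0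
  rw [div_eq_mul_inv q w, Complex.inv_def, ← Complex.normSq_eq_norm_sq]
  simp only [Complex.inner, Complex.mul_re, Complex.mul_im, Complex.conj_re, Complex.conj_im,
    Complex.I_re, Complex.I_im, Complex.sub_re, Complex.sub_im, Complex.ofReal_re,
    Complex.ofReal_im, hre, him, Complex.normSq_apply q]
  field_simp
  ring

/-- The energy is maximal on the real axis along vertical lines. -/
theorem hankelEnergy_le_re {w : ℂ} (hw : 0 < w.re) : hankelEnergy w ≤ hankelEnergy (w.re : ℂ) := by
  have hd := hasDerivAt_hankelEnergy_vertical hw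
  have hcont : Continuous fun ν : ℝ => hankelEnergy (w.re + ν * Complex.I) :=
    continuous_iff_continuousAt.2 fun ν => (hd ν).continuousAt
  have e1 : hankelEnergy w = hankelEnergy (w.re + w.im * Complex.I) := by rw [Complex.re_add_im]
  have e0 : hankelEnergy (w.re : ℂ) = hankelEnergy (w.re + (0 : ℝ) * Complex.I) := by simp
  rw [e1, e0]
  rcases le_total 0 w.im with h | h
  · refine antitoneOn_of_deriv_nonpos (convex_Ici (0 : ℝ)) hcont.continuousOn
      (fun ν _ => (hd ν).differentiableAt.differentiableWithinAt) (fun ν hν => ?_)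
      self_mem_Ici h h
    rw [interior_Ici] at hν
    rw [(hd ν).deriv]
    have := Complex.normSq_nonneg (w.re + ν * Complex.I)
    have := mem_Ioi.1 hν
    apply div_nonpos_of_nonpos_of_nonneg _ (by assumption)
    nlinarith [sq_nonneg ‖modHankel' (w.re + ν * Complex.I)‖]
  · refine monotoneOn_of_deriv_nonneg (convex_Iic (0 : ℝ)) hcont.continuousOn
      (fun ν _ => (hd ν).differentiableAt.differentiableWithinAt) (fun ν hν => ?_)
      h self_mem_Iic h
    rw [interior_Iic] at hν
    rw [(hd ν).deriv]
    have := Complex.normSq_nonneg (w.re + ν * Complex.I)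
    have := mem_Iio.1 hν
    apply div_nonneg _ (by assumption)
    nlinarith [sq_nonneg ‖modHankel' (w.re + ν * Complex.I)‖]

/-- Here the cross terms add up instead, with $e=2\langle H,H'\rangle$, and $2|H||H'|$ is at most
the energy. -/
theorem exists_hasDerivAt_hankelEnergy_real {x : ℝ} (hx : 0 < x) :
    ∃ e : ℝ, |e| ≤ hankelEnergy (x : ℂ) ∧ HasDerivAt (fun x : ℝ => hankelEnergy (x : ℂ))
      (2 * e - 2 * ‖modHankel' (x : ℂ)‖ ^ 2 / x) x := by
  have hw0 : 0 < ((x : ℂ)).re := by simpa using hx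
  have hline : HasDerivAt (fun x : ℝ => (x : ℂ)) 1 x := Complex.ofRealCLM.hasDerivAt (x := x)
  have h1 := ((hasDerivAt_modHankel hw0).scomp x hline).norm_sq
  have h2 := ((hasDerivAt_modHankel' hw0).scomp x hline).norm_sq
  refine ⟨2 * inner ℝ (modHankel (x : ℂ)) (modHankel' (x : ℂ)), ?_, (h1.add h2).congr_deriv ?_⟩
  · rw [abs_mul, abs_two]
    have := abs_real_inner_le_norm (modHankel (x : ℂ)) (modHankel' (x : ℂ))
    unfold hankelEnergy
    nlinarith [sq_nonneg (‖modHankel (x : ℂ)‖ - ‖modHankel' (x : ℂ)‖)]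
  · simp only [Function.comp_def, smul_eq_mul, one_mul]
    generalize modHankel (x : ℂ) = p
    generalize modHankel' (x : ℂ) = q
    rw [div_eq_mul_inv q (x : ℂ), ← Complex.ofReal_inv, ← Complex.normSq_eq_norm_sq]
    simp only [Complex.inner, Complex.mul_re, Complex.mul_im, Complex.conj_re, Complex.conj_im,
      Complex.sub_re, Complex.sub_im, Complex.ofReal_re,
      Complex.ofReal_im, Complex.normSq_apply q]
    field_simp
    ring

/-- For $x\ge1$, $e^{-2x}E$ is decreasing; for $x\le1$, $e^{2x}x^2E$ is increasing. Both are
compared with $x=1$. The true decay at infinity is not needed: the exponential in the wake integral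
beats this growth. -/
theorem hankelEnergy_real_le {x : ℝ} (hx : 0 < x) :
    hankelEnergy (x : ℂ) ≤ Real.exp 2 * hankelEnergy 1 * (Real.exp x * (1 + 1 / x)) ^ 2 := by
  have hE1 := hankelEnergy_nonneg 1
  have key : ∀ y : ℝ, 0 < y → ∃ e : ℝ, |e| ≤ hankelEnergy (y : ℂ) ∧
      HasDerivAt (fun x : ℝ => hankelEnergy (x : ℂ))
        (2 * e - 2 * ‖modHankel' (y : ℂ)‖ ^ 2 / y) y := fun y hy =>
    exists_hasDerivAt_hankelEnergy_real hy
  choose! e he hd using key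
  rcases le_total 1 x with h | h
  · have hd2 : ∀ y : ℝ, 0 < y → HasDerivAt (fun y : ℝ => Real.exp (-2 * y) * hankelEnergy (y : ℂ))
        (Real.exp (-2 * y) * (-2) * hankelEnergy (y : ℂ) + Real.exp (-2 * y) *
          (2 * e y - 2 * ‖modHankel' (y : ℂ)‖ ^ 2 / y)) y := fun y hy => by
      have := ((hasDerivAt_id y).const_mul (-2 : ℝ)).exp
      simp only [id, mul_one] at this
      exact this.mul (hd y hy)
    have h1 : (fun y : ℝ => Real.exp (-2 * y) * hankelEnergy (y : ℂ)) x ≤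
        (fun y : ℝ => Real.exp (-2 * y) * hankelEnergy (y : ℂ)) 1 := by
      refine antitoneOn_of_deriv_nonpos (convex_Ici (1 : ℝ))
        (fun y hy => (hd2 y (by linarith [mem_Ici.1 hy])).continuousAt.continuousWithinAt)
        (fun y hy => ?_) (fun y hy => ?_) self_mem_Ici h h
      · rw [interior_Ici] at hy
        exact (hd2 y (by linarith [mem_Ioi.1 hy])).differentiableAt.differentiableWithinAt
      · rw [interior_Ici] at hy
        have hy0 : 0 < y := by linarith [mem_Ioi.1 hy]
        rw [(hd2 y hy0).deriv]
        have h3 := (abs_le.1 (he y hy0)).2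
        have h4 : 0 ≤ 2 * ‖modHankel' (y : ℂ)‖ ^ 2 / y := by positivity
        nlinarith [Real.exp_pos (-2 * y)]
    simp only [Complex.ofReal_one] at h1
    have h5 : hankelEnergy (x : ℂ) ≤ Real.exp (2 * x) * hankelEnergy 1 := by
      calc hankelEnergy (x : ℂ) = Real.exp (2 * x) * (Real.exp (-2 * x) * hankelEnergy (x : ℂ)) := by
            rw [← mul_assoc, ← Real.exp_add]; ring_nf; simp
        _ ≤ Real.exp (2 * x) * (Real.exp (-2 * 1) * hankelEnergy 1) := by gcongr
        _ ≤ Real.exp (2 * x) * (1 * hankelEnergy 1) := by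
            gcongr
            rw [Real.exp_le_one_iff]; norm_num
        _ = _ := by ring
    refine h5.trans ?_
    have h6 : 1 ≤ (1 + 1 / x) ^ 2 := one_le_pow₀ (by linarith [one_div_pos.2 hx])
    have h7 : 1 ≤ Real.exp 2 := Real.one_le_exp (by norm_num)
    have h8 : Real.exp (2 * x) = Real.exp x ^ 2 := by rw [← Real.exp_nat_mul]; norm_num
    rw [mul_pow, h8]
    calc Real.exp x ^ 2 * hankelEnergy 1 = 1 * hankelEnergy 1 * (Real.exp x ^ 2 * 1) := by ring
      _ ≤ _ := by gcongr
  · have hd2 : ∀ y : ℝ, 0 < y → HasDerivAt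
        (fun y : ℝ => (Real.exp (2 * y) * y ^ 2) * hankelEnergy (y : ℂ))
        ((Real.exp (2 * y) * 2 * y ^ 2 + Real.exp (2 * y) * (2 * y)) * hankelEnergy (y : ℂ)
          + Real.exp (2 * y) * y ^ 2 *
          (2 * e y - 2 * ‖modHankel' (y : ℂ)‖ ^ 2 / y)) y := fun y hy => by
      have h1 := ((hasDerivAt_id y).const_mul (2 : ℝ)).exp
      have h2 := hasDerivAt_pow 2 y
      simp only [id, mul_one] at h1
      norm_num at h2
      exact (h1.mul h2).mul (hd y hy)
    have h1 : (fun y : ℝ => (Real.exp (2 * y) * y ^ 2) * hankelEnergy (y : ℂ)) x ≤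
        (fun y : ℝ => (Real.exp (2 * y) * y ^ 2) * hankelEnergy (y : ℂ)) 1 := by
      refine monotoneOn_of_deriv_nonneg (convex_Icc x (1 : ℝ))
        (fun y hy => (hd2 y (by linarith [hy.1])).continuousAt.continuousWithinAt)
        (fun y hy => ?_) (fun y hy => ?_) (left_mem_Icc.2 h) (right_mem_Icc.2 h) h
      · rw [interior_Icc] at hy
        exact (hd2 y (by linarith [hy.1])).differentiableAt.differentiableWithinAt
      · rw [interior_Icc] at hy
        have hy0 : 0 < y := by linarith [hy.1]
        rw [(hd2 y hy0).deriv]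
        have h3 := (abs_le.1 (he y hy0)).1
        have h4 : ‖modHankel' (y : ℂ)‖ ^ 2 ≤ hankelEnergy (y : ℂ) := by
          unfold hankelEnergy; linarith [sq_nonneg ‖modHankel (y : ℂ)‖]
        have h5 : y ^ 2 * (2 * ‖modHankel' (y : ℂ)‖ ^ 2 / y) = 2 * y * ‖modHankel' (y : ℂ)‖ ^ 2 := by
          field_simp
        have h6 : (Real.exp (2 * y) * 2 * y ^ 2 + Real.exp (2 * y) * (2 * y)) * hankelEnergy (y : ℂ)
          + Real.exp (2 * y) * y ^ 2 * (2 * e y - 2 * ‖modHankel' (y : ℂ)‖ ^ 2 / y)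
          = Real.exp (2 * y) * (2 * y ^ 2 * (hankelEnergy (y : ℂ) + e y)
            + 2 * y * (hankelEnergy (y : ℂ) - ‖modHankel' (y : ℂ)‖ ^ 2)) := by
          linear_combination (-Real.exp (2 * y)) * h5
        rw [h6]
        have h7 : 0 ≤ hankelEnergy (y : ℂ) + e y := by linarith
        have h8 : 0 ≤ hankelEnergy (y : ℂ) - ‖modHankel' (y : ℂ)‖ ^ 2 := by linarith
        positivity
    simp only [Complex.ofReal_one, mul_one, one_pow] at h1
    have h9 : 1 ≤ Real.exp (2 * x) := Real.one_le_exp (by linarith)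
    have h10 : hankelEnergy (x : ℂ) ≤ Real.exp 2 * hankelEnergy 1 * (1 / x) ^ 2 := by
      rw [div_pow, one_pow, mul_one_div, le_div_iff₀ (by positivity)]
      refine le_trans ?_ h1
      have := hankelEnergy_nonneg (x : ℂ)
      calc hankelEnergy (x : ℂ) * x ^ 2 = 1 * (x ^ 2 * hankelEnergy (x : ℂ)) := by ring
        _ ≤ Real.exp (2 * x) * (x ^ 2 * hankelEnergy (x : ℂ)) := by gcongr
        _ = _ := by ring
    refine h10.trans ?_
    have h11 : 1 ≤ Real.exp x := Real.one_le_exp hx.le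
    have h12 : 0 < 1 / x := by positivity
    gcongr
    nlinarith

/-- Bound for the modified Hankel function and its derivative in the right half-plane. -/
theorem exists_norm_modHankel_le : ∃ C : ℝ, 0 < C ∧ ∀ w : ℂ, 0 < w.re →
    ‖modHankel w‖ ≤ C * (Real.exp w.re * (1 + 1 / w.re)) ∧
    ‖modHankel' w‖ ≤ C * (Real.exp w.re * (1 + 1 / w.re)) := by
  set K := Real.exp 2 * hankelEnergy 1 with hK
  have hK0 : 0 ≤ K := by have := hankelEnergy_nonneg 1; positivity
  refine ⟨√K + 1, by positivity, fun w hw => ?_⟩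
  have h1 := (hankelEnergy_le_re hw).trans (hankelEnergy_real_le hw)
  rw [← hK] at h1
  set T := Real.exp w.re * (1 + 1 / w.re) with hT
  have hT0 : 0 ≤ T := by positivity
  have h2 : hankelEnergy w ≤ ((√K + 1) * T) ^ 2 := by
    have h4 : K ≤ (√K + 1) ^ 2 := by nlinarith [Real.sq_sqrt hK0, Real.sqrt_nonneg K]
    calc hankelEnergy w ≤ K * T ^ 2 := h1
      _ ≤ (√K + 1) ^ 2 * T ^ 2 := mul_le_mul_of_nonneg_right h4 (sq_nonneg T)
      _ = _ := by ring
  have h3 : 0 ≤ (√K + 1) * T := by positivity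
  unfold hankelEnergy at h2
  constructor
  · exact (abs_le_of_sq_le_sq' (by nlinarith [sq_nonneg ‖modHankel' w‖]) h3).2
  · exact (abs_le_of_sq_le_sq' (by nlinarith [sq_nonneg ‖modHankel w‖]) h3).2

/-! ### The Hankel function along rays from the origin -/

theorem continuous_powSum {c : ℕ → ℂ} (hc : ∀ k, ‖c k‖ ≤ 1 / k.factorial) :
    Continuous (powSum c) :=
  continuous_iff_continuousAt.2 fun x => (hasDerivAt_powSum hc x).continuousAt

/-- Only the term $1/w$ of the derivative survives, since each logarithm comes with a factor $t^2$.
The limit fixes the coefficient of the Cauchy singularity. -/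
theorem tendsto_mul_modHankel' {κ : ℂ} (hκ : 0 < κ.re) :
    Tendsto (fun t : ℝ => κ * t * modHankel' (κ * t)) (𝓝[>] 0) (𝓝 (2 * Complex.I / Real.pi)) := by
  have hκ0 : κ ≠ 0 := by rintro rfl; simp at hκ
  have ht : Tendsto (fun t : ℝ => (t : ℂ)) (𝓝[>] 0) (𝓝 0) := by
    have := (Complex.continuous_ofReal.tendsto 0).mono_left (nhdsWithin_le_nhds (s := Ioi 0))
    simpa using this
  have hx : Tendsto (fun t : ℝ => (κ * t) ^ 2 / 4) (𝓝[>] 0) (𝓝 0) := by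
    have := ((ht.const_mul κ).pow 2).div_const 4
    simpa using this
  have hp : ∀ {c : ℕ → ℂ}, (∀ k, ‖c k‖ ≤ 1 / k.factorial) →
      Tendsto (fun t : ℝ => powSum c ((κ * t) ^ 2 / 4)) (𝓝[>] 0) (𝓝 (c 0)) := fun {c} hc => by
    have := ((continuous_powSum hc).tendsto 0).comp hx
    rwa [powSum_zero] at this
  have hlog : Tendsto (fun t : ℝ => (t : ℂ) ^ 2 * (Complex.log (κ * t / 2)
      + Real.eulerMascheroniConstant)) (𝓝[>] 0) (𝓝 0) := by
    have h1 : Tendsto (fun t : ℝ => Real.log t * t ^ 2) (𝓝[>] 0) (𝓝 0) := by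
      have := tendsto_log_mul_rpow_nhdsGT_zero (r := 2) two_pos
      simpa using this
    have h2 := (Complex.continuous_ofReal.tendsto 0).comp h1
    have h3 := h2.add ((ht.pow 2).mul_const (Complex.log (κ / 2) + Real.eulerMascheroniConstant))
    simp only [Complex.ofReal_zero, ne_eq, OfNat.ofNat_ne_zero, not_false_eq_true, zero_pow,
      zero_mul, add_zero] at h3
    refine h3.congr' ?_
    filter_upwards [self_mem_nhdsWithin] with t ht
    rw [mem_Ioi] at ht
    have e : κ * t / 2 = (t : ℂ) * (κ / 2) := by ring
    rw [e, Complex.log_ofReal_mul ht (div_ne_zero hκ0 two_ne_zero)]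
    simp only [Function.comp_apply]
    push_cast
    ring
  have hb0 : besselCoeff 0 = 1 := by simp [besselCoeff]
  have h := (((hp norm_besselCoeff_le).add ((hlog.mul (hp (norm_derivCoeff_le
    norm_besselCoeff_le))).mul_const (κ ^ 2 / 2))).sub
    ((hp (norm_derivCoeff_le norm_harmonicCoeff_le)).mul
      ((ht.pow 2).mul_const (κ ^ 2 / 2)))).const_mul (2 * Complex.I / Real.pi)
  simp only [hb0, zero_mul, add_zero, ne_eq, OfNat.ofNat_ne_zero, not_false_eq_true, zero_pow,
    mul_zero, sub_zero, mul_one] at h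
  refine h.congr' ?_
  filter_upwards [self_mem_nhdsWithin] with t ht
  have ht0 : (t : ℂ) ≠ 0 := by exact_mod_cast (mem_Ioi.1 ht).ne'
  rw [modHankel']
  field_simp

theorem hasDerivAt_ofReal_mul (κ : ℂ) (t : ℝ) : HasDerivAt (fun t : ℝ => κ * (t : ℂ)) κ t := by
  simpa using (Complex.ofRealCLM.hasDerivAt (x := t)).const_mul κ

theorem re_mul_ofReal_pos {κ : ℂ} (hκ : 0 < κ.re) {t : ℝ} (ht : 0 < t) : 0 < (κ * (t : ℂ)).re := by
  rw [Complex.re_mul_ofReal]; positivity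

theorem hasDerivAt_modHankel_ray {κ : ℂ} (hκ : 0 < κ.re) {t : ℝ} (ht : 0 < t) :
    HasDerivAt (fun t : ℝ => modHankel (κ * t)) (κ * modHankel' (κ * t)) t :=
  HasDerivAt.scomp (g₁ := modHankel) t (hasDerivAt_modHankel (re_mul_ofReal_pos hκ ht)) (hasDerivAt_ofReal_mul κ t)

theorem hasDerivAt_modHankel'_ray {κ : ℂ} (hκ : 0 < κ.re) {t : ℝ} (ht : 0 < t) :
    HasDerivAt (fun t : ℝ => modHankel' (κ * t))
      (κ * (modHankel (κ * t) - modHankel' (κ * t) / (κ * t))) t :=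
  HasDerivAt.scomp (g₁ := modHankel') t (hasDerivAt_modHankel' (re_mul_ofReal_pos hκ ht)) (hasDerivAt_ofReal_mul κ t)

/-- The part of `∂ₜ H₀⁽¹⁾(iκt)` left after its Cauchy singularity is removed. -/
def hankelDerivReg (κ : ℂ) (t : ℝ) : ℂ := κ * modHankel' (κ * t) - 2 * Complex.I / Real.pi / t

/-- Bessel's equation in divergence form. Combined with the limit at 0, it presents $t$ times
`hankelDerivReg` as the increment from $0$ of a function with derivative $\kappa^2tH(\kappa t)$. -/
theorem hasDerivAt_mul_hankelDerivReg {κ : ℂ} (hκ : 0 < κ.re) {t : ℝ} (ht : 0 < t) :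
    HasDerivAt (fun t : ℝ => κ * t * modHankel' (κ * t)) (κ ^ 2 * t * modHankel (κ * t)) t := by
  have hκ0 : κ ≠ 0 := by rintro rfl; simp at hκ
  have ht0 : (t : ℂ) ≠ 0 := by exact_mod_cast ht.ne'
  refine ((hasDerivAt_ofReal_mul κ t).mul (hasDerivAt_modHankel'_ray hκ ht)).congr_deriv ?_
  field_simp
  ring

theorem hasDerivAt_hankelDerivReg {κ : ℂ} (hκ : 0 < κ.re) {t : ℝ} (ht : 0 < t) :
    HasDerivAt (hankelDerivReg κ) (κ ^ 2 * modHankel (κ * t) - hankelDerivReg κ t / t) t := by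
  have hκ0 : κ ≠ 0 := by rintro rfl; simp at hκ
  have ht0 : (t : ℂ) ≠ 0 := by exact_mod_cast ht.ne'
  have h1 : HasDerivAt (fun t : ℝ => 2 * Complex.I / Real.pi / (t : ℂ))
      (2 * Complex.I / Real.pi * (-1 / (t : ℂ) ^ 2)) t := by
    have h := (Complex.ofRealCLM.hasDerivAt (x := t)).inv (by simpa using ht0)
    simp only [Complex.ofRealCLM_apply] at h
    simpa [div_eq_mul_inv] using h.const_mul (2 * Complex.I / (Real.pi : ℂ))
  refine (((hasDerivAt_modHankel'_ray hκ ht).const_mul κ).sub h1).congr_deriv ?_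
  rw [hankelDerivReg]
  field_simp
  ring

theorem abs_log_le_two_div_sqrt {t : ℝ} (ht : 0 < t) (ht1 : t ≤ 1) : |Real.log t| ≤ 2 * (1 / √t) := by
  have hs : 0 < √t := Real.sqrt_pos.2 ht
  rw [abs_of_nonpos (Real.log_nonpos ht.le ht1)]
  have h1 := Real.log_le_sub_one_of_pos (x := 1 / √t) (by positivity)
  rw [Real.log_div one_ne_zero hs.ne', Real.log_one, Real.log_sqrt ht.le] at h1
  linarith

/-- Bounds for the modified Hankel function along rays in a vertical strip. -/
theorem exists_ray_bounds {d D : ℝ} (hd : 0 < d) :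
    ∃ C : ℝ, 0 < C ∧ ∀ κ : ℂ, d ≤ κ.re → κ.re ≤ D →
      (∀ t : ℝ, 0 < t → t ≤ 2 → ‖κ * t * modHankel' (κ * t)‖ ≤ C * (1 + ‖κ‖)) ∧
      (∀ t : ℝ, 0 < t → ‖modHankel (κ * t)‖ ≤
        C * (1 + ‖κ‖) * ((1 + 1 / √t) * Real.exp (κ.re * t))) ∧
      (∀ t₁ t₂ : ℝ, 0 < t₁ → t₁ ≤ 2 → 0 < t₂ → t₂ ≤ 2 →
        ‖modHankel (κ * t₁) - modHankel (κ * t₂)‖ ≤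
          C * (1 + ‖κ‖) * |Real.log t₁ - Real.log t₂|) := by
  obtain ⟨C₀, hC₀, hC⟩ := exists_norm_modHankel_le
  set C₁ := C₀ * (Real.exp (2 * |D|) * (2 + 1 / d)) with hC₁
  have hC₁0 : 0 < C₁ := by positivity
  have hD : D ≤ |D| := le_abs_self D
  have hE : 1 ≤ Real.exp (2 * |D|) := Real.one_le_exp (by positivity)
  refine ⟨3 * C₁, by positivity, fun κ hκd hκD => ?_⟩
  have hκ : 0 < κ.re := hd.trans_le hκd
  have hb1 : ∀ t : ℝ, 0 < t → t ≤ 2 → ‖κ * t * modHankel' (κ * t)‖ ≤ C₁ * (1 + ‖κ‖) := by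
    intro t ht ht2
    have h := (hC (κ * t) (re_mul_ofReal_pos hκ ht)).2
    rw [Complex.re_mul_ofReal] at h
    rw [norm_mul, norm_mul, Complex.norm_real, Real.norm_of_nonneg ht.le]
    have h1 : t * (1 + 1 / (κ.re * t)) ≤ 2 + 1 / d := by
      have : t * (1 + 1 / (κ.re * t)) = t + 1 / κ.re := by field_simp
      rw [this]
      gcongr
    have h2 : Real.exp (κ.re * t) ≤ Real.exp (2 * |D|) := by
      rw [Real.exp_le_exp]; nlinarith [abs_nonneg D]
    calc ‖κ‖ * t * ‖modHankel' (κ * t)‖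
        ≤ ‖κ‖ * t * (C₀ * (Real.exp (κ.re * t) * (1 + 1 / (κ.re * t)))) := by gcongr
      _ = C₀ * (Real.exp (κ.re * t) * (t * (1 + 1 / (κ.re * t)))) * ‖κ‖ := by ring
      _ ≤ C₀ * (Real.exp (2 * |D|) * (2 + 1 / d)) * (1 + ‖κ‖) := by
          gcongr
          linarith
  have hlog : ∀ t₁ t₂ : ℝ, 0 < t₁ → t₁ ≤ 2 → 0 < t₂ → t₂ ≤ 2 →
        ‖modHankel (κ * t₁) - modHankel (κ * t₂)‖ ≤
          C₁ * (1 + ‖κ‖) * |Real.log t₁ - Real.log t₂| := by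
    intro t₁ t₂ h₁ h₁' h₂ h₂'
    -- In the variable $r=\log t$ the derivative is $\kappa tH'(\kappa t)$, bounded by `hb1`; hence
    -- $H(\kappa t)$ is Lipschitz in $\log t$.
    have hder : ∀ r : ℝ, HasDerivAt (fun r : ℝ => modHankel (κ * (Real.exp r : ℝ)))
        (κ * (Real.exp r : ℝ) * modHankel' (κ * (Real.exp r : ℝ))) r := fun r => by
      refine ((hasDerivAt_modHankel_ray hκ (Real.exp_pos r)).scomp r
        (Real.hasDerivAt_exp r)).congr_deriv ?_
      rw [Complex.real_smul]; ring
    have := (convex_Iic (Real.log 2)).norm_image_sub_le_of_norm_hasDerivWithin_le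
      (f := fun r : ℝ => modHankel (κ * (Real.exp r : ℝ))) (C := C₁ * (1 + ‖κ‖))
      (fun r _ => (hder r).hasDerivWithinAt)
      (fun r hr => hb1 _ (Real.exp_pos r) (by
        rw [← Real.exp_log two_pos]; exact Real.exp_le_exp.2 hr))
      (Real.log_le_log h₂ h₂') (Real.log_le_log h₁ h₁')
    simpa only [Real.exp_log h₁, Real.exp_log h₂, Real.norm_eq_abs] using this
  have hb0 : ∀ t : ℝ, 1 ≤ t → ‖modHankel (κ * t)‖ ≤ C₁ * Real.exp (κ.re * t) := by
    intro t ht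
    have ht0 : 0 < t := by linarith
    have h := (hC (κ * t) (re_mul_ofReal_pos hκ ht0)).1
    rw [Complex.re_mul_ofReal] at h
    refine h.trans ?_
    have h1 : 1 + 1 / (κ.re * t) ≤ 2 + 1 / d := by
      have : d ≤ κ.re * t := by nlinarith
      have := one_div_le_one_div_of_le hd this
      linarith
    calc C₀ * (Real.exp (κ.re * t) * (1 + 1 / (κ.re * t)))
        ≤ C₀ * (Real.exp (κ.re * t) * (1 * (2 + 1 / d))) := by rw [one_mul]; gcongr
      _ ≤ C₀ * (Real.exp (κ.re * t) * (Real.exp (2 * |D|) * (2 + 1 / d))) := by gcongr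
      _ = _ := by ring
  refine ⟨fun t ht ht2 => (hb1 t ht ht2).trans (by gcongr; linarith), fun t ht => ?_,
    fun t₁ t₂ h₁ h₁' h₂ h₂' => (hlog t₁ t₂ h₁ h₁' h₂ h₂').trans (by gcongr; linarith)⟩
  have hsq : 0 < 1 / √t := by have := Real.sqrt_pos.2 ht; positivity
  rcases le_total 1 t with h | h
  · refine (hb0 t h).trans ?_
    calc C₁ * Real.exp (κ.re * t) = C₁ * 1 * (1 * Real.exp (κ.re * t)) := by ring
      _ ≤ 3 * C₁ * (1 + ‖κ‖) * ((1 + 1 / √t) * Real.exp (κ.re * t)) := by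
        gcongr
        · linarith
        · linarith [norm_nonneg κ]
        · linarith
  · have h1 := hlog t 1 ht (by linarith) one_pos (by norm_num)
    rw [Real.log_one, sub_zero] at h1
    have h2 := hC (κ * (1 : ℝ)) (re_mul_ofReal_pos hκ one_pos)
    have h3 : ‖modHankel (κ * (1 : ℝ))‖ ≤ C₁ := by
      refine h2.1.trans ?_
      rw [Complex.re_mul_ofReal, mul_one, hC₁]
      have : 1 / κ.re ≤ 1 / d := by gcongr
      gcongr
      · nlinarith [abs_nonneg D]
      · linarith
    have h4 := abs_log_le_two_div_sqrt ht h
    have h5 : 1 ≤ Real.exp (κ.re * t) := Real.one_le_exp (by positivity)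
    calc ‖modHankel (κ * t)‖ = ‖(modHankel (κ * t) - modHankel (κ * (1 : ℝ))) + modHankel (κ * (1 : ℝ))‖ := by
          ring_nf
      _ ≤ C₁ * (1 + ‖κ‖) * |Real.log t| + C₁ := (norm_add_le _ _).trans (add_le_add h1 h3)
      _ ≤ C₁ * (1 + ‖κ‖) * (2 * (1 / √t)) + C₁ * (1 + ‖κ‖) := by
          gcongr
          nlinarith [norm_nonneg κ]
      _ ≤ C₁ * (1 + ‖κ‖) * (3 * ((1 + 1 / √t) * 1)) := by
          have : 0 < C₁ * (1 + ‖κ‖) := by positivity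
          nlinarith
      _ ≤ C₁ * (1 + ‖κ‖) * (3 * ((1 + 1 / √t) * Real.exp (κ.re * t))) := by gcongr
      _ = _ := by ring

/-! ### Integrable majorants and the regularised derivative -/

theorem integrable_comp_abs {f : ℝ → ℝ} (hf : IntegrableOn f (Ioi 0)) :
    Integrable fun x => f |x| := by
  have h1 : IntegrableOn (fun x => f |x|) (Ioi 0) :=
    hf.congr_fun (fun x hx => by simp only [abs_of_pos (mem_Ioi.1 hx)]) measurableSet_Ioi
  have h2 : IntegrableOn (fun x ↦ f |x|) (Iic 0) := by
    rw [← Measure.map_neg_eq_self (volume : Measure ℝ)]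
    let m : MeasurableEmbedding fun x : ℝ => -x := (Homeomorph.neg ℝ).measurableEmbedding
    rw [m.integrableOn_map_iff]
    simp_rw [Function.comp_def, abs_neg, neg_preimage, neg_Iic, neg_zero]
    exact Iff.mpr integrableOn_Ici_iff_integrableOn_Ioi h1
  rw [← integrableOn_univ, ← Iic_union_Ioi (a := (0 : ℝ))]
  exact h2.union h1

/-- An integrable majorant with an inverse square root singularity and exponential decay. -/
def decayWeight (η v : ℝ) : ℝ := (1 + 1 / √|v|) * Real.exp (-η * |v|)

theorem decayWeight_nonneg (η v : ℝ) : 0 ≤ decayWeight η v := by unfold decayWeight; positivity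

theorem integrable_decayWeight {η : ℝ} (hη : 0 < η) : Integrable (decayWeight η) := by
  have h0 := integrableOn_rpow_mul_exp_neg_mul_rpow (p := 1) (s := 0) (b := η) (by norm_num)
    one_pos hη
  have h1 := integrableOn_rpow_mul_exp_neg_mul_rpow (p := 1) (s := -(1 / 2)) (b := η) (by norm_num)
    one_pos hη
  refine integrable_comp_abs (f := fun v => (1 + 1 / √v) * Real.exp (-η * v))
    ((h0.add h1).congr_fun (fun v hv => ?_) measurableSet_Ioi)
  have hv0 : 0 < v := hv
  simp only [Pi.add_apply, Real.rpow_zero, Real.rpow_one, one_mul]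
  rw [Real.rpow_neg hv0.le, ← Real.sqrt_eq_rpow]
  ring

theorem integrableOn_one_div_sqrt_Ioc (b : ℝ) :
    IntegrableOn (fun x : ℝ => 1 / √x) (Ioc 0 b) := by
  rcases le_total 0 b with hb | hb
  · have h := (intervalIntegral.intervalIntegrable_rpow' (a := 0) (b := b) (r := -(1 / 2))
      (by norm_num)).1
    refine h.congr_fun (fun x hx => ?_) measurableSet_Ioc
    simp only
    rw [Real.rpow_neg hx.1.le, ← Real.sqrt_eq_rpow, one_div]
  · rw [Ioc_eq_empty (not_lt.2 hb)]; exact integrableOn_empty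

theorem setIntegral_one_div_sqrt_Ioc {b : ℝ} (hb : 0 ≤ b) :
    ∫ x in Ioc 0 b, 1 / √x = 2 * √b := by
  have h := integral_rpow (a := 0) (b := b) (r := -(1 / 2)) (Or.inl (by norm_num))
  rw [intervalIntegral.integral_of_le hb] at h
  have e : ∫ x in Ioc 0 b, 1 / √x = ∫ x in Ioc 0 b, x ^ (-(1 / 2) : ℝ) := by
    refine setIntegral_congr_fun measurableSet_Ioc fun x hx => ?_
    rw [Real.rpow_neg hx.1.le, ← Real.sqrt_eq_rpow, one_div]
  rw [e, h, Real.sqrt_eq_rpow]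
  norm_num
  ring

/-- The integral of `|v|^{-1/2}` over an interval is at most a multiple of the square root of its
length. -/
theorem setIntegral_one_div_sqrt_abs_le {p q : ℝ} (hpq : p ≤ q) :
    IntegrableOn (fun v : ℝ => 1 / √|v|) (Ioc p q) ∧ ∫ v in Ioc p q, 1 / √|v| ≤ 5 * √(q - p) := by
  rcases hpq.eq_or_lt with rfl | hlt
  · simp
  set L := q - p with hL
  have hL0 : 0 < L := by simp only [hL]; linarith
  have hsL : 0 < √L := Real.sqrt_pos.2 hL0
  set f : ℝ → ℝ := (Ioc 0 L).indicator fun x => 1 / √x with hf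
  have hfint : Integrable f :=
    (integrable_indicator_iff measurableSet_Ioc).2 (integrableOn_one_div_sqrt_Ioc L)
  have hfabs : Integrable fun v : ℝ => f |v| := integrable_comp_abs hfint.integrableOn
  have hfval : ∫ v : ℝ, f |v| = 4 * √L := by
    rw [integral_comp_abs, hf, setIntegral_indicator measurableSet_Ioc,
      inter_eq_right.2 (fun x hx => hx.1), setIntegral_one_div_sqrt_Ioc hL0.le]
    ring
  have hf0 : ∀ x, 0 ≤ f x := fun x => indicator_nonneg (fun _ _ => by positivity) _
  have hle : ∀ v : ℝ, 1 / √|v| ≤ f |v| + 1 / √L := by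
    intro v
    -- At $v=0$ the quotient $1/\sqrt{|v|}$ has the value 0, by the convention for division by zero.
    rcases eq_or_ne v 0 with rfl | hv
    · have := hf0 |0|
      simp only [abs_zero, Real.sqrt_zero, div_zero] at this ⊢
      positivity
    · have hv' : 0 < |v| := abs_pos.2 hv
      rcases le_or_gt |v| L with h | h
      · have : f |v| = 1 / √|v| := indicator_of_mem (mem_Ioc.2 ⟨hv', h⟩) _
        rw [this]
        have : 0 < 1 / √L := by positivity
        linarith
      · have h1 : 1 / √|v| ≤ 1 / √L := one_div_le_one_div_of_le hsL (Real.sqrt_le_sqrt h.le)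
        linarith [hf0 |v|]
  have hint : IntegrableOn (fun v : ℝ => f |v| + 1 / √L) (Ioc p q) :=
    hfabs.integrableOn.add (integrableOn_const (by simp))
  have hI : IntegrableOn (fun v : ℝ => 1 / √|v|) (Ioc p q) := by
    refine hint.mono' (by measurability) (Eventually.of_forall fun v => ?_)
    rw [Real.norm_of_nonneg (by positivity)]
    exact hle v
  refine ⟨hI, ?_⟩
  calc ∫ v in Ioc p q, 1 / √|v| ≤ ∫ v in Ioc p q, (f |v| + 1 / √L) :=
        setIntegral_mono hI hint hle
    _ = (∫ v in Ioc p q, f |v|) + L * (1 / √L) := by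
        rw [integral_add hfabs.integrableOn (integrableOn_const (by simp)), setIntegral_const]
        simp [Measure.real, hlt.le, hL]
    _ ≤ (∫ v : ℝ, f |v|) + L * (1 / √L) := by
        gcongr
        · exact Eventually.of_forall fun v => hf0 _
        · exact Measure.restrict_le_self
    _ = 5 * √L := by
        rw [hfval, mul_one_div, Real.div_sqrt]; ring

theorem sqrt_add_le_of_two_mul_le {x y : ℝ} (hx : 0 ≤ x) (h : 2 * x ≤ y) :
    √x + √y ≤ 3 * √(y - x) := by
  have h1 : √x ≤ √(y - x) := Real.sqrt_le_sqrt (by linarith)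
  have h2 : √y ≤ 2 * √(y - x) := by
    rw [show (2 : ℝ) * √(y - x) = √(2 ^ 2 * (y - x)) by
      rw [Real.sqrt_mul (by norm_num), Real.sqrt_sq (by norm_num)]]
    exact Real.sqrt_le_sqrt (by linarith)
  linarith

/-- The regularised derivative of the Hankel function vanishes at `0` and is Hölder continuous of
exponent `1/2`. -/
theorem exists_hankelDerivReg_bounds {d D : ℝ} (hd : 0 < d) :
    ∃ C : ℝ, 0 < C ∧ ∀ κ : ℂ, d ≤ κ.re → κ.re ≤ D →
      (∀ t : ℝ, 0 < t → t ≤ 2 → ‖hankelDerivReg κ t‖ ≤ C * (1 + ‖κ‖) ^ 3 * √t) ∧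
      (∀ t₁ t₂ : ℝ, 0 < t₁ → t₁ ≤ 2 → 0 < t₂ → t₂ ≤ 2 →
        ‖hankelDerivReg κ t₁ - hankelDerivReg κ t₂‖ ≤ C * (1 + ‖κ‖) ^ 3 * √|t₁ - t₂|) := by
  obtain ⟨C₀, hC₀, hC⟩ := exists_ray_bounds (D := D) hd
  set C₁ := C₀ * Real.exp (2 * |D|) with hC₁
  have hC₁0 : 0 < C₁ := by positivity
  refine ⟨18 * C₁, by positivity, fun κ hκd hκD => ?_⟩
  have hκ : 0 < κ.re := hd.trans_le hκd
  have hκ0 : κ ≠ 0 := by rintro rfl; simp at hκ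
  obtain ⟨-, hC0, -⟩ := hC κ hκd hκD
  set M := C₁ * (1 + ‖κ‖) ^ 3 with hM
  have hM0 : 0 < M := by positivity
  have hMb : ∀ t : ℝ, 0 < t → t ≤ 2 → ‖κ ^ 2 * modHankel (κ * t)‖ ≤ M * (1 + 1 / √t) := by
    intro t ht ht2
    have h1 : Real.exp (κ.re * t) ≤ Real.exp (2 * |D|) := by
      rw [Real.exp_le_exp]; nlinarith [abs_nonneg D, le_abs_self D]
    rw [norm_mul, norm_pow]
    calc ‖κ‖ ^ 2 * ‖modHankel (κ * t)‖
        ≤ (1 + ‖κ‖) ^ 2 * (C₀ * (1 + ‖κ‖) * ((1 + 1 / √t) * Real.exp (2 * |D|))) := by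
          gcongr
          · linarith
          · exact (hC0 t ht).trans (by gcongr)
      _ = M * (1 + 1 / √t) := by rw [hM, hC₁]; ring
  have hMb' : ∀ t : ℝ, 0 < t → t ≤ 2 → M * (1 + 1 / √t) * t ≤ 3 * M * √t := by
    intro t ht ht2
    have hs := Real.sqrt_pos.2 ht
    have hsq := Real.mul_self_sqrt ht.le
    have hs2 : √t ≤ 2 := by
      rw [show (2 : ℝ) = √(2 ^ 2) by rw [Real.sqrt_sq (by norm_num)]]
      exact Real.sqrt_le_sqrt (by linarith)
    have e : (1 + 1 / √t) * t = t + √t := by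
      have : 1 / √t * t = √t := by rw [div_mul_eq_mul_div, one_mul, Real.div_sqrt]
      rw [add_mul, this, one_mul]
    rw [mul_assoc, e]
    have h1 : t + √t ≤ 3 * √t := by nlinarith
    calc M * (t + √t) ≤ M * (3 * √t) := by gcongr
      _ = _ := by ring
  have hbd : ∀ t : ℝ, 0 < t → t ≤ 2 → ‖hankelDerivReg κ t‖ ≤ 3 * M * √t := by
    intro t ht ht2
    -- The increment over $[\varepsilon,t]$ is estimated by the mean value inequality; letting
    -- $\varepsilon\to0$ gives the bound for $t$ times `hankelDerivReg`.
    have hincr : ∀ ε : ℝ, 0 < ε → ε ≤ t →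
        ‖κ * t * modHankel' (κ * t) - κ * ε * modHankel' (κ * ε)‖ ≤ 3 * M * √t * (t - ε) := by
      intro ε hε hεt
      have := (convex_Icc ε t).norm_image_sub_le_of_norm_hasDerivWithin_le
        (f := fun t : ℝ => κ * t * modHankel' (κ * t)) (C := 3 * M * √t)
        (fun x hx => (hasDerivAt_mul_hankelDerivReg hκ (hε.trans_le hx.1)).hasDerivWithinAt)
        (fun x hx => by
          have hx0 : 0 < x := hε.trans_le hx.1
          have h1 := hMb x hx0 (hx.2.trans ht2)
          rw [mul_right_comm, norm_mul, Complex.norm_real, Real.norm_of_nonneg hx0.le]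
          calc _ ≤ M * (1 + 1 / √x) * x := by gcongr
            _ ≤ 3 * M * √x := hMb' x hx0 (hx.2.trans ht2)
            _ ≤ _ := by gcongr; exact hx.2)
        (left_mem_Icc.2 hεt) (right_mem_Icc.2 hεt)
      rwa [Real.norm_of_nonneg (by linarith)] at this
    have hlim : ‖κ * t * modHankel' (κ * t) - 2 * Complex.I / Real.pi‖ ≤ 3 * M * √t * (t - 0) := by
      refine le_of_tendsto_of_tendsto
        ((tendsto_const_nhds.sub (tendsto_mul_modHankel' hκ)).norm)
        ((tendsto_const_nhds.sub (tendsto_id.mono_left nhdsWithin_le_nhds)).const_mul (3 * M * √t)) ?_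
      filter_upwards [Ioc_mem_nhdsGT ht] with ε hε
      exact hincr ε hε.1 hε.2
    have ht0 : (t : ℂ) ≠ 0 := by exact_mod_cast ht.ne'
    have e : κ * t * modHankel' (κ * t) - 2 * Complex.I / Real.pi = t * hankelDerivReg κ t := by
      rw [hankelDerivReg]; field_simp
    rw [e, norm_mul, Complex.norm_real, Real.norm_of_nonneg ht.le, sub_zero] at hlim
    nlinarith
  have hholder : ∀ t₁ t₂ : ℝ, 0 < t₁ → t₁ ≤ t₂ → t₂ ≤ 2 →
      ‖hankelDerivReg κ t₂ - hankelDerivReg κ t₁‖ ≤ 18 * M * √(t₂ - t₁) := by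
    intro t₁ t₂ h₁ h₁₂ h₂
    -- If $t_2\ge2t_1$, both values are $O(\sqrt{t_2-t_1})$. Otherwise the derivative is
    -- $O(t_1^{-1/2})$ on the interval and $t_2-t_1\le t_1$.
    rcases le_total (2 * t₁) t₂ with h | h
    · calc _ ≤ ‖hankelDerivReg κ t₂‖ + ‖hankelDerivReg κ t₁‖ := norm_sub_le _ _
        _ ≤ 3 * M * √t₂ + 3 * M * √t₁ :=
            add_le_add (hbd _ (by linarith) h₂) (hbd _ h₁ (by linarith))
        _ = 3 * M * (√t₁ + √t₂) := by ring
        _ ≤ 3 * M * (3 * √(t₂ - t₁)) := by gcongr; exact sqrt_add_le_of_two_mul_le h₁.le h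
        _ ≤ _ := by nlinarith [mul_nonneg hM0.le (Real.sqrt_nonneg (t₂ - t₁))]
    · have hs1 := Real.sqrt_pos.2 h₁
      have := (convex_Icc t₁ t₂).norm_image_sub_le_of_norm_hasDerivWithin_le
        (f := hankelDerivReg κ) (C := 6 * M * (1 / √t₁))
        (fun x hx => (hasDerivAt_hankelDerivReg hκ (h₁.trans_le hx.1)).hasDerivWithinAt)
        (fun x hx => by
          have hx0 : 0 < x := h₁.trans_le hx.1
          have hsx := Real.sqrt_pos.2 hx0
          have hx2 := hx.2.trans h₂
          have e1 : ‖hankelDerivReg κ x / x‖ ≤ 3 * M * (1 / √x) := by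
            rw [norm_div, Complex.norm_real, Real.norm_of_nonneg hx0.le, div_le_iff₀ hx0]
            refine (hbd x hx0 hx2).trans_eq ?_
            rw [mul_assoc (3 * M), div_mul_eq_mul_div, one_mul, Real.div_sqrt]
          have e2 : M * (1 + 1 / √x) ≤ 3 * M * (1 / √x) := by
            have := hMb' x hx0 hx2
            rw [← le_div_iff₀ hx0] at this
            refine this.trans_eq ?_
            rw [mul_div_assoc, Real.sqrt_div_self']
          have e3 : 1 / √x ≤ 1 / √t₁ := one_div_le_one_div_of_le hs1 (Real.sqrt_le_sqrt hx.1)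
          calc _ ≤ ‖κ ^ 2 * modHankel (κ * x)‖ + ‖hankelDerivReg κ x / x‖ := norm_sub_le _ _
            _ ≤ 3 * M * (1 / √x) + 3 * M * (1 / √x) :=
                add_le_add ((hMb x hx0 hx2).trans e2) e1
            _ = 6 * M * (1 / √x) := by ring
            _ ≤ _ := by gcongr)
        (left_mem_Icc.2 h₁₂) (right_mem_Icc.2 h₁₂)
      refine this.trans ?_
      have h3 : √(t₂ - t₁) ≤ √t₁ := Real.sqrt_le_sqrt (by linarith)
      have h4 := Real.mul_self_sqrt (sub_nonneg.2 h₁₂)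
      rw [Real.norm_of_nonneg (by linarith)]
      have h5 : 1 / √t₁ * (t₂ - t₁) ≤ √(t₂ - t₁) := by
        rw [div_mul_eq_mul_div, one_mul, div_le_iff₀ hs1]
        nlinarith [Real.sqrt_nonneg (t₂ - t₁)]
      calc 6 * M * (1 / √t₁) * (t₂ - t₁) = 6 * M * (1 / √t₁ * (t₂ - t₁)) := by ring
        _ ≤ 6 * M * √(t₂ - t₁) := by gcongr
        _ ≤ _ := by nlinarith [mul_nonneg hM0.le (Real.sqrt_nonneg (t₂ - t₁))]
  refine ⟨fun t ht ht2 => (hbd t ht ht2).trans ?_, fun t₁ t₂ h₁ h₁' h₂ h₂' => ?_⟩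
  · rw [mul_assoc 18 C₁, ← hM]
    gcongr
    norm_num
  · rw [mul_assoc 18 C₁, ← hM]
    rcases le_total t₁ t₂ with h | h
    · rw [norm_sub_rev, abs_sub_comm, abs_of_nonneg (sub_nonneg.2 h)]
      exact hholder t₁ t₂ h₁ h h₂'
    · rw [abs_of_nonneg (sub_nonneg.2 h)]
      exact hholder t₂ t₁ h₂ h h₁'

/-! ### The wake integral -/

theorem measurable_modHankel : Measurable modHankel := by
  have h1 := (continuous_powSum norm_besselCoeff_le).measurable
  have h2 := (continuous_powSum norm_harmonicCoeff_le).measurable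
  unfold modHankel
  fun_prop

theorem measurable_modHankel' : Measurable modHankel' := by
  have h0 := (continuous_powSum norm_besselCoeff_le).measurable
  have h1 := (continuous_powSum (norm_derivCoeff_le norm_besselCoeff_le)).measurable
  have h2 := (continuous_powSum (norm_derivCoeff_le norm_harmonicCoeff_le)).measurable
  unfold modHankel'
  fun_prop

theorem differentiableOn_modHankel : DifferentiableOn ℂ modHankel {w | 0 < w.re} := fun _ hw =>
  (hasDerivAt_modHankel hw).differentiableAt.differentiableWithinAt

theorem differentiableOn_modHankel' : DifferentiableOn ℂ modHankel' {w | 0 < w.re} := fun _ hw =>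
  (hasDerivAt_modHankel' hw).differentiableAt.differentiableWithinAt

/-- The integrand of the wake term. -/
def wakeIntegrand (κ : ℂ) (m t ρ v : ℝ) : ℂ :=
  Complex.exp (m * κ * (v - t : ℝ)) * modHankel (κ * ρ)

/-- The wake term `∫_{-∞}^t e^{mκ(v-t)} H₀⁽¹⁾(iκ|v|) dv`. -/
def wake (κ : ℂ) (m t : ℝ) : ℂ := ∫ v in Iic t, wakeIntegrand κ m t |v| v

/-- At $-\infty$ the factor $e^{m\operatorname{Re}\kappa\,v}$ beats the growth
$e^{\operatorname{Re}\kappa|v|}$ of the Hankel bound because $m>1$. The range $|v|\le\rho\le|v|+1$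
covers the radius for $0<y\le1$ as well as its limit $|v|$, so one majorant serves the passage
$y\to0^+$. -/
theorem exists_norm_wakeIntegrand_le {d D m : ℝ} (hd : 0 < d) (hm : 1 < m) :
    ∃ C : ℝ, 0 < C ∧ ∀ κ : ℂ, d ≤ κ.re → κ.re ≤ D → ∀ t ∈ Icc (-2 : ℝ) 2, ∀ v ρ : ℝ, v ≤ t →
      v ≠ 0 → |v| ≤ ρ → ρ ≤ |v| + 1 →
      ‖wakeIntegrand κ m t ρ v‖ ≤ C * (1 + ‖κ‖) * decayWeight ((m - 1) * d) v := by
  obtain ⟨C₀, hC₀, hC⟩ := exists_ray_bounds (D := D) hd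
  refine ⟨C₀ * Real.exp ((4 * m + 3) * |D|), by positivity,
    fun κ hκd hκD t ht v ρ hvt hv hρ1 hρ2 => ?_⟩
  have hv0 : 0 < |v| := abs_pos.2 hv
  have hρ0 : 0 < ρ := hv0.trans_le hρ1
  have hD : D ≤ |D| := le_abs_self D
  have h1 := (hC κ hκd hκD).2.1 ρ hρ0
  have h2 : ‖Complex.exp (m * κ * (v - t : ℝ))‖ = Real.exp (m * κ.re * (v - t)) := by
    rw [Complex.norm_exp, Complex.re_mul_ofReal, Complex.re_ofReal_mul]
  have h3 : 1 / √ρ ≤ 1 / √|v| :=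
    one_div_le_one_div_of_le (Real.sqrt_pos.2 hv0) (Real.sqrt_le_sqrt hρ1)
  have h4 : m * κ.re * (v - t) + κ.re * ρ ≤ (4 * m + 3) * |D| + -((m - 1) * d) * |v| := by
    set r := κ.re
    have hr : 0 < r := hd.trans_le hκd
    have hrD : r ≤ |D| := hκD.trans hD
    have h5 : r * ρ ≤ r * |v| + |D| := by nlinarith
    have hm0 : 0 < m - 1 := by linarith
    have h6 : (m - 1) * d ≤ (m - 1) * r := by gcongr
    have hmr : m * r ≤ m * |D| := by gcongr
    rcases le_total v 0 with hv' | hv'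
    · rw [abs_of_nonpos hv'] at *
      have h7 : (m - 1) * d * (-v) ≤ (m - 1) * r * (-v) := by gcongr
      have h8 : m * r * (-t) ≤ m * r * 2 := by gcongr; linarith [ht.1]
      nlinarith
    · rw [abs_of_nonneg hv'] at *
      have h7 : (m - 1) * d * v ≤ (m - 1) * r * 2 := by
        have : v ≤ 2 := hvt.trans ht.2
        gcongr
      have h8 : m * r * (v - t) ≤ 0 := by
        apply mul_nonpos_of_nonneg_of_nonpos
        · positivity
        · linarith
      have h9 : r * v ≤ 2 * |D| := by
        have : v ≤ 2 := hvt.trans ht.2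
        nlinarith
      nlinarith
  rw [wakeIntegrand, norm_mul, h2, decayWeight]
  calc Real.exp (m * κ.re * (v - t)) * ‖modHankel (κ * ρ)‖
      ≤ Real.exp (m * κ.re * (v - t)) * (C₀ * (1 + ‖κ‖) * ((1 + 1 / √|v|) * Real.exp (κ.re * ρ))) := by
        gcongr
        exact h1.trans (by gcongr)
    _ = C₀ * (1 + ‖κ‖) * (1 + 1 / √|v|) * Real.exp (m * κ.re * (v - t) + κ.re * ρ) := by
        rw [Real.exp_add]; ring
    _ ≤ C₀ * (1 + ‖κ‖) * (1 + 1 / √|v|) *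
        Real.exp ((4 * m + 3) * |D| + -((m - 1) * d) * |v|) := by gcongr
    _ = _ := by rw [Real.exp_add]; ring

theorem ae_ne_zero : ∀ᵐ v : ℝ, v ≠ 0 := by
  rw [ae_iff]; simp

theorem measurable_wakeIntegrand (κ : ℂ) (m : ℝ) :
    Measurable fun p : ℝ × ℝ => wakeIntegrand κ m p.1 |p.2| p.2 := by
  have := measurable_modHankel
  have h : Measurable fun p : ℝ × ℝ => |p.2| := by
    simpa only [Real.norm_eq_abs] using (measurable_snd (α := ℝ) (β := ℝ)).norm
  unfold wakeIntegrand
  fun_prop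

theorem measurable_wakeIntegrand_right (κ : ℂ) (m t : ℝ) :
    Measurable fun v : ℝ => wakeIntegrand κ m t |v| v :=
  (measurable_wakeIntegrand κ m).comp (measurable_const.prodMk measurable_id)

theorem measurable_wake (κ : ℂ) (m : ℝ) : Measurable (wake κ m) := by
  have h : Measurable fun p : ℝ × ℝ => (Iic p.1).indicator (wakeIntegrand κ m p.1 |p.2|) p.2 := by
    have e : (fun p : ℝ × ℝ => (Iic p.1).indicator (wakeIntegrand κ m p.1 |p.2|) p.2)
        = {p : ℝ × ℝ | p.2 ≤ p.1}.indicator fun p => wakeIntegrand κ m p.1 |p.2| p.2 := by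
      ext p
      by_cases hp : p.2 ≤ p.1 <;> simp [indicator, hp]
    rw [e]
    exact (measurable_wakeIntegrand κ m).indicator (measurableSet_le measurable_snd measurable_fst)
  have h2 := (h.stronglyMeasurable.integral_prod_right (ν := volume)
    (f := fun t v => (Iic t).indicator (wakeIntegrand κ m t |v|) v)).measurable
  convert h2 using 1
  ext t
  rw [wake, ← integral_indicator measurableSet_Iic]
  congr 1

theorem norm_exp_sub_one_le_of_re_nonpos {z : ℂ} (hz : z.re ≤ 0) : ‖Complex.exp z - 1‖ ≤ ‖z‖ := by
  have := (convex_halfSpace_re_le (0 : ℝ)).norm_image_sub_le_of_norm_hasDerivWithin_le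
    (f := Complex.exp) (f' := Complex.exp) (C := 1) (x := 0) (y := z)
    (fun w _ => (Complex.hasDerivAt_exp w).hasDerivWithinAt)
    (fun w hw => by
      rw [Complex.norm_exp]
      exact Real.exp_le_one_iff.2 hw) (by simp) hz
  simpa using this

theorem exists_wake_bounds {d D m : ℝ} (hd : 0 < d) (hm : 1 < m) :
    ∃ C : ℝ, 0 < C ∧ ∀ κ : ℂ, d ≤ κ.re → κ.re ≤ D →
      (∀ t ∈ Icc (-2 : ℝ) 2, IntegrableOn (fun v => wakeIntegrand κ m t |v| v) (Iic t)) ∧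
      (∀ t₁ ∈ Icc (-2 : ℝ) 2, ∀ t₂ ∈ Icc (-2 : ℝ) 2,
        ‖wake κ m t₁ - wake κ m t₂‖ ≤ C * (1 + ‖κ‖) ^ 2 * √|t₁ - t₂|) := by
  obtain ⟨C₀, hC₀, hC⟩ := exists_norm_wakeIntegrand_le (D := D) hd hm
  set η := (m - 1) * d with hη
  have hη0 : 0 < η := mul_pos (by linarith) hd
  have hWint := integrable_decayWeight hη0
  set J := ∫ v, decayWeight η v with hJ
  have hJ0 : 0 ≤ J := integral_nonneg fun v => decayWeight_nonneg η v
  refine ⟨C₀ * (2 * m * J + 7), by positivity, fun κ hκd hκD => ?_⟩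
  have hκ : 0 < κ.re := hd.trans_le hκd
  have hbd : ∀ t ∈ Icc (-2 : ℝ) 2, ∀ᵐ v ∂(volume.restrict (Iic t)),
      ‖wakeIntegrand κ m t |v| v‖ ≤ C₀ * (1 + ‖κ‖) * decayWeight η v := by
    intro t ht
    rw [ae_restrict_iff' measurableSet_Iic]
    filter_upwards [ae_ne_zero] with v hv hvt
    exact hC κ hκd hκD t ht v |v| hvt hv le_rfl (by linarith)
  have hint : ∀ t ∈ Icc (-2 : ℝ) 2, IntegrableOn (fun v => wakeIntegrand κ m t |v| v) (Iic t) :=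
    fun t ht => (hWint.const_mul (C₀ * (1 + ‖κ‖))).integrableOn.mono'
      (measurable_wakeIntegrand_right κ m t).aestronglyMeasurable (hbd t ht)
  have hnorm : ∀ t ∈ Icc (-2 : ℝ) 2, ‖wake κ m t‖ ≤ C₀ * (1 + ‖κ‖) * J := by
    intro t ht
    refine (norm_integral_le_of_norm_le (hWint.const_mul (C₀ * (1 + ‖κ‖))).integrableOn
      (hbd t ht)).trans ?_
    rw [hJ, ← integral_const_mul]
    refine setIntegral_le_integral (hWint.const_mul _) (Eventually.of_forall fun v => ?_)
    have := decayWeight_nonneg η v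
    simp only [Pi.zero_apply]
    positivity
  have hmain : ∀ t₁ ∈ Icc (-2 : ℝ) 2, ∀ t₂ ∈ Icc (-2 : ℝ) 2, t₁ ≤ t₂ →
      ‖wake κ m t₂ - wake κ m t₁‖ ≤ C₀ * (2 * m * J + 7) * (1 + ‖κ‖) ^ 2 * √(t₂ - t₁) := by
    intro t₁ ht₁ t₂ ht₂ h12
    have hsq2 : √(t₂ - t₁) ≤ 2 := by
      rw [show (2 : ℝ) = √(2 ^ 2) by rw [Real.sqrt_sq (by norm_num)]]
      exact Real.sqrt_le_sqrt (by linarith [ht₁.1, ht₂.2])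
    have hsq := Real.mul_self_sqrt (sub_nonneg.2 h12)
    have hsq0 := Real.sqrt_nonneg (t₂ - t₁)
    have hlin : t₂ - t₁ ≤ 2 * √(t₂ - t₁) := by nlinarith
    -- Changing $t$ multiplies the old integral by an exponential and adds an integral over
    -- $(t_1,t_2]$, where the singularity $|v|^{-1/2}$ yields a square root of the length.
    have hsplit : wake κ m t₂ - wake κ m t₁ = (Complex.exp (m * κ * (t₁ - t₂ : ℝ)) - 1) * wake κ m t₁
        + ∫ v in Ioc t₁ t₂, wakeIntegrand κ m t₂ |v| v := by
      have e1 : wake κ m t₂ = (∫ v in Iic t₁, wakeIntegrand κ m t₂ |v| v)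
          + ∫ v in Ioc t₁ t₂, wakeIntegrand κ m t₂ |v| v := by
        rw [wake, ← setIntegral_union (Iic_disjoint_Ioc le_rfl) measurableSet_Ioc
          ((hint t₂ ht₂).mono_set (Iic_subset_Iic.2 h12))
          ((hint t₂ ht₂).mono_set (fun v hv => hv.2)), Iic_union_Ioc_eq_Iic h12]
      have e2 : ∫ v in Iic t₁, wakeIntegrand κ m t₂ |v| v
          = Complex.exp (m * κ * (t₁ - t₂ : ℝ)) * wake κ m t₁ := by
        rw [wake, ← integral_const_mul]
        congr 1
        ext v
        rw [wakeIntegrand, wakeIntegrand, ← mul_assoc, ← Complex.exp_add]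
        congr 2
        push_cast; ring
      rw [e1, e2]; ring
    have hexp : ‖Complex.exp (m * κ * (t₁ - t₂ : ℝ)) - 1‖ ≤ m * ‖κ‖ * (t₂ - t₁) := by
      refine (norm_exp_sub_one_le_of_re_nonpos ?_).trans_eq ?_
      · rw [Complex.re_mul_ofReal, Complex.re_ofReal_mul]
        exact mul_nonpos_of_nonneg_of_nonpos (by positivity) (by linarith)
      · rw [norm_mul, norm_mul, Complex.norm_real, Complex.norm_real,
          Real.norm_of_nonneg (by linarith : (0 : ℝ) ≤ m), Real.norm_of_nonpos (by linarith)]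
        ring
    have hsm := setIntegral_one_div_sqrt_abs_le h12
    have hIoc : ‖∫ v in Ioc t₁ t₂, wakeIntegrand κ m t₂ |v| v‖ ≤
        C₀ * (1 + ‖κ‖) * (7 * √(t₂ - t₁)) := by
      have hone : IntegrableOn (fun _ : ℝ => (1 : ℝ)) (Ioc t₁ t₂) := integrableOn_const (by simp)
      have hi : IntegrableOn (fun v : ℝ => C₀ * (1 + ‖κ‖) * (1 + 1 / √|v|)) (Ioc t₁ t₂) :=
        ((integrableOn_const (by simp)).add hsm.1).const_mul _
      refine (norm_integral_le_of_norm_le hi ?_).trans ?_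
      · rw [ae_restrict_iff' measurableSet_Ioc]
        filter_upwards [ae_ne_zero] with v hv hvt
        refine (hC κ hκd hκD t₂ ht₂ v |v| hvt.2 hv le_rfl (by linarith)).trans ?_
        gcongr
        unfold decayWeight
        refine mul_le_of_le_one_right (by positivity) (Real.exp_le_one_iff.2 ?_)
        exact mul_nonpos_of_nonpos_of_nonneg (by linarith) (abs_nonneg v)
      · rw [integral_const_mul, integral_add hone hsm.1, setIntegral_const]
        gcongr
        simp only [Measure.real, Real.volume_Ioc, smul_eq_mul, mul_one,
          ENNReal.toReal_ofReal (sub_nonneg.2 h12)]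
        linarith [hsm.2]
    have hn := norm_nonneg κ
    calc _ ≤ ‖(Complex.exp (m * κ * (t₁ - t₂ : ℝ)) - 1) * wake κ m t₁‖
          + ‖∫ v in Ioc t₁ t₂, wakeIntegrand κ m t₂ |v| v‖ := by rw [hsplit]; exact norm_add_le _ _
      _ ≤ m * ‖κ‖ * (t₂ - t₁) * (C₀ * (1 + ‖κ‖) * J) + C₀ * (1 + ‖κ‖) * (7 * √(t₂ - t₁)) := by
          rw [norm_mul]
          gcongr
          exact hnorm t₁ ht₁
      _ ≤ m * (1 + ‖κ‖) * (2 * √(t₂ - t₁)) * (C₀ * (1 + ‖κ‖) * J)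
          + C₀ * (1 + ‖κ‖) ^ 2 * (7 * √(t₂ - t₁)) := by
          gcongr
          · linarith
          · nlinarith
      _ = _ := by ring
  refine ⟨hint, fun t₁ h₁ t₂ h₂ => ?_⟩
  rcases le_total t₁ t₂ with h | h
  · rw [norm_sub_rev, abs_sub_comm, abs_of_nonneg (sub_nonneg.2 h)]
    exact hmain t₁ h₁ t₂ h₂ h
  · rw [abs_of_nonneg (sub_nonneg.2 h)]
    exact hmain t₂ h₂ t₁ h₁ h

theorem differentiableOn_wake {m : ℝ} (hm : 1 < m) {t : ℝ} (ht : t ∈ Icc (-2 : ℝ) 2) :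
    DifferentiableOn ℂ (fun κ => wake κ m t) {κ | 0 < κ.re} := by
  have hV : IsOpen {s : ℂ | 0 < s.re} := isOpen_lt continuous_const Complex.continuous_re
  refine differentiableOn_integral_of_dominated hV
    (fun κ _ => (measurable_wakeIntegrand_right κ m t).aestronglyMeasurable) ?_ ?_
  · filter_upwards [ae_restrict_of_ae ae_ne_zero] with v hv
    unfold wakeIntegrand
    refine DifferentiableOn.mul (by fun_prop) ?_
    refine differentiableOn_modHankel.comp (by fun_prop) fun κ hκ => ?_
    exact re_mul_ofReal_pos hκ (abs_pos.2 hv)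
  · intro κ₀ hκ₀
    have hκ₀' : 0 < κ₀.re := hκ₀
    obtain ⟨C, hC0, hC⟩ := exists_norm_wakeIntegrand_le (D := κ₀.re + 1) (half_pos hκ₀') hm
    refine ⟨min (κ₀.re / 2) 1, by positivity,
      fun v => C * (2 + ‖κ₀‖) * decayWeight ((m - 1) * (κ₀.re / 2)) v,
      ((integrable_decayWeight (mul_pos (by linarith) (by linarith))).const_mul _).integrableOn, ?_⟩
    rw [ae_restrict_iff' measurableSet_Iic]
    filter_upwards [ae_ne_zero] with v hv hvt κ hκ
    have hdist : ‖κ - κ₀‖ < min (κ₀.re / 2) 1 := by simpa [dist_eq_norm] using hκ.1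
    have h1 : ‖κ - κ₀‖ < κ₀.re / 2 := hdist.trans_le (min_le_left _ _)
    have h2 : ‖κ - κ₀‖ < 1 := hdist.trans_le (min_le_right _ _)
    have h3 := abs_le.1 (Complex.abs_re_le_norm (κ - κ₀))
    rw [Complex.sub_re] at h3
    refine (hC κ (by linarith) (by linarith) t ht v |v| hvt hv le_rfl (by linarith)).trans ?_
    have h4 := norm_le_norm_add_norm_sub' κ κ₀
    have := decayWeight_nonneg ((m - 1) * (κ₀.re / 2)) v
    have h5 : 1 + ‖κ‖ ≤ 2 + ‖κ₀‖ := by linarith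
    gcongr

/-! ### Reduction of the Possio kernel to a difference kernel -/

/-- The wave number `κ = s / (a (1 - M²))`. -/
def waveNumber (a U : ℝ) (s : ℂ) : ℂ := s / ((a * (1 - mach a U ^ 2) : ℝ) : ℂ)

theorem one_sub_mach_sq_pos {a U : ℝ} (hU : 0 < U) (hUa : U < a) : 0 < 1 - mach a U ^ 2 := by
  have ha : 0 < a := hU.trans hUa
  have h1 : mach a U < 1 := (div_lt_one ha).2 hUa
  have h2 : 0 < mach a U := div_pos hU ha
  nlinarith

theorem waveNumber_re (a U : ℝ) (s : ℂ) :
    (waveNumber a U s).re = s.re / (a * (1 - mach a U ^ 2)) := by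
  rw [waveNumber, Complex.div_ofReal_re]

theorem waveNumber_re_pos {a U : ℝ} (hU : 0 < U) (hUa : U < a) {s : ℂ} (hs : 0 < s.re) :
    0 < (waveNumber a U s).re := by
  rw [waveNumber_re]
  exact div_pos hs (mul_pos (hU.trans hUa) (one_sub_mach_sq_pos hU hUa))

/-- Since $1+cU=1/(1-M^2)$, $\lambda$ is a real multiple of the wave number; the wake exponent is
$m=a/U>1$. -/
theorem lam_eq {a U : ℝ} (hU : 0 < U) (hUa : U < a) (s : ℂ) :
    lam a U s = -(((a / U : ℝ) : ℂ) * waveNumber a U s) := by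
  have hβ := one_sub_mach_sq_pos hU hUa
  have ha : 0 < a := hU.trans hUa
  have key : 1 + cConst a U * U = 1 / (1 - mach a U ^ 2) := by
    rw [cConst]
    have h1 : mach a U * a = U := div_mul_cancel₀ U ha.ne'
    generalize mach a U = M at *
    rw [← h1]
    field_simp
    ring
  have key' : (1 : ℂ) + (cConst a U : ℂ) * (U : ℂ) = ((1 / (1 - mach a U ^ 2) : ℝ) : ℂ) := by
    rw [← key]; push_cast; rfl
  have hU' : (U : ℂ) ≠ 0 := by exact_mod_cast hU.ne'
  have ha' : (a : ℂ) ≠ 0 := by exact_mod_cast ha.ne'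
  have hβ' : ((1 - mach a U ^ 2 : ℝ) : ℂ) ≠ 0 := by exact_mod_cast hβ.ne'
  rw [lam, key', waveNumber, Complex.ofReal_div, Complex.ofReal_div, Complex.ofReal_mul]
  generalize ((1 - mach a U ^ 2 : ℝ) : ℂ) = b at *
  push_cast
  field_simp

/-- The radial variable of the kernel. -/
def radius (a U t y : ℝ) : ℝ := √(t ^ 2 + (1 - mach a U ^ 2) * y ^ 2)

theorem zArg_eq {a U : ℝ} (hU : 0 < U) (hUa : U < a) (s : ℂ) (x ξ y : ℝ) :
    zArg a U s x ξ y = Complex.I * (waveNumber a U s * (radius a U (x - ξ) y : ℝ)) := by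
  have hβ := one_sub_mach_sq_pos hU hUa
  have ha : 0 < a := hU.trans hUa
  rw [zArg, waveNumber, radius]
  generalize 1 - mach a U ^ 2 = b at *
  have h1 : (x - ξ) ^ 2 / b + y ^ 2 = ((x - ξ) ^ 2 + b * y ^ 2) / b := by field_simp
  have hs : 0 < √b := Real.sqrt_pos.2 hβ
  have hs' : (√b : ℂ) ≠ 0 := by exact_mod_cast hs.ne'
  have ha' : (a : ℂ) ≠ 0 := by exact_mod_cast ha.ne'
  have hb : (b : ℂ) = (√b : ℂ) * (√b : ℂ) := by
    rw [← Complex.ofReal_mul, Real.mul_self_sqrt hβ.le]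
  rw [h1, Real.sqrt_div' _ hβ.le]
  push_cast
  rw [hb]
  field_simp

theorem radius_pos {a U : ℝ} (hU : 0 < U) (hUa : U < a) {t y : ℝ} (h : t ≠ 0 ∨ y ≠ 0) :
    0 < radius a U t y := by
  have hβ := one_sub_mach_sq_pos hU hUa
  refine Real.sqrt_pos.2 ?_
  rcases h with h | h
  · have := sq_pos_of_ne_zero h; positivity
  · have := sq_pos_of_ne_zero h; positivity

theorem abs_le_radius {a U : ℝ} (hU : 0 < U) (hUa : U < a) (t y : ℝ) : |t| ≤ radius a U t y := by
  have hβ := one_sub_mach_sq_pos hU hUa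
  rw [radius, ← Real.sqrt_sq_eq_abs]
  exact Real.sqrt_le_sqrt (by nlinarith [mul_nonneg hβ.le (sq_nonneg y)])

theorem radius_le {a U : ℝ} (hU : 0 < U) (hUa : U < a) (t : ℝ) {y : ℝ} (hy : 0 ≤ y) (hy1 : y ≤ 1) :
    radius a U t y ≤ |t| + 1 := by
  have hβ := one_sub_mach_sq_pos hU hUa
  rw [radius, Real.sqrt_le_left (by positivity)]
  have h1 : (1 - mach a U ^ 2) ≤ 1 := by nlinarith [sq_nonneg (mach a U)]
  have h2 : y ^ 2 ≤ 1 := by nlinarith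
  nlinarith [abs_nonneg t, sq_abs t, mul_le_mul h1 h2 (sq_nonneg y) zero_le_one]

theorem tendsto_radius (a U t : ℝ) : Tendsto (radius a U t) (𝓝[>] 0) (𝓝 |t|) := by
  have h : Continuous (radius a U t) := by unfold radius; fun_prop
  have h2 := (h.tendsto 0).mono_left (nhdsWithin_le_nhds (s := Ioi 0))
  have e : radius a U t 0 = |t| := by simp [radius, Real.sqrt_sq_eq_abs]
  rwa [e] at h2

theorem hankelH0_zArg {a U : ℝ} (hU : 0 < U) (hUa : U < a) {s : ℂ} (hs : 0 < s.re) {x ξ y : ℝ}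
    (h : x - ξ ≠ 0 ∨ y ≠ 0) : hankelH0 (zArg a U s x ξ y) =
      modHankel (waveNumber a U s * (radius a U (x - ξ) y : ℝ)) := by
  rw [zArg_eq hU hUa, hankelH0_I_mul]
  exact re_mul_ofReal_pos (waveNumber_re_pos hU hUa hs) (radius_pos hU hUa h)

theorem deriv_hankelH0_zArg {a U : ℝ} (hU : 0 < U) (hUa : U < a) {s : ℂ} (hs : 0 < s.re) {x ξ y : ℝ}
    (hy : y ≠ 0) : deriv (fun x' : ℝ => hankelH0 (zArg a U s x' ξ y)) x =
      ((x - ξ) / radius a U (x - ξ) y : ℝ) * (waveNumber a U s *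
        modHankel' (waveNumber a U s * (radius a U (x - ξ) y : ℝ))) := by
  have e : (fun x' : ℝ => hankelH0 (zArg a U s x' ξ y)) =
      fun x' : ℝ => modHankel (waveNumber a U s * (radius a U (x' - ξ) y : ℝ)) := by
    ext x'; exact hankelH0_zArg hU hUa hs (Or.inr hy)
  have hpos := radius_pos hU hUa (t := x - ξ) (Or.inr hy)
  have hr : HasDerivAt (fun x' : ℝ => radius a U (x' - ξ) y) ((x - ξ) / radius a U (x - ξ) y) x := by
    have h1 : HasDerivAt (fun x' : ℝ => (x' - ξ) ^ 2 + (1 - mach a U ^ 2) * y ^ 2)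
        (2 * (x - ξ)) x := by
      have := (((hasDerivAt_id x).sub_const ξ).pow 2).add_const ((1 - mach a U ^ 2) * y ^ 2)
      simpa using this
    have h2 := h1.sqrt (by have := Real.sqrt_pos.1 hpos; exact this.ne')
    refine h2.congr_deriv ?_
    rw [radius]; ring
  have := HasDerivAt.scomp x (hasDerivAt_modHankel_ray (waveNumber_re_pos hU hUa hs) hpos) hr
  rw [e]
  simpa [Function.comp_def] using this.deriv

/-- The wake integral before the passage to the limit. -/
theorem exp_mul_integral_eq {a U : ℝ} (hU : 0 < U) (hUa : U < a) {s : ℂ} (hs : 0 < s.re)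
    {x ξ y : ℝ} (hy : y ≠ 0) : Complex.exp (lam a U s * (x : ℂ)) *
        (∫ u in Iic x, Complex.exp (-(lam a U s * (u : ℂ))) * hankelH0 (zArg a U s u ξ y)) =
      ∫ v in Iic (x - ξ), wakeIntegrand (waveNumber a U s) (a / U) (x - ξ) (radius a U v y) v := by
  rw [← integral_const_mul, ← integral_indicator measurableSet_Iic,
    ← integral_indicator measurableSet_Iic,
    ← integral_add_right_eq_self (μ := (volume : Measure ℝ)) _ ξ]
  congr 1
  ext v
  have hiff : v + ξ ∈ Iic x ↔ v ∈ Iic (x - ξ) := by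
    simp only [mem_Iic]; constructor <;> intro h <;> linarith
  by_cases hv : v ∈ Iic (x - ξ)
  · rw [indicator_of_mem (hiff.2 hv), indicator_of_mem hv, hankelH0_zArg hU hUa hs (Or.inr hy),
      wakeIntegrand, ← mul_assoc, ← Complex.exp_add, lam_eq hU hUa, add_sub_cancel_right]
    congr 2
    push_cast; ring
  · rw [indicator_of_notMem (fun h => hv (hiff.1 h)), indicator_of_notMem hv]

theorem tendsto_wake_integral {a U : ℝ} (hU : 0 < U) (hUa : U < a) {s : ℂ} (hs : 0 < s.re)
    {t : ℝ} (ht : t ∈ Icc (-2 : ℝ) 2) :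
    Tendsto (fun y : ℝ => ∫ v in Iic t,
      wakeIntegrand (waveNumber a U s) (a / U) t (radius a U v y) v) (𝓝[>] 0)
      (𝓝 (wake (waveNumber a U s) (a / U) t)) := by
  have hκ := waveNumber_re_pos hU hUa hs
  have hm : 1 < a / U := (one_lt_div hU).2 hUa
  set κ := waveNumber a U s
  obtain ⟨C, hC0, hC⟩ := exists_norm_wakeIntegrand_le (D := κ.re) hκ hm
  refine tendsto_integral_filter_of_dominated_convergence
    (fun v => C * (1 + ‖κ‖) * decayWeight ((a / U - 1) * κ.re) v) ?_ ?_ ?_ ?_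
  · refine Eventually.of_forall fun y => Measurable.aestronglyMeasurable ?_
    have := measurable_modHankel
    unfold wakeIntegrand radius
    fun_prop
  · filter_upwards [Ioc_mem_nhdsGT one_pos] with y hy
    rw [ae_restrict_iff' measurableSet_Iic]
    filter_upwards [ae_ne_zero] with v hv hvt
    exact hC κ le_rfl le_rfl t ht v _ hvt hv (abs_le_radius hU hUa v y)
      (radius_le hU hUa v hy.1.le hy.2)
  · exact ((integrable_decayWeight (mul_pos (by linarith) hκ)).const_mul _).integrableOn
  · rw [ae_restrict_iff' measurableSet_Iic]
    filter_upwards [ae_ne_zero] with v hv _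
    unfold wakeIntegrand
    refine Tendsto.const_mul _ ?_
    exact ((hasDerivAt_modHankel_ray hκ (abs_pos.2 hv)).continuousAt.tendsto).comp
      (tendsto_radius a U v)

/-- The regularised kernel as a function of `t = x - ξ`. -/
def diffKernel (a U : ℝ) (s : ℂ) (t : ℝ) : ℂ :=
  (((1 - mach a U ^ 2) / U : ℝ) : ℂ) *
      (((t / |t| : ℝ) : ℂ) * hankelDerivReg (waveNumber a U s) |t|)
    + lam a U s * ((1 - mach a U ^ 2 : ℝ) : ℂ) / (U : ℂ) * modHankel (waveNumber a U s * (|t| : ℝ))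
    + 1 / (U : ℂ) * (lam a U s ^ 2 * ((1 - mach a U ^ 2 : ℝ) : ℂ)
        - s ^ 2 / ((a ^ 2 * (1 - mach a U ^ 2) : ℝ) : ℂ)) * wake (waveNumber a U s) (a / U) t

/-- All three terms converge as $y\to0^+$, the wake by dominated convergence. The subtracted
singularity matches the one removed in `hankelDerivReg`, as $(t/|t|)\cdot1/|t|=1/t$. -/
theorem kernelK_eq {a U : ℝ} (hU : 0 < U) (hUa : U < a) {s : ℂ} (hs : 0 < s.re) {x ξ : ℝ}
    (hx : x ∈ Icc (-1 : ℝ) 1) (hξ : ξ ∈ Icc (-1 : ℝ) 1) (hne : x ≠ ξ) :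
    kernelK a U s x ξ = diffKernel a U s (x - ξ) := by
  have hκ := waveNumber_re_pos hU hUa hs
  set t := x - ξ with ht
  have ht0 : t ≠ 0 := sub_ne_zero.2 hne
  have htI : t ∈ Icc (-2 : ℝ) 2 := ⟨by linarith [hx.1, hξ.2], by linarith [hx.2, hξ.1]⟩
  have htp : 0 < |t| := abs_pos.2 ht0
  set κ := waveNumber a U s with hκdef
  have hr := tendsto_radius a U t
  have h2 : Tendsto (fun y => modHankel (κ * (radius a U t y : ℝ))) (𝓝[>] 0)
      (𝓝 (modHankel (κ * (|t| : ℝ)))) :=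
    ((hasDerivAt_modHankel_ray hκ htp).continuousAt.tendsto).comp hr
  have h1 : Tendsto (fun y => ((t / radius a U t y : ℝ) : ℂ) *
      (κ * modHankel' (κ * (radius a U t y : ℝ)))) (𝓝[>] 0)
      (𝓝 (((t / |t| : ℝ) : ℂ) * (κ * modHankel' (κ * (|t| : ℝ))))) := by
    refine Tendsto.mul ?_ ((((hasDerivAt_modHankel'_ray hκ htp).continuousAt.tendsto).comp
      hr).const_mul κ)
    exact (Complex.continuous_ofReal.tendsto _).comp (tendsto_const_nhds.div hr htp.ne')
  have h3 := tendsto_wake_integral hU hUa hs htI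
  have hlim := (((h1.const_mul (((1 - mach a U ^ 2) / U : ℝ) : ℂ)).add
    (h2.const_mul (lam a U s * ((1 - mach a U ^ 2 : ℝ) : ℂ) / (U : ℂ)))).add
    (h3.const_mul (1 / (U : ℂ) * (lam a U s ^ 2 * ((1 - mach a U ^ 2 : ℝ) : ℂ)
        - s ^ 2 / ((a ^ 2 * (1 - mach a U ^ 2) : ℝ) : ℂ)))))
  have hpre := hlim.congr' (f₂ := fun y : ℝ => possioPreKernel a U s x ξ y) (by
    filter_upwards [self_mem_nhdsWithin] with y hy
    have hy0 : y ≠ 0 := (mem_Ioi.1 hy).ne'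
    rw [possioPreKernel, deriv_hankelH0_zArg hU hUa hs hy0, hankelH0_zArg hU hUa hs (Or.inr hy0),
      ← exp_mul_integral_eq hU hUa hs hy0, ← hκdef, ← ht]
    ring)
  rw [kernelK, possioKernel, hpre.limUnder_eq, diffKernel, ← hκdef, ← ht, hankelDerivReg]
  have hU' : (U : ℂ) ≠ 0 := by exact_mod_cast hU.ne'
  have ht' : (t : ℂ) ≠ 0 := by exact_mod_cast ht0
  have hab' : ((|t| : ℝ) : ℂ) ≠ 0 := by exact_mod_cast htp.ne'
  have hab : ((|t| : ℝ) : ℂ) * ((|t| : ℝ) : ℂ) = t * t := by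
    rw [← Complex.ofReal_mul, abs_mul_abs_self]; push_cast; rfl
  have hpi : (Real.pi : ℂ) ≠ 0 := by exact_mod_cast Real.pi_ne_zero
  have e : ((t / |t| : ℝ) : ℂ) * (2 * Complex.I / Real.pi / ((|t| : ℝ) : ℂ))
      = 2 * Complex.I / Real.pi * (1 / (t : ℂ)) := by
    rw [Complex.ofReal_div]
    field_simp
    rw [sq, sq, hab]
  rw [mul_sub ((t / |t| : ℝ) : ℂ), e]
  push_cast
  field_simp
  ring

theorem measurable_diffKernel (a U : ℝ) (s : ℂ) : Measurable (diffKernel a U s) := by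
  have h1 := measurable_modHankel
  have h2 := measurable_modHankel'
  have h3 := measurable_wake (waveNumber a U s) (a / U)
  have h4 : Measurable fun t : ℝ => |t| := measurable_norm
  unfold diffKernel hankelDerivReg
  fun_prop

theorem differentiableOn_diffKernel {a U : ℝ} (hU : 0 < U) (hUa : U < a) {t : ℝ}
    (ht : t ∈ Icc (-2 : ℝ) 2) (ht0 : t ≠ 0) :
    DifferentiableOn ℂ (fun s => diffKernel a U s t) {s | 0 < s.re} := by
  have hm : 1 < a / U := (one_lt_div hU).2 hUa
  have htp := abs_pos.2 ht0
  have hκ : DifferentiableOn ℂ (waveNumber a U) {s | 0 < s.re} := by unfold waveNumber; fun_prop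
  have hlam : DifferentiableOn ℂ (lam a U) {s | 0 < s.re} := by unfold lam; fun_prop
  have hmaps : MapsTo (waveNumber a U) {s | 0 < s.re} {κ | 0 < κ.re} := fun s hs =>
    waveNumber_re_pos hU hUa hs
  have hmaps' : MapsTo (fun s => waveNumber a U s * (|t| : ℝ)) {s | 0 < s.re} {κ | 0 < κ.re} :=
    fun s hs => re_mul_ofReal_pos (waveNumber_re_pos hU hUa hs) htp
  have h1 := differentiableOn_modHankel.comp (hκ.mul_const ((|t| : ℝ) : ℂ)) hmaps'
  have h2 := differentiableOn_modHankel'.comp (hκ.mul_const ((|t| : ℝ) : ℂ)) hmaps'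
  have h3 := (differentiableOn_wake hm ht).comp hκ hmaps
  simp only [Function.comp_def] at h1 h2 h3
  unfold diffKernel hankelDerivReg
  fun_prop

/-! ### Modulus of continuity of the difference kernel -/

/-- An odd extension of a function which is Hölder continuous and vanishes at `0`. -/
theorem norm_odd_extension_sub_le {e : ℝ → ℂ} {M : ℝ} (hM : 0 ≤ M)
    (h0 : ∀ t : ℝ, 0 < t → t ≤ 2 → ‖e t‖ ≤ M * √t)
    (h1 : ∀ t₁ t₂ : ℝ, 0 < t₁ → t₁ ≤ 2 → 0 < t₂ → t₂ ≤ 2 → ‖e t₁ - e t₂‖ ≤ M * √|t₁ - t₂|)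
    {t₁ t₂ : ℝ} (ht₁ : t₁ ∈ Icc (-2 : ℝ) 2) (ht₂ : t₂ ∈ Icc (-2 : ℝ) 2) (hn₁ : t₁ ≠ 0)
    (hn₂ : t₂ ≠ 0) :
    ‖((t₁ / |t₁| : ℝ) : ℂ) * e |t₁| - ((t₂ / |t₂| : ℝ) : ℂ) * e |t₂|‖ ≤ 2 * M * √|t₁ - t₂| := by
  have ha₁ : |t₁| ≤ 2 := abs_le.2 ht₁
  have ha₂ : |t₂| ≤ 2 := abs_le.2 ht₂
  have hp₁ := abs_pos.2 hn₁
  have hp₂ := abs_pos.2 hn₂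
  have hs := Real.sqrt_nonneg |t₁ - t₂|
  have hunit : ∀ t : ℝ, t ≠ 0 → ‖((t / |t| : ℝ) : ℂ)‖ = 1 := fun t ht => by
    rw [Complex.norm_real, Real.norm_eq_abs, abs_div, abs_abs, div_self (abs_pos.2 ht).ne']
  by_cases hsame : t₁ / |t₁| = t₂ / |t₂|
  · rw [hsame, ← mul_sub, norm_mul, hunit _ hn₂, one_mul]
    refine (h1 _ _ hp₁ ha₁ hp₂ ha₂).trans ?_
    calc M * √|(|t₁| - |t₂|)| ≤ M * √|t₁ - t₂| := 
        mul_le_mul_of_nonneg_left (Real.sqrt_le_sqrt (abs_abs_sub_abs_le_abs_sub t₁ t₂)) hM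
      _ ≤ _ := by nlinarith
  · have hle : |t₁| ≤ |t₁ - t₂| ∧ |t₂| ≤ |t₁ - t₂| := by
      rcases lt_or_gt_of_ne hn₁ with h | h <;> rcases lt_or_gt_of_ne hn₂ with h' | h'
      · refine absurd ?_ hsame
        rw [abs_of_neg h, abs_of_neg h', div_neg, div_neg, div_self hn₁, div_self hn₂]
      · rw [abs_of_neg h, abs_of_pos h', abs_of_neg (by linarith)]
        constructor <;> linarith
      · rw [abs_of_pos h, abs_of_neg h', abs_of_pos (by linarith)]
        constructor <;> linarith
      · refine absurd ?_ hsame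
        rw [abs_of_pos h, abs_of_pos h', div_self hn₁, div_self hn₂]
    calc _ ≤ ‖e |t₁|‖ + ‖e |t₂|‖ := by
          refine (norm_sub_le _ _).trans_eq ?_
          rw [norm_mul, norm_mul, hunit _ hn₁, hunit _ hn₂, one_mul, one_mul]
      _ ≤ M * √|t₁| + M * √|t₂| := add_le_add (h0 _ hp₁ ha₁) (h0 _ hp₂ ha₂)
      _ ≤ M * √|t₁ - t₂| + M * √|t₁ - t₂| := 
        add_le_add (mul_le_mul_of_nonneg_left (Real.sqrt_le_sqrt hle.1) hM)
          (mul_le_mul_of_nonneg_left (Real.sqrt_le_sqrt hle.2) hM)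
      _ = _ := by ring

/-- The regularity of the difference kernel: logarithmic at `0`, Hölder continuous elsewhere, with
polynomial growth in `s` on vertical strips. -/
theorem exists_norm_diffKernel_sub_le {a U : ℝ} (hU : 0 < U) (hUa : U < a) {δ L : ℝ} (hδ : 0 < δ) :
    ∃ C : ℝ, 0 < C ∧ ∀ s : ℂ, δ ≤ s.re → s.re ≤ L → ∀ t₁ ∈ Icc (-2 : ℝ) 2, ∀ t₂ ∈ Icc (-2 : ℝ) 2,
      t₁ ≠ 0 → t₂ ≠ 0 → ‖diffKernel a U s t₁ - diffKernel a U s t₂‖ ≤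
        C * (1 + ‖s‖) ^ 4 * (|Real.log |t₁| - Real.log (|t₂|)| + √|t₁ - t₂|) := by
  have hβ := one_sub_mach_sq_pos hU hUa
  have ha : 0 < a := hU.trans hUa
  have hm : 1 < a / U := (one_lt_div hU).2 hUa
  set b := 1 - mach a U ^ 2 with hb
  have hab : 0 < a * b := mul_pos ha hβ
  have hd : 0 < δ / (a * b) := div_pos hδ hab
  obtain ⟨C₁, hC₁, h₁⟩ := exists_hankelDerivReg_bounds (D := L / (a * b)) hd
  obtain ⟨C₂, hC₂, h₂⟩ := exists_ray_bounds (D := L / (a * b)) hd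
  obtain ⟨C₃, hC₃, h₃⟩ := exists_wake_bounds (D := L / (a * b)) hd hm
  set q := 1 + 1 / (a * b) with hq
  have hq1 : 1 ≤ q := by rw [hq]; linarith [one_div_pos.2 hab]
  set p := a / U * (1 / (a * b)) with hp
  have hp0 : 0 < p := by positivity
  set r := 1 / U * (p ^ 2 * b + 1 / (a ^ 2 * b)) with hr
  have hr0 : 0 < r := by positivity
  -- The fourth power is the wake's: its coefficient and its Hölder constant are both quadratic in
  -- $s$. The other two terms need only the powers 3 and 2.
  refine ⟨b / U * (2 * (C₁ * q ^ 3)) + p * b / U * (C₂ * q) + r * (C₃ * q ^ 2), by positivity,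
    fun s hsδ hsL t₁ ht₁ t₂ ht₂ hn₁ hn₂ => ?_⟩
  have hκ1 : δ / (a * b) ≤ (waveNumber a U s).re := by
    rw [waveNumber_re, ← hb]; gcongr
  have hκ2 : (waveNumber a U s).re ≤ L / (a * b) := by
    rw [waveNumber_re, ← hb]; gcongr
  have hκn : ‖waveNumber a U s‖ = ‖s‖ * (1 / (a * b)) := by
    rw [waveNumber, norm_div, Complex.norm_real, ← hb, Real.norm_of_nonneg hab.le, mul_one_div]
  have hlam : ‖lam a U s‖ = p * ‖s‖ := by
    rw [lam_eq hU hUa, norm_neg, norm_mul, hκn, Complex.norm_real,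
      Real.norm_of_nonneg (by positivity), hp]; ring
  obtain ⟨h₁0, h₁1⟩ := h₁ _ hκ1 hκ2
  obtain ⟨-, -, h₂l⟩ := h₂ _ hκ1 hκ2
  obtain ⟨-, h₃h⟩ := h₃ _ hκ1 hκ2
  set S := 1 + ‖s‖ with hS
  have hS1 : 1 ≤ S := by rw [hS]; linarith [norm_nonneg s]
  have hsS : ‖s‖ ≤ S := by rw [hS]; linarith
  have hκS : 1 + ‖waveNumber a U s‖ ≤ q * S := by
    rw [hκn, hq, hS]
    have : 0 < 1 / (a * b) := by positivity
    nlinarith [norm_nonneg s]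
  have hκ0 : 0 ≤ 1 + ‖waveNumber a U s‖ := by positivity
  set l := |Real.log |t₁| - Real.log (|t₂|)| with hl
  set w := √|t₁ - t₂| with hw
  have hl0 : 0 ≤ l := abs_nonneg _
  have hw0 : 0 ≤ w := Real.sqrt_nonneg _
  have ha₁ : |t₁| ≤ 2 := abs_le.2 ht₁
  have ha₂ : |t₂| ≤ 2 := abs_le.2 ht₂
  have hp₁ := abs_pos.2 hn₁
  have hp₂ := abs_pos.2 hn₂
  have B1 : ‖((t₁ / |t₁| : ℝ) : ℂ) * hankelDerivReg (waveNumber a U s) |t₁|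
      - ((t₂ / |t₂| : ℝ) : ℂ) * hankelDerivReg (waveNumber a U s) |t₂|‖
      ≤ 2 * (C₁ * q ^ 3) * (S ^ 4 * (l + w)) := by
    refine (norm_odd_extension_sub_le (by positivity) h₁0 h₁1 ht₁ ht₂ hn₁ hn₂).trans ?_
    calc 2 * (C₁ * (1 + ‖waveNumber a U s‖) ^ 3) * w ≤ 2 * (C₁ * (q * S) ^ 3) * w := by gcongr
      _ = 2 * (C₁ * q ^ 3) * (S ^ 3 * w) := by ring
      _ ≤ _ := by
        gcongr
        · norm_num
        · linarith
  have B2 : ‖modHankel (waveNumber a U s * (|t₁| : ℝ)) - modHankel (waveNumber a U s * (|t₂| : ℝ))‖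
      ≤ C₂ * q * (S * (l + w)) := by
    refine (h₂l _ _ hp₁ ha₁ hp₂ ha₂).trans ?_
    calc C₂ * (1 + ‖waveNumber a U s‖) * l ≤ C₂ * (q * S) * (l + w) := by gcongr; linarith
      _ = _ := by ring
  have B3 : ‖wake (waveNumber a U s) (a / U) t₁ - wake (waveNumber a U s) (a / U) t₂‖
      ≤ C₃ * q ^ 2 * (S ^ 2 * (l + w)) := by
    refine (h₃h _ ht₁ _ ht₂).trans ?_
    calc C₃ * (1 + ‖waveNumber a U s‖) ^ 2 * w ≤ C₃ * (q * S) ^ 2 * (l + w) := by gcongr; linarith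
      _ = _ := by ring
  have c1 : ‖((b / U : ℝ) : ℂ)‖ = b / U := by
    rw [Complex.norm_real, Real.norm_of_nonneg (by positivity)]
  have c2 : ‖lam a U s * (b : ℂ) / (U : ℂ)‖ = p * b / U * ‖s‖ := by
    rw [norm_div, norm_mul, hlam, Complex.norm_real, Complex.norm_real, Real.norm_of_nonneg hβ.le,
      Real.norm_of_nonneg hU.le]; ring
  have c3 : ‖1 / (U : ℂ) * (lam a U s ^ 2 * (b : ℂ) - s ^ 2 / ((a ^ 2 * b : ℝ) : ℂ))‖
      ≤ r * ‖s‖ ^ 2 := by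
    rw [norm_mul, norm_div, norm_one, Complex.norm_real, Real.norm_of_nonneg hU.le, hr]
    rw [mul_assoc]
    gcongr
    refine (norm_sub_le _ _).trans_eq ?_
    rw [norm_mul, norm_pow, hlam, norm_div, norm_pow, Complex.norm_real, Complex.norm_real,
      Real.norm_of_nonneg hβ.le, Real.norm_of_nonneg (by positivity)]
    ring
  have hdecomp : diffKernel a U s t₁ - diffKernel a U s t₂ =
      ((b / U : ℝ) : ℂ) * (((t₁ / |t₁| : ℝ) : ℂ) * hankelDerivReg (waveNumber a U s) |t₁|
        - ((t₂ / |t₂| : ℝ) : ℂ) * hankelDerivReg (waveNumber a U s) |t₂|)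
      + lam a U s * (b : ℂ) / (U : ℂ) * (modHankel (waveNumber a U s * (|t₁| : ℝ))
        - modHankel (waveNumber a U s * (|t₂| : ℝ)))
      + 1 / (U : ℂ) * (lam a U s ^ 2 * (b : ℂ) - s ^ 2 / ((a ^ 2 * b : ℝ) : ℂ)) *
        (wake (waveNumber a U s) (a / U) t₁ - wake (waveNumber a U s) (a / U) t₂) := by
    rw [diffKernel, diffKernel]; ring
  rw [hdecomp]
  refine (norm_add₃_le ..).trans ?_
  rw [norm_mul, norm_mul, norm_mul, c1, c2]
  have hlw : 0 ≤ l + w := add_nonneg hl0 hw0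
  have T1 : b / U * ‖((t₁ / |t₁| : ℝ) : ℂ) * hankelDerivReg (waveNumber a U s) |t₁|
      - ((t₂ / |t₂| : ℝ) : ℂ) * hankelDerivReg (waveNumber a U s) |t₂|‖
      ≤ b / U * (2 * (C₁ * q ^ 3)) * (S ^ 4 * (l + w)) := by
    rw [mul_assoc (b / U)]; gcongr
  have T2 : p * b / U * ‖s‖ * ‖modHankel (waveNumber a U s * (|t₁| : ℝ))
      - modHankel (waveNumber a U s * (|t₂| : ℝ))‖ ≤ p * b / U * (C₂ * q) * (S ^ 4 * (l + w)) := by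
    calc _ ≤ p * b / U * S * (C₂ * q * (S * (l + w))) := by gcongr
      _ = p * b / U * (C₂ * q) * (S ^ 2 * (l + w)) := by ring
      _ ≤ _ := by gcongr; norm_num
  have T3 : ‖1 / (U : ℂ) * (lam a U s ^ 2 * (b : ℂ) - s ^ 2 / ((a ^ 2 * b : ℝ) : ℂ))‖ *
      ‖wake (waveNumber a U s) (a / U) t₁ - wake (waveNumber a U s) (a / U) t₂‖
      ≤ r * (C₃ * q ^ 2) * (S ^ 4 * (l + w)) := by
    calc _ ≤ r * ‖s‖ ^ 2 * (C₃ * q ^ 2 * (S ^ 2 * (l + w))) := by gcongr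
      _ ≤ r * S ^ 2 * (C₃ * q ^ 2 * (S ^ 2 * (l + w))) := by gcongr
      _ = _ := by ring
  refine (add_le_add (add_le_add T1 T2) T3).trans_eq ?_
  ring

/-! ### Logarithmic estimates in the hyperbolic variable -/

theorem hasDerivAt_tanh (x : ℝ) : HasDerivAt Real.tanh (1 / Real.cosh x ^ 2) x := by
  have h := (Real.hasDerivAt_sinh x).div (Real.hasDerivAt_cosh x) (Real.cosh_pos x).ne'
  have e : (fun y => Real.sinh y / Real.cosh y) = Real.tanh := by
    ext y; rw [Real.tanh_eq_sinh_div_cosh]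
  rw [show (Real.sinh / Real.cosh) = Real.tanh from e] at h
  refine h.congr_deriv ?_
  have := Real.cosh_sq x
  congr 1
  nlinarith

theorem continuous_tanh : Continuous Real.tanh :=
  continuous_iff_continuousAt.2 fun x => (hasDerivAt_tanh x).continuousAt

theorem abs_tanh_sub_tanh_le (p q : ℝ) : |Real.tanh p - Real.tanh q| ≤ |p - q| := by
  have h := convex_univ.norm_image_sub_le_of_norm_hasDerivWithin_le (f := Real.tanh) (C := 1)
    (fun x _ => (hasDerivAt_tanh x).hasDerivWithinAt) (fun x _ => by
      rw [Real.norm_of_nonneg (by positivity), div_le_one (by have := Real.cosh_pos x; positivity)]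
      exact one_le_pow₀ (Real.one_le_cosh x)) (mem_univ q) (mem_univ p)
  simpa using h

theorem abs_log_cosh_sub_le (p q : ℝ) :
    |Real.log (Real.cosh p) - Real.log (Real.cosh q)| ≤ |p - q| := by
  have h := convex_univ.norm_image_sub_le_of_norm_hasDerivWithin_le
    (f := fun x => Real.log (Real.cosh x)) (C := 1)
    (fun x _ => ((Real.hasDerivAt_cosh x).log (Real.cosh_pos x).ne').hasDerivWithinAt)
    (fun x _ => by
      rw [← Real.tanh_eq_sinh_div_cosh]
      exact (Real.abs_tanh_lt_one x).le) (mem_univ q) (mem_univ p)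
  simpa using h

/-- The function $\log(\sinh x/x)$ has derivative in $[0,1]$ for $x>0$, so it is 1-Lipschitz. -/
theorem abs_log_abs_sinh_sub_le {p q : ℝ} (hp : p ≠ 0) (hq : q ≠ 0) :
    |Real.log |Real.sinh p| - Real.log (|Real.sinh q|)| ≤
      |Real.log |p| - Real.log (|q|)| + |p - q| := by
  have key := (convex_Ioi (0 : ℝ)).norm_image_sub_le_of_norm_hasDerivWithin_le
    (f := fun x => Real.log (Real.sinh x) - Real.log x) (C := 1)
    (f' := fun x => Real.cosh x / Real.sinh x - x⁻¹)
    (fun x hx => (((Real.hasDerivAt_sinh x).log (Real.sinh_pos_iff.2 hx).ne').sub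
      (Real.hasDerivAt_log (ne_of_gt hx))).hasDerivWithinAt)
    (fun x hx => by
      have hx0 : 0 < x := hx
      have hs := Real.sinh_pos_iff.2 hx0
      have hxs := Real.self_le_sinh_iff.2 hx0.le
      have h1 : Real.sinh x ≤ x * Real.cosh x := by
        have hmono : MonotoneOn (fun y => y * Real.cosh y - Real.sinh y) (Ici 0) := by
          refine monotoneOn_of_hasDerivWithinAt_nonneg (convex_Ici 0)
            (f' := fun y => y * Real.sinh y) (by fun_prop) (fun y _ => ?_) (fun y hy => ?_)
          · have := ((hasDerivAt_id y).mul (Real.hasDerivAt_cosh y)).sub (Real.hasDerivAt_sinh y)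
            refine (this.congr_deriv ?_).hasDerivWithinAt
            simp
          · rw [interior_Ici] at hy
            exact mul_nonneg (le_of_lt hy) (Real.sinh_nonneg_iff.2 (le_of_lt hy))
        have := hmono (mem_Ici.2 le_rfl) (mem_Ici.2 hx0.le) hx0.le
        simp at this
        linarith
      have h2 : x * Real.cosh x ≤ (x + 1) * Real.sinh x := by
        have e1 : Real.cosh x - Real.sinh x = Real.exp (-x) := Real.cosh_sub_sinh x
        have e2 : Real.exp (-x) ≤ 1 := Real.exp_le_one_iff.2 (by linarith)
        nlinarith
      have e : Real.cosh x / Real.sinh x - x⁻¹ = (x * Real.cosh x - Real.sinh x) / (x * Real.sinh x) := by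
        field_simp
      rw [e, Real.norm_of_nonneg (div_nonneg (by linarith) (by positivity)),
        div_le_one (by positivity)]
      linarith) (abs_pos.2 hq) (abs_pos.2 hp)
  rw [one_mul, Real.norm_eq_abs, Real.norm_eq_abs] at key
  have h3 := abs_abs_sub_abs_le_abs_sub p q
  rw [Real.abs_sinh, Real.abs_sinh]
  have h4 : Real.log (Real.sinh |p|) - Real.log (Real.sinh |q|) =
      (Real.log |p| - Real.log |q|) + ((Real.log (Real.sinh |p|) - Real.log |p|)
        - (Real.log (Real.sinh |q|) - Real.log |q|)) := by ring
  rw [h4]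
  exact (abs_add_le _ _).trans (add_le_add le_rfl (key.trans h3))

theorem tanh_sub_tanh (p q : ℝ) :
    Real.tanh p - Real.tanh q = Real.sinh (p - q) / (Real.cosh p * Real.cosh q) := by
  have hp := (Real.cosh_pos p).ne'
  have hq := (Real.cosh_pos q).ne'
  rw [Real.tanh_eq_sinh_div_cosh, Real.tanh_eq_sinh_div_cosh, Real.sinh_sub]
  field_simp

/-- From $\tanh c-\tanh p=\sinh(c-p)/(\cosh c\cosh p)$ the factor $\cosh c$ cancels in the
difference, and $\log\cosh$ is 1-Lipschitz. The estimate is therefore uniform up to the endpoints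
$\pm1$. -/
theorem abs_log_abs_tanh_sub_le {c p q : ℝ} (hp : p ≠ c) (hq : q ≠ c) :
    |Real.log |Real.tanh c - Real.tanh p| - Real.log (|Real.tanh c - Real.tanh q|)| ≤
      |Real.log |c - p| - Real.log (|c - q|)| + 2 * |p - q| := by
  have e : ∀ r, r ≠ c → Real.log |Real.tanh c - Real.tanh r| =
      Real.log |Real.sinh (c - r)| - Real.log (Real.cosh c) - Real.log (Real.cosh r) := by
    intro r hr
    have h1 : |Real.sinh (c - r)| ≠ 0 :=
      abs_ne_zero.2 (fun h => hr (sub_eq_zero.1 (Real.sinh_eq_zero.1 h)).symm)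
    have h2 := (Real.cosh_pos c).ne'
    have h3 := (Real.cosh_pos r).ne'
    rw [tanh_sub_tanh, abs_div, abs_of_pos (mul_pos (Real.cosh_pos c) (Real.cosh_pos r)),
      Real.log_div h1 (mul_ne_zero h2 h3), Real.log_mul h2 h3]
    ring
  have h1 := abs_log_abs_sinh_sub_le (sub_ne_zero.2 hp.symm) (sub_ne_zero.2 hq.symm)
  have h2 := abs_log_cosh_sub_le q p
  have h3 : |c - p - (c - q)| = |p - q| := by rw [abs_sub_comm p q]; congr 1; ring
  rw [h3] at h1
  rw [abs_sub_comm q p] at h2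
  rw [e p hp, e q hq, show ∀ A B C D E : ℝ, A - B - C - (D - B - E) = (A - D) + (E - C) from
    fun _ _ _ _ _ => by ring]
  refine (abs_add_le _ _).trans ?_
  linarith

/-- The factor $|r|$ later cancels the zero of $\sinh v$, and the logarithmic singularity at $r=-1$
is weakened to an inverse square root. For $p=|1+r|<1$ it comes from $-\log p=-2\log\sqrt
p\le2(p^{-1/2}-1)$. -/
theorem abs_log_abs_one_add_le {r : ℝ} (hr : 1 + r ≠ 0) :
    |Real.log (|1 + r|)| ≤ |r| * (1 + 2 / √|1 + r|) := by
  set p := |1 + r| with hp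
  have hp0 : 0 < p := abs_pos.2 hr
  have hs := Real.sqrt_pos.2 hp0
  have hpr : |p - 1| ≤ |r| := by
    have := abs_abs_sub_abs_le_abs_sub (1 + r) 1
    rwa [abs_one, ← hp, add_sub_cancel_left] at this
  refine le_trans ?_ (mul_le_mul_of_nonneg_right hpr (by positivity))
  rcases le_total 1 p with h | h
  · rw [abs_of_nonneg (Real.log_nonneg h), abs_of_nonneg (by linarith)]
    have := Real.log_le_sub_one_of_pos hp0
    have h2 : 0 ≤ (p - 1) * (2 / √p) := mul_nonneg (by linarith) (by positivity)
    nlinarith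
  · rw [abs_of_nonpos (Real.log_nonpos hp0.le h), abs_of_nonpos (by linarith)]
    have h1 := Real.one_sub_inv_le_log_of_pos hs
    have h2 : Real.log (√p) = Real.log p / 2 := Real.log_sqrt hp0.le
    have h3 : p ≤ √p := Real.le_sqrt_of_sq_le (by nlinarith)
    have h4 : (√p)⁻¹ - 1 ≤ (1 - p) / √p := by
      rw [inv_eq_one_div, sub_le_iff_le_add, div_add_one hs.ne']
      gcongr; linarith
    have h5 : -(p - 1) * (1 + 2 / √p) = (1 - p) + 2 * ((1 - p) / √p) := by ring
    rw [h5]; linarith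

theorem div_sinh_le {v : ℝ} (hv : 0 < v) : v / Real.sinh v ≤ 2 * Real.exp (-(1 / 2) * v) := by
  have h1 : Real.sinh v = 2 * Real.sinh (v / 2) * Real.cosh (v / 2) := by
    rw [← Real.sinh_two_mul]; congr 1; ring
  have h2 : v / 2 ≤ Real.sinh (v / 2) := Real.self_le_sinh_iff.2 (by positivity)
  have h3 : Real.exp (v / 2) / 2 ≤ Real.cosh (v / 2) := by
    rw [Real.cosh_eq]; linarith [Real.exp_pos (-(v / 2))]
  have h4 : Real.exp (-(1 / 2) * v) * Real.exp (v / 2) = 1 := by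
    rw [← Real.exp_add]; ring_nf; simp
  rw [div_le_iff₀ (Real.sinh_pos_iff.2 hv), h1]
  have h5 : v * (Real.exp (v / 2) / 2) ≤ 2 * Real.sinh (v / 2) * Real.cosh (v / 2) := by
    gcongr; linarith
  calc v = 2 * Real.exp (-(1 / 2) * v) * (v * (Real.exp (v / 2) / 2)) := by linear_combination (-v) * h4
    _ ≤ _ := by gcongr

theorem abs_div_sinh_le {v : ℝ} (hv : v ≠ 0) :
    |v| / |Real.sinh v| ≤ 2 * Real.exp (-(1 / 2) * |v|) := by
  rw [Real.abs_sinh]; exact div_sinh_le (abs_pos.2 hv)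

theorem sqrt_abs_div_sinh_le {v : ℝ} (hv : v ≠ 0) :
    √|v| / |Real.sinh v| ≤ 2 * (1 / √|v| * Real.exp (-(1 / 2) * |v|)) := by
  have h := Real.sqrt_pos.2 (abs_pos.2 hv)
  calc √|v| / |Real.sinh v| = 1 / √|v| * (|v| / |Real.sinh v|) := by
        nth_rewrite 3 [← Real.mul_self_sqrt (abs_nonneg v)]
        field_simp
    _ ≤ 1 / √|v| * (2 * Real.exp (-(1 / 2) * |v|)) := by gcongr; exact abs_div_sinh_le hv
    _ = _ := by ring

/-- An integrable majorant of `|log |1 + r| - log |1 - r|| / r`. -/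
def logRatioWeight (r : ℝ) : ℝ :=
  (Iic 2).indicator (fun r => 4 + 2 / √|r - 1|) r + (Ioi 2).indicator (fun r => 4 * r ^ (-2 : ℝ)) r

theorem logRatioWeight_nonneg (r : ℝ) : 0 ≤ logRatioWeight r := by
  refine add_nonneg (indicator_nonneg (fun _ _ => by positivity) _)
    (indicator_nonneg (fun x hx => ?_) _)
  have : 0 < x := lt_trans two_pos hx
  positivity

theorem integrableOn_logRatioWeight : IntegrableOn logRatioWeight (Ioi 0) := by
  refine Integrable.add ?_ ?_
  · rw [integrable_indicator_iff measurableSet_Iic, IntegrableOn, Measure.restrict_restrict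
      measurableSet_Iic, inter_comm, Ioi_inter_Iic]
    have h1 : IntegrableOn (fun _ : ℝ => (4 : ℝ)) (Ioc 0 2) := integrableOn_const (by simp)
    have h2 := (setIntegral_one_div_sqrt_abs_le (p := -1) (q := 1) (by norm_num)).1
    have h3 : IntervalIntegrable (fun v : ℝ => 1 / √|v|) volume (-1) 1 :=
      (intervalIntegrable_iff_integrableOn_Ioc_of_le (by norm_num)).2 h2
    have h4 := h3.comp_sub_right 1
    norm_num at h4
    rw [intervalIntegrable_iff_integrableOn_Ioc_of_le (by norm_num)] at h4
    have h5 : IntegrableOn (fun x : ℝ => 2 / √|x - 1|) (Ioc 0 2) :=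
      IntegrableOn.congr_fun (Integrable.const_mul h4 2) (fun x _ => by simp [div_eq_mul_inv])
        measurableSet_Ioc
    exact Integrable.add h1 h5
  · rw [integrable_indicator_iff measurableSet_Ioi]
    rw [IntegrableOn, Measure.restrict_restrict measurableSet_Ioi]
    exact IntegrableOn.mono_set ((integrableOn_Ioi_rpow_of_lt (a := -2) (by norm_num)
      two_pos).const_mul 4) inter_subset_left

/-- Up to $r=2$ the two logarithms are bounded separately. Beyond,
$\log\frac{r+1}{r-1}\le\frac2{r-1}\le\frac4r$, which is integrable at infinity after division by
$r$. -/
theorem abs_log_sub_log_le {r : ℝ} (hr : 0 < r) (h1 : r ≠ 1) :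
    |Real.log |1 + r| - Real.log (|1 - r|)| ≤ r * logRatioWeight r := by
  rw [logRatioWeight]
  rcases le_or_gt r 2 with h | h
  · rw [indicator_of_mem (mem_Iic.2 h), indicator_of_notMem (by simpa using h), add_zero]
    have b1 := abs_log_abs_one_add_le (r := r) (by linarith)
    have b2 := abs_log_abs_one_add_le (r := -r) (by contrapose! h1; linarith)
    rw [abs_neg, ← sub_eq_add_neg] at b2
    rw [abs_of_pos hr] at b1 b2
    rw [abs_sub_comm r 1]
    have b3 : 2 / √|1 + r| ≤ 2 := by
      rw [div_le_iff₀ (Real.sqrt_pos.2 (abs_pos.2 (by linarith)))]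
      have : 1 ≤ √|1 + r| := Real.one_le_sqrt.2 (by rw [abs_of_pos] <;> linarith)
      linarith
    refine (abs_sub (Real.log |1 + r|) (Real.log (|1 - r|))).trans ?_
    nlinarith
  · rw [indicator_of_notMem (by simpa using h), indicator_of_mem (mem_Ioi.2 h), zero_add,
      abs_of_pos (by linarith : 0 < 1 + r), abs_of_neg (by linarith : 1 - r < 0), neg_sub,
      ← Real.log_div (by linarith) (by linarith)]
    have hr1 : 0 < r - 1 := by linarith
    have e1 : 1 ≤ (1 + r) / (r - 1) := by rw [one_le_div hr1]; linarith
    rw [abs_of_nonneg (Real.log_nonneg e1)]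
    refine (Real.log_le_sub_one_of_pos (by linarith)).trans ?_
    have e2 : r * (4 * r ^ (-2 : ℝ)) = 4 / r := by
      rw [Real.rpow_neg hr.le, Real.rpow_two]; field_simp
    rw [e2, div_sub_one hr1.ne', div_le_div_iff₀ hr1 hr]
    nlinarith

/-- A modulus of continuity with a logarithmic singularity at the origin. -/
def LogHolder (k : ℝ → ℂ) (B : ℝ) : Prop :=
  ∀ t₁ ∈ Icc (-2 : ℝ) 2, ∀ t₂ ∈ Icc (-2 : ℝ) 2, t₁ ≠ 0 → t₂ ≠ 0 →
    ‖k t₁ - k t₂‖ ≤ B * (|Real.log |t₁| - Real.log (|t₂|)| + √|t₁ - t₂|)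

theorem tanh_sub_tanh_mem (p q : ℝ) : Real.tanh p - Real.tanh q ∈ Icc (-2 : ℝ) 2 :=
  ⟨by linarith [Real.neg_one_lt_tanh p, Real.tanh_lt_one q],
    by linarith [Real.tanh_lt_one p, Real.neg_one_lt_tanh q]⟩

theorem tanh_sub_tanh_ne_zero {p q : ℝ} (h : p ≠ q) : Real.tanh p - Real.tanh q ≠ 0 :=
  sub_ne_zero.2 (fun e => h (Real.tanh_injective e))

theorem LogHolder.norm_tanh_sub_le {k : ℝ → ℂ} {B : ℝ} (hk : LogHolder k B) (hB : 0 ≤ B)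
    {c p q : ℝ} (hp : p ≠ c) (hq : q ≠ c) :
    ‖k (Real.tanh c - Real.tanh p) - k (Real.tanh c - Real.tanh q)‖ ≤
      B * (|Real.log |c - p| - Real.log (|c - q|)| + 2 * |p - q| + √|p - q|) := by
  refine (hk _ (tanh_sub_tanh_mem _ _) _ (tanh_sub_tanh_mem _ _) (tanh_sub_tanh_ne_zero hp.symm)
    (tanh_sub_tanh_ne_zero hq.symm)).trans ?_
  refine mul_le_mul_of_nonneg_left (add_le_add (abs_log_abs_tanh_sub_le hp hq)
    (Real.sqrt_le_sqrt ?_)) hB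
  rw [sub_sub_sub_cancel_left, abs_sub_comm p q]
  exact abs_tanh_sub_tanh_le q p

/-! ### Boundedness of the weighted finite Hilbert transform -/

/-- The integrand of the finite Hilbert transform of a difference kernel in the variable
`u = tanh (b - v)`, symmetrised in `v`. -/
def transformIntegrand (k : ℝ → ℂ) (x b v : ℝ) : ℂ :=
  (k (x - Real.tanh (b - v)) - k (x - Real.tanh (b + v))) / (Real.sinh v : ℂ)

/-- The weighted finite Hilbert transform of a difference kernel. -/
def transform (k : ℝ → ℂ) (x y : ℝ) : ℂ :=
  ∫ v in Ioi 0, transformIntegrand k x (Real.artanh y) v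

/-- A majorant of the integrand of the transform. -/
def transformWeight (ω v : ℝ) : ℝ := ω⁻¹ * logRatioWeight (ω⁻¹ * v) + 8 * decayWeight (1 / 2) v

theorem abs_log_add_sub_log_sub {w v : ℝ} (hw : w ≠ 0) (hv : 0 < v) (hvw : v ≠ |w|) :
    |Real.log |w + v| - Real.log (|w - v|)| =
      |Real.log |1 + |w|⁻¹ * v| - Real.log (|1 - |w|⁻¹ * v|)| := by
  have hω := abs_pos.2 hw
  have h1 : (1 + |w|⁻¹ * v) ≠ 0 := by positivity
  have h2 : (1 - |w|⁻¹ * v) ≠ 0 := by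
    intro h; field_simp at h; apply hvw; linarith
  have e1 : |w| * (1 + |w|⁻¹ * v) = |w| + v := by field_simp
  have e2 : |w| * (1 - |w|⁻¹ * v) = |w| - v := by field_simp
  have l1 : Real.log (|(|w| + v)|) = Real.log |w| + Real.log |1 + |w|⁻¹ * v| := by
    rw [← e1, abs_mul, abs_abs, Real.log_mul hω.ne' (abs_ne_zero.2 h1)]
  have l2 : Real.log (|(|w| - v)|) = Real.log |w| + Real.log |1 - |w|⁻¹ * v| := by
    rw [← e2, abs_mul, abs_abs, Real.log_mul hω.ne' (abs_ne_zero.2 h2)]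
  rcases lt_or_gt_of_ne hw with h | h
  · have a1 : |w + v| = |(|w| - v)| := by
      rw [abs_of_neg h, ← abs_neg (-w - v)]; congr 1; ring
    have a2 : |w - v| = |(|w| + v)| := by
      rw [abs_of_neg h, ← abs_neg (-w + v)]; congr 1; ring
    rw [a1, a2, l1, l2, abs_sub_comm]
    congr 1; ring
  · have a : |w| = w := abs_of_pos h
    rw [a] at l1 l2 ⊢
    rw [l1, l2]
    congr 1; ring

/-- With $w=c-b$ the logarithmic part is a function of $v/|w|$ alone, bounded by $(v/|w|)$ times
`logRatioWeight`, and $v/\sinh v\le1$. The linear and square-root parts, divided by $\sinh v$, go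
into the decaying weight. -/
theorem LogHolder.norm_transformIntegrand_le {k : ℝ → ℂ} {B : ℝ} (hk : LogHolder k B) (hB : 0 ≤ B)
    {c b v : ℝ} (hcb : c ≠ b) (hv : 0 < v) (hvw : v ≠ |c - b|) :
    ‖transformIntegrand k (Real.tanh c) b v‖ ≤ B * transformWeight |c - b| v := by
  set w := c - b with hw
  have hw0 : w ≠ 0 := sub_ne_zero.2 hcb
  have hω := abs_pos.2 hw0
  have hp : b - v ≠ c := by
    intro h; apply hvw; rw [show w = -v by linarith, abs_neg, abs_of_pos hv]
  have hq : b + v ≠ c := by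
    intro h; apply hvw; rw [show w = v by linarith, abs_of_pos hv]
  have hs : 0 < Real.sinh v := Real.sinh_pos_iff.2 hv
  have h1 := hk.norm_tanh_sub_le hB hp hq
  have e1 : |b - v - (b + v)| = 2 * v := by
    rw [show b - v - (b + v) = -(2 * v) by ring, abs_neg, abs_of_pos (by positivity)]
  rw [show c - (b - v) = w + v by rw [hw]; ring, show c - (b + v) = w - v by rw [hw]; ring, e1,
    abs_log_add_sub_log_sub hw0 hv hvw] at h1
  have h2 := abs_log_sub_log_le (r := |w|⁻¹ * v) (by positivity) (by
    intro h; field_simp at h; exact hvw h)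
  have h3 : √(2 * v) ≤ 2 * √v := by
    rw [Real.sqrt_mul two_pos.le]
    have : √(2 : ℝ) ≤ 2 := by rw [Real.sqrt_le_left two_pos.le]; norm_num
    gcongr
  have hlw := logRatioWeight_nonneg (|w|⁻¹ * v)
  have d1 := div_sinh_le hv
  have d2 := sqrt_abs_div_sinh_le hv.ne'
  rw [abs_of_pos hs, abs_of_pos hv] at d2
  have d3 : v / Real.sinh v ≤ 1 := (div_le_one hs).2 (Real.self_le_sinh_iff.2 hv.le)
  rw [transformIntegrand, norm_div, Complex.norm_real, Real.norm_of_nonneg hs.le]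
  calc _ ≤ B * (|w|⁻¹ * v * logRatioWeight (|w|⁻¹ * v) + 2 * (2 * v) + 2 * √v) / Real.sinh v := by
        gcongr
        refine h1.trans ?_
        gcongr
    _ = B * (|w|⁻¹ * logRatioWeight (|w|⁻¹ * v) * (v / Real.sinh v) + 4 * (v / Real.sinh v)
          + 2 * (√v / Real.sinh v)) := by ring
    _ ≤ B * (|w|⁻¹ * logRatioWeight (|w|⁻¹ * v) * 1 + 4 * (2 * Real.exp (-(1 / 2) * v))
          + 2 * (2 * (1 / √v * Real.exp (-(1 / 2) * v)))) := by gcongr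
    _ ≤ _ := by
        rw [transformWeight, decayWeight, abs_of_pos hv]
        have : 0 ≤ 1 / √v * Real.exp (-(1 / 2) * v) := by positivity
        refine mul_le_mul_of_nonneg_left ?_ hB
        linarith

theorem integrableOn_transformWeight {ω : ℝ} (hω : 0 < ω) :
    IntegrableOn (transformWeight ω) (Ioi 0) := by
  have h1 : IntegrableOn (fun v => logRatioWeight (ω⁻¹ * v)) (Ioi 0) := by
    rw [integrableOn_Ioi_comp_mul_left_iff _ _ (inv_pos.2 hω), mul_zero]
    exact integrableOn_logRatioWeight
  exact (h1.const_mul _).add ((integrable_decayWeight (by norm_num)).integrableOn.const_mul 8)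

/-- Scale invariance of the logarithmic part; this makes the bound of the transform uniform as $x$
and $y$ come together. -/
theorem setIntegral_transformWeight {ω : ℝ} (hω : 0 < ω) :
    ∫ v in Ioi 0, transformWeight ω v = ∫ v in Ioi 0, transformWeight 1 v := by
  have h1 : ∀ ω : ℝ, 0 < ω → ∫ v in Ioi 0, transformWeight ω v =
      (∫ v in Ioi 0, logRatioWeight v) + ∫ v in Ioi 0, 8 * decayWeight (1 / 2) v := by
    intro ω hω
    have h1 : IntegrableOn (fun v => ω⁻¹ * logRatioWeight (ω⁻¹ * v)) (Ioi 0) := by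
      refine Integrable.const_mul ?_ _
      refine (integrableOn_Ioi_comp_mul_left_iff _ _ (inv_pos.2 hω)).2 ?_
      rw [mul_zero]
      exact integrableOn_logRatioWeight
    unfold transformWeight
    rw [integral_add h1 ((integrable_decayWeight (by norm_num)).integrableOn.const_mul 8),
      integral_const_mul, integral_comp_mul_left_Ioi _ _ (inv_pos.2 hω), mul_zero, inv_inv,
      smul_eq_mul, inv_mul_cancel_left₀ hω.ne']
  rw [h1 ω hω, h1 1 one_pos]

theorem ae_ne (w : ℝ) : ∀ᵐ v : ℝ, v ≠ w := by
  simp [ae_iff]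

theorem LogHolder.ae_norm_transformIntegrand_le {k : ℝ → ℂ} {B : ℝ} (hk : LogHolder k B)
    (hB : 0 ≤ B) {c b : ℝ} (hcb : c ≠ b) : ∀ᵐ v ∂(volume.restrict (Ioi (0 : ℝ))),
    ‖transformIntegrand k (Real.tanh c) b v‖ ≤ B * transformWeight |c - b| v := by
  rw [ae_restrict_iff' measurableSet_Ioi]
  filter_upwards [ae_ne |c - b|] with v hv hv0
  exact hk.norm_transformIntegrand_le hB hcb hv0 hv

theorem LogHolder.norm_transform_le {k : ℝ → ℂ} {B : ℝ} (hk : LogHolder k B) (hB : 0 ≤ B)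
    {c b : ℝ} (hcb : c ≠ b) : ‖transform k (Real.tanh c) (Real.tanh b)‖ ≤
      B * ∫ v in Ioi 0, transformWeight 1 v := by
  have hω := abs_pos.2 (sub_ne_zero.2 hcb)
  rw [transform, Real.artanh_tanh, ← setIntegral_transformWeight hω, ← integral_const_mul]
  exact norm_integral_le_of_norm_le ((integrableOn_transformWeight hω).const_mul B)
    (hk.ae_norm_transformIntegrand_le hB hcb)

/-! ### The principal value in the hyperbolic variable -/

/-- The integrand in the variable `u = tanh (b - v)`, made regular at `v = 0`. -/
def shiftedIntegrand (k : ℝ → ℂ) (x b v : ℝ) : ℂ :=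
  (k (x - Real.tanh (b - v)) - k (x - Real.tanh b)) / (Real.sinh v : ℂ)

theorem measurable_shiftedIntegrand {k : ℝ → ℂ} (hk : Measurable k) (x b : ℝ) :
    Measurable (shiftedIntegrand k x b) := by
  have := continuous_tanh.measurable
  unfold shiftedIntegrand
  fun_prop

theorem measurable_transformIntegrand {k : ℝ → ℂ} (hk : Measurable k) (x b : ℝ) :
    Measurable (transformIntegrand k x b) := by
  have := continuous_tanh.measurable
  unfold transformIntegrand
  fun_prop

/-- Subtracting the value at $v=0$ tames the pole of $1/\sinh v$, and the logarithmic singularity at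
$v=-w$ is integrable. The majorant depends badly on $w$, which is harmless: it only justifies limits
for fixed $x\ne y$. -/
theorem LogHolder.integrable_shiftedIntegrand {k : ℝ → ℂ} {B : ℝ} (hk : LogHolder k B)
    (hB : 0 ≤ B) (hm : Measurable k) {c b : ℝ} (hcb : c ≠ b) :
    Integrable (shiftedIntegrand k (Real.tanh c) b) := by
  set w := c - b with hw
  have hw0 : w ≠ 0 := sub_ne_zero.2 hcb
  have hω := abs_pos.2 hw0
  have hD := integrable_decayWeight (η := 1 / 2) (by norm_num)
  refine Integrable.mono' (g := fun v => B * ((2 * |w|⁻¹ + 4) * decayWeight (1 / 2) v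
    + 4 * √|w| * |w|⁻¹ * Real.exp (1 / 2 * |w|) * decayWeight (1 / 2) (v + w)
    + 2 * decayWeight (1 / 2) v)) ?_ (measurable_shiftedIntegrand hm _ _).aestronglyMeasurable ?_
  · exact (((hD.const_mul _).add ((hD.comp_add_right w).const_mul _)).add (hD.const_mul _)).const_mul _
  filter_upwards [ae_ne 0, ae_ne (-w)] with v hv0 hvw
  have hp : b - v ≠ c := by
    intro h; apply hvw; linarith
  have hs : 0 < |Real.sinh v| := abs_pos.2 (by simpa using hv0)
  have hvp := abs_pos.2 hv0
  have hwv : w + v ≠ 0 := fun h => hvw (by linarith)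
  have h1 := hk.norm_tanh_sub_le hB hp hcb.symm
  have e1 : |b - v - b| = |v| := by rw [sub_sub_cancel_left, abs_neg]
  rw [show c - (b - v) = w + v by rw [hw]; ring, e1, ← hw] at h1
  have hr : 1 + v / w ≠ 0 := by
    intro h; field_simp at h; exact hwv (by simpa using h)
  have e2 : Real.log |w + v| - Real.log |w| = Real.log |1 + v / w| := by
    rw [← Real.log_div (abs_ne_zero.2 hwv) hω.ne', ← abs_div, add_div, div_self hw0]
  have e3 : √|1 + v / w| = √|w + v| / √|w| := by
    rw [← Real.sqrt_div (abs_nonneg _), ← abs_div, add_div, div_self hw0]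
  have h2 := abs_log_abs_one_add_le hr
  rw [e3, abs_div] at h2
  rw [e2] at h1
  have hsw := Real.sqrt_pos.2 hω
  have hswv := Real.sqrt_pos.2 (abs_pos.2 hwv)
  have d1 := abs_div_sinh_le hv0
  have d2 := sqrt_abs_div_sinh_le hv0
  set E := Real.exp (-(1 / 2) * |v|) with hE
  have hE0 : 0 < E := Real.exp_pos _
  have w1 : E ≤ decayWeight (1 / 2) v := by
    rw [decayWeight, ← hE]
    have : 0 ≤ 1 / √|v| * E := by positivity
    linarith
  have w2 : 1 / √|v| * E ≤ decayWeight (1 / 2) v := by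
    rw [decayWeight, ← hE]; linarith
  -- The decay is recentred at the singularity by $|w+v|\le|w|+|v|$.
  have w3 : 1 / √|w + v| * E ≤ Real.exp (1 / 2 * |w|) * decayWeight (1 / 2) (v + w) := by
    rw [decayWeight, add_comm v w]
    have : E ≤ Real.exp (1 / 2 * |w|) * Real.exp (-(1 / 2) * |w + v|) := by
      rw [hE, ← Real.exp_add]
      refine Real.exp_le_exp.2 ?_
      have := abs_add_le w v
      linarith [abs_add_le w v]
    calc 1 / √|w + v| * E ≤ 1 / √|w + v| * (Real.exp (1 / 2 * |w|) * Real.exp (-(1 / 2) * |w + v|)) := by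
          gcongr
      _ ≤ _ := by
          have : 0 ≤ Real.exp (1 / 2 * |w|) * Real.exp (-(1 / 2) * |w + v|) := by positivity
          linarith
  rw [shiftedIntegrand, norm_div, Complex.norm_real, Real.norm_eq_abs]
  calc _ ≤ B * (|v| / |w| * (1 + 2 / (√|w + v| / √|w|)) + 2 * |v| + √|v|) / |Real.sinh v| := by
        gcongr
        exact h1.trans (by gcongr)
    _ = B * ((|w|⁻¹ + 2) * (|v| / |Real.sinh v|)
          + 2 * √|w| * |w|⁻¹ * (1 / √|w + v|) * (|v| / |Real.sinh v|)
          + √|v| / |Real.sinh v|) := by field_simp; ring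
    _ ≤ B * ((|w|⁻¹ + 2) * (2 * E) + 2 * √|w| * |w|⁻¹ * (1 / √|w + v|) * (2 * E)
          + 2 * (1 / √|v| * E)) := by gcongr
    _ = B * ((2 * |w|⁻¹ + 4) * E + 4 * √|w| * |w|⁻¹ * (1 / √|w + v| * E)
          + 2 * (1 / √|v| * E)) := by ring
    _ ≤ B * ((2 * |w|⁻¹ + 4) * decayWeight (1 / 2) v + 4 * √|w| * |w|⁻¹ *
          (Real.exp (1 / 2 * |w|) * decayWeight (1 / 2) (v + w))
          + 2 * decayWeight (1 / 2) v) := by gcongr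
    _ = _ := by ring

/-- Folding the half-lines onto each other cancels the subtracted constant, since $\sinh$ is odd. -/
theorem integral_shiftedIntegrand {k : ℝ → ℂ} {x b : ℝ} (h : Integrable (shiftedIntegrand k x b)) :
    ∫ v, shiftedIntegrand k x b v = ∫ v in Ioi 0, transformIntegrand k x b v := by
  have h2 : IntegrableOn (fun v => shiftedIntegrand k x b (-v)) (Ioi 0) := h.comp_neg.integrableOn
  rw [← integral_add_compl measurableSet_Ioi (s := Ioi (0 : ℝ)) h, compl_Ioi,
    show (0 : ℝ) = -0 by simp, ← integral_comp_neg_Ioi, neg_zero,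
    ← integral_add h.integrableOn h2]
  refine setIntegral_congr_fun measurableSet_Ioi fun v _ => ?_
  simp only [shiftedIntegrand, transformIntegrand, Real.sinh_neg, Complex.ofReal_neg, sub_neg_eq_add]
  rw [div_neg, ← sub_eq_add_neg, ← sub_div, sub_sub_sub_cancel_right]

/-- The hyperbolic tangent of half the argument. -/
def tanhHalf (v : ℝ) : ℝ := (1 - Real.exp (-v)) / (1 + Real.exp (-v))

theorem tanhHalf_neg (v : ℝ) : tanhHalf (-v) = -tanhHalf v := by
  have h : Real.exp v * Real.exp (-v) = 1 := by rw [← Real.exp_add]; simp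
  have h1 : 0 < 1 + Real.exp v := by positivity
  have h2 : 0 < 1 + Real.exp (-v) := by positivity
  rw [tanhHalf, tanhHalf, neg_neg, ← neg_div, div_eq_div_iff h1.ne' h2.ne']
  linear_combination (-2) * h

theorem tanhHalf_pos {v : ℝ} (hv : 0 < v) : 0 < tanhHalf v :=
  div_pos (sub_pos.2 (Real.exp_lt_one_iff.2 (by linarith))) (by positivity)

theorem hasDerivAt_tanhHalf (v : ℝ) :
    HasDerivAt tanhHalf (2 * Real.exp (-v) / (1 + Real.exp (-v)) ^ 2) v := by
  have he : HasDerivAt (fun v : ℝ => Real.exp (-v)) (-Real.exp (-v)) v := by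
    simpa using (hasDerivAt_neg v).exp
  have h := (he.const_sub 1).div (he.const_add 1) (by positivity)
  refine h.congr_deriv ?_
  congr 1; ring

theorem hasDerivAt_log_tanhHalf {v : ℝ} (hv : 0 < v) :
    HasDerivAt (fun v => Real.log (tanhHalf v)) (1 / Real.sinh v) v := by
  refine ((hasDerivAt_tanhHalf v).log (tanhHalf_pos hv).ne').congr_deriv ?_
  have h1 : 0 < 1 - Real.exp (-v) := sub_pos.2 (Real.exp_lt_one_iff.2 (by linarith))
  have h2 : 0 < 1 + Real.exp (-v) := by positivity
  have hs : Real.sinh v * (2 * Real.exp (-v)) = (1 - Real.exp (-v)) * (1 + Real.exp (-v)) := by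
    have h : Real.exp v * Real.exp (-v) = 1 := by rw [← Real.exp_add]; simp
    rw [Real.sinh_eq]; linear_combination h
  have hs0 := Real.sinh_pos_iff.2 hv
  rw [tanhHalf, div_div_div_eq, div_eq_div_iff (by positivity) hs0.ne']
  linear_combination (1 + Real.exp (-v)) * hs

theorem tendsto_log_tanhHalf : Tendsto (fun v => Real.log (tanhHalf v)) atTop (𝓝 0) := by
  have he : Tendsto (fun v : ℝ => Real.exp (-v)) atTop (𝓝 0) :=
    Real.tendsto_exp_atBot.comp tendsto_neg_atTop_atBot
  have h := ((he.const_sub 1).div (he.const_add 1) (by norm_num)).log (by norm_num)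
  simpa [tanhHalf] using h

theorem integrableOn_one_div_sinh {p : ℝ} (hp : 0 < p) :
    IntegrableOn (fun v => 1 / Real.sinh v) (Ioi p) ∧
      ∫ v in Ioi p, 1 / Real.sinh v = -Real.log (tanhHalf p) := by
  have hd : ∀ v ∈ Ici p, HasDerivAt (fun v => Real.log (tanhHalf v)) (1 / Real.sinh v) v :=
    fun v hv => hasDerivAt_log_tanhHalf (lt_of_lt_of_le hp hv)
  have hn : ∀ v ∈ Ioi p, 0 ≤ 1 / Real.sinh v := fun v hv =>
    (one_div_pos.2 (Real.sinh_pos_iff.2 (hp.trans hv))).le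
  refine ⟨integrableOn_Ioi_deriv_of_nonneg' hd hn tendsto_log_tanhHalf, ?_⟩
  rw [integral_Ioi_of_hasDerivAt_of_nonneg' hd hn tendsto_log_tanhHalf, zero_sub]

/-- For $p\ne q$ the truncation is asymmetric, and the two tails of the odd function $1/\sinh$ leave
a logarithmic defect. -/
theorem integrableOn_one_div_sinh_compl {p q : ℝ} (hp : 0 < p) (hq : 0 < q) :
    IntegrableOn (fun v => 1 / Real.sinh v) (Iio (-q) ∪ Ioi p) ∧
      ∫ v in Iio (-q) ∪ Ioi p, 1 / Real.sinh v =
        Real.log (tanhHalf q) - Real.log (tanhHalf p) := by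
  obtain ⟨ip, vp⟩ := integrableOn_one_div_sinh hp
  obtain ⟨iq, vq⟩ := integrableOn_one_div_sinh hq
  have iq' : IntegrableOn (fun v => 1 / Real.sinh v) (Iio (-q)) := by
    have h : IntegrableOn (fun v => 1 / Real.sinh v) (Ioi (-(-q))) := by rwa [neg_neg]
    have := (IntegrableOn.comp_neg_Iio h).neg
    refine this.congr_fun (fun v _ => ?_) measurableSet_Iio
    simp [Real.sinh_neg]
  refine ⟨iq'.union ip, ?_⟩
  rw [setIntegral_union (disjoint_left.2 fun v hv hv' => by
    have h1 := mem_Iio.1 hv; have h2 := mem_Ioi.1 hv'; linarith) measurableSet_Ioi iq' ip, vp,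
    ← integral_Iic_eq_integral_Iio, ← integral_comp_neg_Ioi]
  simp only [Real.sinh_neg, div_neg]
  rw [integral_neg, vq]
  ring

theorem hasDerivAt_artanh {y : ℝ} (hy : y ∈ Ioo (-1 : ℝ) 1) :
    HasDerivAt Real.artanh (Real.cosh (Real.artanh y) ^ 2) y := by
  have hcont : ContinuousAt Real.artanh y := by
    unfold Real.artanh
    have h1 : 1 - y ≠ 0 := by linarith [hy.2]
    have h2 : 0 < (1 + y) / (1 - y) := div_pos (by linarith [hy.1]) (by linarith [hy.2])
    refine ContinuousAt.log ?_ (Real.sqrt_pos.2 h2).ne'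
    exact (ContinuousAt.div (by fun_prop) (by fun_prop) h1).sqrt
  have h := HasDerivAt.of_local_left_inverse hcont (hasDerivAt_tanh (Real.artanh y))
    (by have := Real.cosh_pos (Real.artanh y); positivity) (by
      filter_upwards [Ioo_mem_nhds hy.1 hy.2] with z hz using Real.tanh_artanh hz)
  simpa using h

theorem truncation_eq {y ε : ℝ} (h1 : y + ε < 1) (h2 : -1 < y - ε) (hε : 0 < ε) :
    {v : ℝ | ε < |Real.tanh (Real.artanh y - v) - y|} =
      Iio (-(Real.artanh (y + ε) - Real.artanh y)) ∪ Ioi (Real.artanh y - Real.artanh (y - ε)) := by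
  have m1 : y + ε ∈ Ioo (-1 : ℝ) 1 := ⟨by linarith, h1⟩
  have m2 : y - ε ∈ Ioo (-1 : ℝ) 1 := ⟨h2, by linarith⟩
  have hm : ∀ r : ℝ, Real.tanh r ∈ Ioo (-1 : ℝ) 1 := fun r =>
    ⟨Real.neg_one_lt_tanh r, Real.tanh_lt_one r⟩
  ext v
  rw [Set.mem_ofPred_eq, lt_abs, mem_union, mem_Iio, mem_Ioi]
  have a1 := Real.artanh_lt_artanh_iff m1 (hm (Real.artanh y - v))
  have a2 := Real.artanh_lt_artanh_iff (hm (Real.artanh y - v)) m2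
  rw [Real.artanh_tanh] at a1 a2
  refine or_congr ?_ ?_
  · rw [lt_sub_iff_add_lt, add_comm ε y, ← a1]
    constructor <;> intro h <;> linarith
  · rw [neg_sub, lt_sub_comm, ← a2]
    constructor <;> intro h <;> linarith

/-- The truncated integrals of `1 / sinh` which come from a symmetric truncation in the variable
`u = tanh (b - v)` tend to `0`. -/
theorem tendsto_setIntegral_one_div_sinh {y : ℝ} (hy : y ∈ Ioo (-1 : ℝ) 1) :
    Tendsto (fun ε => ∫ v in {v : ℝ | ε < |Real.tanh (Real.artanh y - v) - y|}, 1 / Real.sinh v)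
      (𝓝[>] 0) (𝓝 0) := by
  set b := Real.artanh y with hb
  set D : ℝ → ℝ := fun h => tanhHalf (Real.artanh (y + h) - b) with hD
  have hDd : HasDerivAt D (1 / 2 * Real.cosh b ^ 2) 0 := by
    have h1 : HasDerivAt (fun h => Real.artanh (y + h) - b) (Real.cosh b ^ 2) 0 := by
      have := hasDerivAt_artanh hy
      rw [← add_zero y] at this
      have h2 := (this.comp_const_add y 0).sub_const b
      rwa [add_zero] at h2
    have h3 := hasDerivAt_tanhHalf (Real.artanh (y + 0) - b)
    have := h3.comp (0 : ℝ) h1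
    refine this.congr_deriv ?_
    rw [add_zero, ← hb, sub_self]; norm_num
  have hd0 : 0 < 1 / 2 * Real.cosh b ^ 2 := by have := Real.cosh_pos b; positivity
  have hD0 : D 0 = 0 := by simp [hD, ← hb, tanhHalf]
  have hs := hDd.tendsto_slope_zero
  simp only [zero_add, hD0, sub_zero, smul_eq_mul] at hs
  have s1 : Tendsto (fun ε => ε⁻¹ * D ε) (𝓝[>] 0) (𝓝 (1 / 2 * Real.cosh b ^ 2)) :=
    hs.mono_left (nhdsWithin_mono _ fun x hx => ne_of_gt hx)
  have s2 : Tendsto (fun ε => (-ε)⁻¹ * D (-ε)) (𝓝[>] 0) (𝓝 (1 / 2 * Real.cosh b ^ 2)) := by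
    refine hs.comp (tendsto_nhdsWithin_iff.2 ⟨?_, ?_⟩)
    · have : Tendsto (fun ε : ℝ => -ε) (𝓝 0) (𝓝 (-0)) := tendsto_id.neg
      rw [neg_zero] at this
      exact this.mono_left nhdsWithin_le_nhds
    · filter_upwards [self_mem_nhdsWithin] with ε hε
      simpa using ne_of_gt hε
  -- The two cut-offs are governed by the difference quotients of `D` at 0 from the right and from
  -- the left. Both tend to the same positive derivative, so the logarithmic defect vanishes.
  have hlim := (s1.log hd0.ne').sub (s2.log hd0.ne')
  rw [sub_self] at hlim
  refine hlim.congr' ?_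
  have hη : 0 < min (1 - y) (1 + y) := lt_min (by linarith [hy.2]) (by linarith [hy.1])
  filter_upwards [Ioo_mem_nhdsGT hη] with ε hε
  have hε0 : 0 < ε := hε.1
  have e1 : y + ε < 1 := by linarith [hε.2, min_le_left (1 - y) (1 + y)]
  have e2 : -1 < y - ε := by linarith [hε.2, min_le_right (1 - y) (1 + y)]
  have p1 : 0 < Real.artanh (y + ε) - b :=
    sub_pos.2 (Real.artanh_lt_artanh hy.1 e1 (by linarith))
  have p2 : 0 < b - Real.artanh (y - ε) :=
    sub_pos.2 (Real.artanh_lt_artanh e2 hy.2 (by linarith))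
  rw [truncation_eq e1 e2 hε0, (integrableOn_one_div_sinh_compl p2 p1).2]
  have d1 : D ε = tanhHalf (Real.artanh (y + ε) - b) := rfl
  have d2 : D (-ε) = -tanhHalf (b - Real.artanh (y - ε)) := by
    rw [← tanhHalf_neg, neg_sub, sub_eq_add_neg y ε]
  rw [d1, d2, inv_neg, neg_mul_neg, Real.log_mul (inv_pos.2 hε0).ne' (tanhHalf_pos p1).ne',
    Real.log_mul (inv_pos.2 hε0).ne' (tanhHalf_pos p2).ne']
  ring

/-- The Jacobian and the weight reduce to powers of $\cosh$, which cancel against the denominator of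
$\tanh b-\tanh(b-v)=\sinh v/(\cosh b\cosh(b-v))$. -/
theorem substitution_identity (b v : ℝ) (hv : v ≠ 0) :
    1 / Real.cosh (b - v) ^ 2 * (√((1 - Real.tanh b ^ 2) / (1 - Real.tanh (b - v) ^ 2)) /
      (Real.tanh b - Real.tanh (b - v))) = 1 / Real.sinh v := by
  have hb := Real.cosh_pos b
  have hbv := Real.cosh_pos (b - v)
  have hs : Real.sinh v ≠ 0 := by simpa using hv
  have e : ∀ r, 1 - Real.tanh r ^ 2 = 1 / Real.cosh r ^ 2 := fun r => by
    have := Real.cosh_pos r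
    rw [Real.tanh_eq_sinh_div_cosh, div_pow, eq_div_iff (by positivity), sub_mul,
      div_mul_cancel₀ _ (by positivity), Real.cosh_sq]
    ring
  have e2 : 1 / Real.cosh b ^ 2 / (1 / Real.cosh (b - v) ^ 2) =
      (Real.cosh (b - v) / Real.cosh b) ^ 2 := by field_simp
  rw [e, e, e2, Real.sqrt_sq (by positivity), tanh_sub_tanh, sub_sub_cancel]
  field_simp

theorem setIntegral_truncation {k : ℝ → ℂ} (x : ℝ) {y ε : ℝ} (hy : y ∈ Ioo (-1 : ℝ) 1)
    (hε : 0 < ε) :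
    ∫ u in {u : ℝ | u ∈ Icc (-1) 1 ∧ ε < |u - y|},
      k (x - u) * ((√((1 - y ^ 2) / (1 - u ^ 2)) / (y - u) : ℝ) : ℂ) =
    ∫ v in {v : ℝ | ε < |Real.tanh (Real.artanh y - v) - y|},
      k (x - Real.tanh (Real.artanh y - v)) * ((1 / Real.sinh v : ℝ) : ℂ) := by
  set b := Real.artanh y with hb
  have hyb : Real.tanh b = y := Real.tanh_artanh hy
  set S := {v : ℝ | ε < |Real.tanh (b - v) - y|} with hS
  have hSm : MeasurableSet S := by
    have : Continuous fun v => |Real.tanh (b - v) - y| := by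
      have := continuous_tanh; fun_prop
    exact (isOpen_lt continuous_const this).measurableSet
  have himg : (fun v => Real.tanh (b - v)) '' S = {u : ℝ | u ∈ Ioo (-1) 1 ∧ ε < |u - y|} := by
    ext u
    constructor
    · rintro ⟨v, hv, rfl⟩
      exact ⟨⟨Real.neg_one_lt_tanh _, Real.tanh_lt_one _⟩, hv⟩
    · rintro ⟨hu, hu2⟩
      have e : Real.tanh (b - (b - Real.artanh u)) = u := by
        rw [sub_sub_cancel, Real.tanh_artanh hu]
      refine ⟨b - Real.artanh u, ?_, e⟩
      rw [hS, Set.mem_ofPred_eq, e]; exact hu2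
  have hae : ({u : ℝ | u ∈ Icc (-1) 1 ∧ ε < |u - y|} : Set ℝ) =ᵐ[volume]
      ({u : ℝ | u ∈ Ioo (-1) 1 ∧ ε < |u - y|} : Set ℝ) :=
    (Ioo_ae_eq_Icc (a := (-1 : ℝ)) (b := 1)).symm.inter (ae_eq_refl {u : ℝ | ε < |u - y|})
  rw [setIntegral_congr_set hae, ← himg,
    integral_image_eq_integral_abs_deriv_smul hSm (f' := fun v => -(1 / Real.cosh (b - v) ^ 2))
      (fun v _ => by
        have := (hasDerivAt_tanh (b - v)).comp_const_sub b v
        exact this.hasDerivWithinAt)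
      (fun v _ v' _ h => by have := Real.tanh_injective h; linarith)]
  refine setIntegral_congr_fun hSm fun v hv => ?_
  have hv0 : v ≠ 0 := by
    rintro rfl
    rw [hS, Set.mem_ofPred_eq, sub_zero, hyb, sub_self, abs_zero] at hv
    exact absurd hv (not_lt.2 hε.le)
  have hid := substitution_identity b v hv0
  rw [hyb] at hid
  have hpos : 0 ≤ 1 / Real.cosh (b - v) ^ 2 := by positivity
  simp only [abs_neg, abs_of_nonneg hpos]
  rw [← hid, Complex.real_smul, Complex.ofReal_mul]
  ring

/-- The truncated integral splits into the integrable shifted part, whose truncations exhaust the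
line, and $k(x-y)$ times a truncated integral of $1/\sinh$, which tends to 0. -/
theorem LogHolder.pvIntegral_eq {k : ℝ → ℂ} {B : ℝ} (hk : LogHolder k B) (hB : 0 ≤ B)
    (hm : Measurable k) {x y : ℝ} (hx : x ∈ Ioo (-1 : ℝ) 1) (hy : y ∈ Ioo (-1 : ℝ) 1)
    (hxy : x ≠ y) :
    pvIntegral (fun u => k (x - u) * ((√((1 - y ^ 2) / (1 - u ^ 2)) / (y - u) : ℝ) : ℂ)) y =
      transform k x y := by
  set b := Real.artanh y with hb
  set c := Real.artanh x with hc
  have hyb : Real.tanh b = y := Real.tanh_artanh hy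
  have hxc : Real.tanh c = x := Real.tanh_artanh hx
  have hcb : c ≠ b := fun h => hxy (by rw [← hxc, ← hyb, h])
  have hg := hk.integrable_shiftedIntegrand hB hm hcb
  rw [hxc] at hg
  have hcov : AECover volume (𝓝[>] (0 : ℝ)) fun ε => {v : ℝ | ε < |Real.tanh (b - v) - y|} := by
    constructor
    · filter_upwards [ae_ne 0] with v hv
      have h1 : 0 < |Real.tanh (b - v) - y| := by
        rw [← hyb]
        refine abs_pos.2 (tanh_sub_tanh_ne_zero fun h => hv (by linarith))
      filter_upwards [Ioo_mem_nhdsGT h1] with ε hε using hε.2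
    · intro ε
      have : Continuous fun v => |Real.tanh (b - v) - y| := by
        have := continuous_tanh; fun_prop
      exact (isOpen_lt continuous_const this).measurableSet
  have h1 := hcov.integral_tendsto_of_countably_generated hg
  have h2 := ((Complex.continuous_ofReal.tendsto _).comp
    (tendsto_setIntegral_one_div_sinh hy)).const_mul (k (x - y))
  have h3 := h1.add h2
  rw [Complex.ofReal_zero, mul_zero, add_zero, integral_shiftedIntegrand hg] at h3
  refine Tendsto.limUnder_eq (h3.congr' ?_)
  have hη : 0 < min (1 - y) (1 + y) := lt_min (by linarith [hy.2]) (by linarith [hy.1])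
  filter_upwards [Ioo_mem_nhdsGT hη] with ε hε
  have hε0 : 0 < ε := hε.1
  have e1 : y + ε < 1 := by linarith [hε.2, min_le_left (1 - y) (1 + y)]
  have e2 : -1 < y - ε := by linarith [hε.2, min_le_right (1 - y) (1 + y)]
  have p1 : 0 < Real.artanh (y + ε) - b :=
    sub_pos.2 (Real.artanh_lt_artanh hy.1 e1 (by linarith))
  have p2 : 0 < b - Real.artanh (y - ε) :=
    sub_pos.2 (Real.artanh_lt_artanh e2 hy.2 (by linarith))
  have hint := (integrableOn_one_div_sinh_compl p2 p1).1
  rw [← truncation_eq e1 e2 hε0, ← hb] at hint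
  have hint' : IntegrableOn (fun v => k (x - y) * ((1 / Real.sinh v : ℝ) : ℂ))
      {v | ε < |Real.tanh (b - v) - y|} := Integrable.const_mul (Integrable.ofReal hint) _
  rw [setIntegral_truncation x hy hε0, Function.comp_apply, ← hb, ← integral_complex_ofReal,
    ← integral_const_mul, ← integral_add hg.integrableOn hint']
  refine setIntegral_congr_fun (hcov.measurableSet ε) fun v _ => ?_
  simp only [shiftedIntegrand, hyb]
  push_cast
  ring

theorem pvIntegral_congr {f g : ℝ → ℂ} {x y : ℝ}
    (h : ∀ u ∈ Icc (-1 : ℝ) 1, u ≠ x → f u = g u) : pvIntegral f y = pvIntegral g y := by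
  unfold pvIntegral
  congr 1
  ext ε
  have hm : MeasurableSet {u : ℝ | u ∈ Icc (-1) 1 ∧ ε < |u - y|} :=
    measurableSet_Icc.inter (isOpen_lt continuous_const
      (continuous_abs.comp (continuous_sub_right y))).measurableSet
  refine setIntegral_congr_ae hm ?_
  filter_upwards [ae_ne x] with u hu hu2 using h u hu2.1 hu

/-! ### The kernel $N_s$ and the determinant $D_N$ -/

theorem exists_logHolder_diffKernel {a U : ℝ} (hU : 0 < U) (hUa : U < a) {δ L : ℝ} (hδ : 0 < δ) :
    ∃ C : ℝ, 0 < C ∧ ∀ s : ℂ, δ ≤ s.re → s.re ≤ L →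
      LogHolder (diffKernel a U s) (C * (1 + ‖s‖) ^ 4) := by
  obtain ⟨C, hC, h⟩ := exists_norm_diffKernel_sub_le (L := L) hU hUa hδ
  exact ⟨C, hC, fun s h1 h2 => h s h1 h2⟩

/-- The constant in front of the transform in `kernelN`. -/
def transformConst (a U : ℝ) : ℂ :=
  Complex.I * (U : ℂ) / ((2 * (1 - mach a U ^ 2) : ℝ) : ℂ) * -(1 / (Real.pi : ℂ))

open Classical in
/-- The kernel `kernelN`, modified on the diagonal and on the boundary of the square. -/
def regKernelN (a U : ℝ) (s : ℂ) (x y : ℝ) : ℂ :=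
  if x ∈ Ioo (-1 : ℝ) 1 ∧ y ∈ Ioo (-1 : ℝ) 1 ∧ x ≠ y then
    transformConst a U * transform (diffKernel a U s) x y else 0

/-- The endpoints $\pm1$ are not values of $\tanh$, and the transform is controlled only for $x\ne
y$. Neither exception affects the determinant. -/
theorem kernelN_eq {a U : ℝ} (hU : 0 < U) (hUa : U < a) {s : ℂ} (hs : 0 < s.re) {x y : ℝ}
    (hx : x ∉ ({-1, 1} : Set ℝ)) (hy : y ∉ ({-1, 1} : Set ℝ)) (hxy : x ≠ y) :
    kernelN a U s x y = regKernelN a U s x y := by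
  have hmem : ∀ z : ℝ, z ∉ ({-1, 1} : Set ℝ) → z ∈ Icc (-1 : ℝ) 1 → z ∈ Ioo (-1 : ℝ) 1 := by
    intro z hz hz2
    simp only [mem_insert_iff, mem_singleton_iff, not_or] at hz
    exact ⟨lt_of_le_of_ne hz2.1 (Ne.symm hz.1), lt_of_le_of_ne hz2.2 hz.2⟩
  by_cases h : x ∈ Icc (-1 : ℝ) 1 ∧ y ∈ Icc (-1 : ℝ) 1
  · have hx' := hmem x hx h.1
    have hy' := hmem y hy h.2
    obtain ⟨C, hC, hk⟩ := exists_logHolder_diffKernel (L := s.re) hU hUa hs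
    rw [kernelN, if_pos h, regKernelN, if_pos ⟨hx', hy', hxy⟩, transformConst,
      ← (hk s le_rfl le_rfl).pvIntegral_eq (by positivity) (measurable_diffKernel a U s) hx' hy' hxy,
      ← mul_assoc]
    congr 1
    refine pvIntegral_congr (x := x) fun u hu hux => ?_
    rw [kernelK_eq hU hUa hs h.1 hu hux.symm]
  · rw [kernelN, if_neg h, regKernelN,
      if_neg fun h' => h ⟨Ioo_subset_Icc_self h'.1, Ioo_subset_Icc_self h'.2.1⟩]

theorem exists_norm_regKernelN_le {a U : ℝ} (hU : 0 < U) (hUa : U < a) {δ L : ℝ} (hδ : 0 < δ) :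
    ∃ C : ℝ, 0 ≤ C ∧ ∀ s : ℂ, δ ≤ s.re → s.re ≤ L → ∀ x y : ℝ,
      ‖regKernelN a U s x y‖ ≤ C * (1 + ‖s‖) ^ 4 := by
  obtain ⟨C, hC, hk⟩ := exists_logHolder_diffKernel (L := L) hU hUa hδ
  set W := ∫ v in Ioi 0, transformWeight 1 v with hW
  have hW0 : 0 ≤ W := by
    refine setIntegral_nonneg measurableSet_Ioi fun v _ => ?_
    have h1 := logRatioWeight_nonneg ((1 : ℝ)⁻¹ * v)
    have h2 := decayWeight_nonneg (1 / 2) v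
    rw [transformWeight]; positivity
  refine ⟨‖transformConst a U‖ * (C * W), by positivity, fun s h1 h2 x y => ?_⟩
  rw [regKernelN]
  split_ifs with h
  · obtain ⟨hx, hy, hxy⟩ := h
    have hcb : Real.artanh x ≠ Real.artanh y := fun e =>
      hxy (by rw [← Real.tanh_artanh hx, ← Real.tanh_artanh hy, e])
    have := (hk s h1 h2).norm_transform_le (by positivity) hcb
    rw [Real.tanh_artanh hx, Real.tanh_artanh hy] at this
    rw [norm_mul]
    calc _ ≤ ‖transformConst a U‖ * (C * (1 + ‖s‖) ^ 4 * W) := by gcongr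
      _ = _ := by ring
  · rw [norm_zero]; positivity

theorem measurable_regKernelN (a U : ℝ) (s : ℂ) :
    Measurable (Function.uncurry (regKernelN a U s)) := by
  have hk := measurable_diffKernel a U s
  have ht := continuous_tanh.measurable
  have ha : Measurable Real.artanh := by unfold Real.artanh; fun_prop
  have h1 : Measurable fun q : (ℝ × ℝ) × ℝ =>
      transformIntegrand (diffKernel a U s) q.1.1 (Real.artanh q.1.2) q.2 := by
    unfold transformIntegrand
    fun_prop
  have h2 : Measurable fun p : ℝ × ℝ => transform (diffKernel a U s) p.1 p.2 :=
    (StronglyMeasurable.integral_prod_right (ν := volume.restrict (Ioi (0 : ℝ)))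
      (f := fun (p : ℝ × ℝ) v => transformIntegrand (diffKernel a U s) p.1 (Real.artanh p.2) v)
      h1.stronglyMeasurable).measurable
  refine Measurable.ite ?_ (h2.const_mul _) measurable_const
  exact ((measurableSet_Ioo.preimage measurable_fst).inter
    ((measurableSet_Ioo.preimage measurable_snd).inter
      (isOpen_ne_fun continuous_fst continuous_snd).measurableSet))

theorem isOpen_re_pos : IsOpen {s : ℂ | 0 < s.re} := isOpen_lt continuous_const Complex.continuous_re

/-- Near a point of the right half plane the real part and the norm are under control. -/
theorem ball_bounds {s₀ s : ℂ} (hs : s ∈ Metric.ball s₀ (s₀.re / 2)) :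
    s₀.re / 2 ≤ s.re ∧ s.re ≤ 2 * s₀.re ∧ ‖s‖ ≤ ‖s₀‖ + s₀.re / 2 := by
  rw [Metric.mem_ball, dist_eq_norm] at hs
  have h1 := (Complex.abs_re_le_norm (s - s₀)).trans hs.le
  rw [Complex.sub_re, abs_le] at h1
  have h2 : ‖s‖ ≤ ‖s₀‖ + ‖s - s₀‖ := norm_le_norm_add_norm_sub' s s₀
  exact ⟨by linarith [h1.1], by linarith [h1.1, h1.2], by linarith⟩

/-- For fixed $x\ne y$ the integrand is holomorphic in $s$ away from two values of $v$, and the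
transform weight dominates it locally uniformly in $s$. -/
theorem differentiableOn_regKernelN {a U : ℝ} (hU : 0 < U) (hUa : U < a) (x y : ℝ) :
    DifferentiableOn ℂ (fun s => regKernelN a U s x y) {s | 0 < s.re} := by
  unfold regKernelN
  split_ifs with h
  swap
  · exact differentiableOn_const 0
  obtain ⟨hx, hy, hxy⟩ := h
  set c := Real.artanh x with hc
  set b := Real.artanh y with hb
  have hyb : Real.tanh b = y := Real.tanh_artanh hy
  have hxc : Real.tanh c = x := Real.tanh_artanh hx
  have hcb : c ≠ b := fun h => hxy (by rw [← hxc, ← hyb, h])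
  have hω := abs_pos.2 (sub_ne_zero.2 hcb)
  refine DifferentiableOn.const_mul ?_ _
  unfold transform
  rw [← hb, ← hxc]
  refine differentiableOn_integral_of_dominated isOpen_re_pos (fun s _ =>
    (measurable_transformIntegrand (measurable_diffKernel a U s) _ _).aestronglyMeasurable) ?_ ?_
  · refine ae_restrict_of_ae ?_
    filter_upwards [ae_ne (b - c), ae_ne (c - b)] with v h1 h2
    have n1 : b - v ≠ c := fun h => h1 (by linarith)
    have n2 : b + v ≠ c := fun h => h2 (by linarith)
    have d1 := differentiableOn_diffKernel hU hUa (tanh_sub_tanh_mem c (b - v))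
      (tanh_sub_tanh_ne_zero n1.symm)
    have d2 := differentiableOn_diffKernel hU hUa (tanh_sub_tanh_mem c (b + v))
      (tanh_sub_tanh_ne_zero n2.symm)
    exact (d1.sub d2).div_const _
  · intro s₀ hs₀
    have hs₀' : 0 < s₀.re := hs₀
    have hhalf : 0 < s₀.re / 2 := by linarith
    obtain ⟨C, hC, hk⟩ := exists_logHolder_diffKernel (L := 2 * s₀.re) hU hUa hhalf
    refine ⟨s₀.re / 2, hhalf, fun v => C * (1 + (‖s₀‖ + s₀.re / 2)) ^ 4 * transformWeight |c - b| v,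
      (integrableOn_transformWeight hω).const_mul _, ?_⟩
    rw [ae_restrict_iff' measurableSet_Ioi]
    filter_upwards [ae_ne |c - b|] with v hv hv0 s hs
    obtain ⟨b1, b2, b3⟩ := ball_bounds hs.1
    have hw : 0 ≤ transformWeight |c - b| v := by
      have h1 := logRatioWeight_nonneg (|c - b|⁻¹ * v)
      have h2 := decayWeight_nonneg (1 / 2) v
      rw [transformWeight]; positivity
    refine ((hk s b1 b2).norm_transformIntegrand_le (by positivity) hcb hv0 hv).trans ?_
    gcongr

theorem DN_eq {a U : ℝ} (hU : 0 < U) (hUa : U < a) {s : ℂ} (hs : 0 < s.re) :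
    DN a U s = fredholmDet (regKernelN a U s) :=
  fredholmDet_congr (S := {-1, 1}) (by simp) fun _ _ hx hy hxy => kernelN_eq hU hUa hs hx hy hxy

theorem regKernelN_eq_zero (a U : ℝ) (s : ℂ) (x y : ℝ) (hx : x ∉ Icc (-1 : ℝ) 1) :
    regKernelN a U s x y = 0 := by
  rw [regKernelN, if_neg fun h => hx (Ioo_subset_Icc_self h.1)]

theorem differentiableOn_DN {a U : ℝ} (hU : 0 < U) (hUa : U < a) :
    DifferentiableOn ℂ (DN a U) {s | 0 < s.re} := by
  refine DifferentiableOn.congr (f := fun s => fredholmDet (regKernelN a U s)) ?_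
    fun s hs => DN_eq hU hUa hs
  refine differentiableOn_fredholmDet isOpen_re_pos (fun s _ => measurable_regKernelN a U s)
    (regKernelN_eq_zero a U) (differentiableOn_regKernelN hU hUa) fun s₀ hs₀ => ?_
  have hs₀' : 0 < s₀.re := hs₀
  have hhalf : 0 < s₀.re / 2 := by linarith
  obtain ⟨C, hC, h⟩ := exists_norm_regKernelN_le (L := 2 * s₀.re) hU hUa hhalf
  refine ⟨s₀.re / 2, hhalf, C * (1 + (‖s₀‖ + s₀.re / 2)) ^ 4, by positivity, fun s hs x y => ?_⟩
  obtain ⟨b1, b2, b3⟩ := ball_bounds hs.1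
  refine (h s b1 b2 x y).trans ?_
  gcongr

/-- On vertical strips the determinant has order at most eight. -/
theorem exists_norm_DN_le {a U : ℝ} (hU : 0 < U) (hUa : U < a) {δ L : ℝ} (hδ : 0 < δ) :
    ∃ C : ℝ, 0 ≤ C ∧ ∃ p : ℕ, ∀ s : ℂ, δ ≤ s.re → s.re ≤ L →
      ‖DN a U s‖ ≤ Real.exp (C * (1 + |s.im|) ^ p) := by
  obtain ⟨C, hC, h⟩ := exists_norm_regKernelN_le (L := L) hU hUa hδ
  -- The exponent 8 is the square of the fourth-power kernel bound; the lower-bound argument only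
  -- needs some polynomial order.
  refine ⟨1 + 24 * (C * (1 + |L|) ^ 4) ^ 2, by positivity, 8, fun s h1 h2 => ?_⟩
  rw [DN_eq hU hUa (hδ.trans_le h1)]
  refine (norm_fredholmDet_le (by positivity) (h s h1 h2) (regKernelN_eq_zero a U s)).trans ?_
  refine Real.exp_le_exp.2 ?_
  have hn : 1 + ‖s‖ ≤ (1 + |L|) * (1 + |s.im|) := by
    have := Complex.norm_le_abs_re_add_abs_im s
    rw [abs_of_pos (hδ.trans_le h1)] at this
    nlinarith [le_abs_self L, abs_nonneg L, abs_nonneg s.im, mul_nonneg (abs_nonneg L) (abs_nonneg s.im)]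
  have h1' : (1 : ℝ) ≤ (1 + |s.im|) ^ 8 := one_le_pow₀ (by linarith [abs_nonneg s.im])
  calc 1 + 24 * (C * (1 + ‖s‖) ^ 4) ^ 2
      ≤ (1 + |s.im|) ^ 8 + 24 * (C * ((1 + |L|) * (1 + |s.im|)) ^ 4) ^ 2 := by gcongr
    _ = _ := by ring

end Possio

end

theorem lemma6p3 (a U : ℝ) (hU : 0 < U) (hUa : U < a) (σ₁ σ₂ : ℝ) (hσ₁ : 0 ≤ σ₁)
    (hD : ∀ s : ℂ, σ₁ < s.re → s.re < σ₂ → Possio.DN a U s ≠ 0)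
    (γ : ℝ) (hγ : 0 < γ) :
    ∃ C : ℝ, 0 < C ∧ ∀ s : ℂ, σ₁ + γ < s.re → s.re < σ₂ - γ →
      ‖1 / Possio.DN a U s‖ < Real.exp (C * Real.exp |s.im| * (1 + |s.im|) ^ 4) :=
  Possio.exists_norm_inv_lt_of_zero_free_strip hσ₁ hγ (Possio.differentiableOn_DN hU hUa)
    (fun _ _ hδ => Possio.exists_norm_DN_le hU hUa hδ) hD
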